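/- Let $\ell$ be a prime. Let $J=\begin{pmatrix}&&&1\\&&1&\\&-1&&\\-1&&&\end{pmatrix}$, let $G=\mathrm{GSp}_4\times_{\mathrm{GL}_1}\mathrm{GL}_2$ be the group of pairs $(g_1,g_2)$ with ${}^tg_1Jg_1=\mu J$ and $\mu=\det g_2$, write $\mu(g)=\det g_2$, and let $H=\mathrm{GL}_2\times_{\mathrm{GL}_1}\mathrm{GL}_2$ (pairs with equal determinants), embedded in $G$ by $$\left(\begin{pmatrix}a&b\\c&d\end{pmatrix},\begin{pmatrix}a'&b'\\c'&d'\end{pmatrix}\right)\mapsto\left(\begin{pmatrix}a&&&b\\&a'&b'&\\&c'&d'&\\c&&&d\end{pmatrix},\begin{pmatrix}a'&b'\\c'&d'\end{pmatrix}\right).$$ Let $\mathcal H(G)$ and $\mathcal H(H)$ be the spaces of locally constant compactly supported functions $G(\mathbb Q_\ell)\to\mathbb C$ and $H(\mathbb Q_\ell)\to\mathbb C$, and $\mathcal S(\mathbb Q_\ell^2)$ that of locally constant compactly supported functions $\mathbb Q_\ell^2\to\mathbb C$. Haar measures are normalized so that $G(\mathbb Z_\ell)$, $H(\mathbb Z_\ell)$,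 $\mathrm{GL}_2(\mathbb Z_\ell)$ have volume $1$. The algebra $\mathcal H(H)$ acts on $\mathcal S(\mathbb Q_\ell^2)$ from the left by $(f\phi)(x)=\int_{H(\mathbb Q_\ell)} f(h)\,\phi(x\cdot\mathrm{pr}_1(h))\,dh$ and on $\mathcal H(G)$ from the right by $(\xi f)(x)=\int_{H(\mathbb Q_\ell)} f(h)\,\xi(hx)\,dh$; the algebra $\mathcal H(G)$ acts on itself from the left by $(\xi_1\cdot\xi_2)(x)=\int_{G(\mathbb Q_\ell)}\xi_1(g)\,\xi_2(xg)\,dg$. Let $\sigma$ be a smooth complex representation of $G(\mathbb Q_\ell)$ with contragredient $\sigma^\vee$, and let $$\mathfrak Z\in\mathrm{Hom}_{\mathcal H(G)}\left(\mathcal S(\mathbb Q_\ell^2)\otimes_{\mathcal H(H)}\mathcal H(G),\ \sigma^\vee\right).$$ For integers $s\ge t\ge1$ let $\phi_{s,t}$ be the characteristic function of $\ell^s\mathbb Z_\ell\times(1+\ell^t\mathbb Z_\ell)$ and $K_1(\ell^s,\ell^t)$ the group of $\begin{pmatrix}a&b\\c&d\end{pmatrix}\in\mathrm{GL}_2(\mathbb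 Z_\ell)$ with $c\equiv0$ mod $\ell^s$ and $d\equiv1$ mod $\ell^t$. For $\xi\in\mathcal H(G)$ let $\mathfrak Z(\phi_\infty\otimes\xi)$ denote the eventually constant value, for all sufficiently large $s\ge t$, of $\mathrm{Vol}(K_1(\ell^s,\ell^t))^{-1}\,\mathfrak Z(\phi_{s,t}\otimes\xi)$. Let $K_{m,n}$ be the group of $g\in G(\mathbb Z_\ell)$ whose first component is congruent modulo $\ell^n$ to a matrix of the shape $\begin{pmatrix}*&*&*&*\\&*&*&*\\&*&*&*\\&&&*\end{pmatrix}$ and such that $\mu(g)\equiv1$ mod $\ell^m$. Let $U_i=\mathrm{ch}(K_{1,1}u_iK_{1,0})$, where $u_1,\dots,u_6$ are the pairs of diagonal matrices with entries $(\ell,\ell,1,1;\ell,1)$, $(\ell^2,\ell,\ell,1;\ell,\ell)$, $(\ell^2,\ell,\ell,1;\ell^2,1)$, $(\ell^2,\ell^2,1,1;\ell,\ell)$, $(\ell^3,\ell^2,\ell,1;\ell^2,\ell)$, $(\ell^4,\ell^2,\ell^2,1;\ell^2,\ell^2)$ respectively, and put $$\xi_0^{K_{1,0}}(\ell)=\mathrm{ch}(K_{1,0})-\ell^{-2}U_1+2\ell^{-3}U_2+\ell^{-3}U_3+\ell^{-3}U_4-\ell^{-4}U_5+\ell^{-4}U_6.$$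 Let $$\eta_{i,j}^{a,b,c}=\left(\begin{pmatrix}1&a\ell^{-i}&b\ell^{-i}&\\&1&&b\ell^{-i}\\&&1&-a\ell^{-i}\\&&&1\end{pmatrix},\begin{pmatrix}1&c\ell^{-j}\\&1\end{pmatrix}\right)\in G(\mathbb Q_\ell)$$ and $$\begin{aligned}\xi^{\mathrm{Simple}}=\ \ell(\ell-1)^3(\ell+1)^2\Big(&\mathrm{ch}(K_{1,0})-\mathrm{ch}(\eta_{1,0}^{1,0,0}K_{1,0})-\mathrm{ch}(\eta_{0,1}^{0,0,1}K_{1,0})+\ell\,\mathrm{ch}(\eta_{1,1}^{1,0,1}K_{1,0})\\&-(\ell-1)\,\mathrm{ch}(\eta_{1,1}^{0,1,1}K_{1,0})+\ell\,\mathrm{ch}(\eta_{2,1}^{-\ell,1,1}K_{1,0})\Big)\\&-\ell^2(\ell-1)^2(\ell+1)^2\,\mathrm{ch}(\eta_{2,1}^{0,1,1}K_{0,0}).\end{aligned}$$ Then the values $\mathfrak Z(\phi_\infty\otimes\xi_0^{K_{1,0}}(\ell))$ and $\mathfrak Z(\phi_\infty\otimes\xi^{\mathrm{Simple}})$ exist,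 and $$\mathfrak Z\left(\phi_\infty\otimes\xi_0^{K_{1,0}}(\ell)\right)=\frac{1}{\ell^4(\ell^2-1)}\,\mathfrak Z\left(\phi_\infty\otimes\xi^{\mathrm{Simple}}\right).$$ -/

import Mathlib

open scoped TensorProduct

noncomputable section

namespace GSp4Tame

/-! ### Locally constant functions with compact support -/

/-- The complex vector space of locally constant, compactly supported functions `X → ℂ`. -/
def LCC (X : Type*) [TopologicalSpace X] : Submodule ℂ (X → ℂ) where
  carrier := {f | IsLocallyConstant f ∧ HasCompactSupport f}
  zero_mem' := ⟨IsLocallyConstant.const 0, HasCompactSupport.zero⟩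
  add_mem' := fun hf hg => ⟨hf.1.add hg.1, hf.2.add hg.2⟩
  smul_mem' := fun c _ hf =>
    ⟨hf.1.comp (fun z => c • z), hf.2.comp_left (g := fun z => c • z) (smul_zero c)⟩

instance (X : Type*) [TopologicalSpace X] : AddCommGroup (LCC X) :=
  Submodule.addCommGroup _

/-- The characteristic function of a compact open set. -/
def ch {X : Type*} [TopologicalSpace X] [T2Space X] (S : TopologicalSpace.CompactOpens X) :
    LCC X :=
  ⟨Set.indicator (S : Set X) (fun _ => 1), by
    constructor
    · rw [IsLocallyConstant.iff_exists_open]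
      intro x
      by_cases hx : x ∈ (S : Set X)
      · exact ⟨S, S.isOpen, hx, fun y hy => by simp [Set.indicator, hx, hy]⟩
      · refine ⟨(S : Set X)ᶜ, S.isCompact.isClosed.isOpen_compl, hx, fun y hy => ?_⟩
        rw [Set.indicator_of_notMem hx, Set.indicator_of_notMem hy]
    · exact HasCompactSupport.intro S.isCompact
        (fun x hx => Set.indicator_of_notMem hx _)⟩

/-- If `Y` acts continuously and invertibly on `X`, then averaging a locally constant compactly
supported function on `X` against such a function on `Y` gives again such a function. -/
theorem average_mem {X Y : Type*} [TopologicalSpace X] [T2Space X] [TopologicalSpace Y]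
    {m : MeasurableSpace Y} (μ : MeasureTheory.Measure Y) (act inv : Y → X → X)
    (hact : Continuous (fun p : X × Y => act p.2 p.1))
    (hinv : Continuous (fun p : X × Y => inv p.2 p.1))
    (h : ∀ y x, inv y (act y x) = x) (f : LCC Y) (ψ : LCC X) :
    (fun x => ∫ y, f.1 y * ψ.1 (act y x) ∂μ) ∈ LCC X := by
  constructor
  · rw [IsLocallyConstant.iff_exists_open]
    intro x₀
    have hn : IsOpen {p : X × Y | ψ.1 (act p.2 p.1) = ψ.1 (act p.2 x₀)} := by
      have h1 : IsLocallyConstant (fun p : X × Y => ψ.1 (act p.2 p.1)) :=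
        ψ.2.1.comp_continuous hact
      have h2 : IsLocallyConstant (fun p : X × Y => ψ.1 (act p.2 x₀)) :=
        ψ.2.1.comp_continuous (f := fun p : X × Y => act p.2 x₀)
          (hact.comp (continuous_const.prodMk continuous_snd))
      have h3 : IsLocallyConstant
          (fun p : X × Y => ψ.1 (act p.2 p.1) - ψ.1 (act p.2 x₀)) := h1.sub h2
      convert h3.isOpen_fiber 0 using 1
      ext p
      exact sub_eq_zero.symm
    obtain ⟨u, v, hu, -, hxu, hv, huv⟩ := generalized_tube_lemma (isCompact_singleton (x := x₀))
      f.2.2 hn (by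
        rintro ⟨x, y⟩ ⟨hx, -⟩
        have hx' : x = x₀ := hx
        subst hx'
        rfl)
    refine ⟨u, hu, hxu rfl, fun x hx => ?_⟩
    refine MeasureTheory.integral_congr_ae (Filter.Eventually.of_forall fun y => ?_)
    by_cases hy : y ∈ tsupport f.1
    · have := huv (Set.mk_mem_prod hx (hv hy))
      simp only [Set.mem_ofPred_eq] at this
      simp only [this]
    · simp [image_eq_zero_of_notMem_tsupport hy]
  · refine HasCompactSupport.intro ((ψ.2.2.prod f.2.2).image hinv) fun x hx => ?_
    rw [← MeasureTheory.integral_zero Y ℂ (μ := μ)]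
    refine MeasureTheory.integral_congr_ae (Filter.Eventually.of_forall fun y => ?_)
    by_contra hne
    simp only [mul_eq_zero, not_or] at hne
    exact hx ⟨(act y x, y), ⟨subset_tsupport _ hne.2, subset_tsupport _ hne.1⟩, h y x⟩

/-! ### Haar measure -/

/-- The Haar measure (on the Borel sets) giving the compact neighbourhood `K` mass one. -/
def haarOne {X : Type*} [Group X] [TopologicalSpace X] [IsTopologicalGroup X]
    (K : TopologicalSpace.PositiveCompacts X) : @MeasureTheory.Measure X (borel X) :=
  letI : MeasurableSpace X := borel X
  haveI : BorelSpace X := ⟨rfl⟩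
  MeasureTheory.Measure.haarMeasure K

/-- A compact open set containing a point, as a compact set with non-empty interior. -/
def posCompact {X : Type*} [TopologicalSpace X] (S : TopologicalSpace.CompactOpens X)
    (h : (S : Set X).Nonempty) : TopologicalSpace.PositiveCompacts X :=
  ⟨S.toCompacts, by
    have : interior (S : Set X) = S := S.isOpen.interior_eq
    exact this.symm ▸ h⟩

/-! ### The groups -/

/-- The antidiagonal alternating form. -/
def J (R : Type*) [CommRing R] : Matrix (Fin 4) (Fin 4) R :=
  !![0, 0, 0, 1; 0, 0, 1, 0; 0, -1, 0, 0; -1, 0, 0, 0]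

/-- `GSp₄ ×_{GL₁} GL₂` over `R`: pairs `(g₁, g₂)` such that `g₁` is a symplectic similitude whose
multiplier is `det g₂`. -/
def GSub (R : Type*) [CommRing R] : Subgroup (GL (Fin 4) R × GL (Fin 2) R) where
  carrier := {g | g.1.1.transpose * J R * g.1.1 = g.2.1.det • J R}
  one_mem' := by simp
  mul_mem' := by
    intro a b ha hb
    simp only [Set.mem_ofPred_eq] at ha hb ⊢
    calc (a * b).1.1.transpose * J R * (a * b).1.1
        = b.1.1.transpose * (a.1.1.transpose * J R * a.1.1) * b.1.1 := by
          simp [Matrix.transpose_mul, Matrix.mul_assoc]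
      _ = (a * b).2.1.det • J R := by
          rw [ha]; simp [hb, smul_smul]
  inv_mem' := by
    intro a ha
    simp only [Set.mem_ofPred_eq] at ha ⊢
    have h1 : a.1.1 * (a⁻¹).1.1 = 1 := by
      rw [Prod.fst_inv, ← Units.val_mul, mul_inv_cancel, Units.val_one]
    have h1' : (a⁻¹).1.1.transpose * a.1.1.transpose = 1 := by
      rw [← Matrix.transpose_mul, h1, Matrix.transpose_one]
    have h2 : (a⁻¹).2.1.det * a.2.1.det = 1 := by
      rw [← Matrix.det_mul, Prod.snd_inv, ← Units.val_mul, inv_mul_cancel, Units.val_one,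
        Matrix.det_one]
    have h3 : J R = a.2.1.det • ((a⁻¹).1.1.transpose * J R * (a⁻¹).1.1) := by
      calc J R = ((a⁻¹).1.1.transpose * a.1.1.transpose) * J R * (a.1.1 * (a⁻¹).1.1) := by
            rw [h1, h1']; simp
        _ = (a⁻¹).1.1.transpose * (a.1.1.transpose * J R * a.1.1) * (a⁻¹).1.1 := by
            simp only [Matrix.mul_assoc]
        _ = _ := by rw [ha]; simp
    conv_rhs => rw [h3, smul_smul, h2, one_smul]

/-- `GL₂ ×_{GL₁} GL₂` over `R`: pairs of matrices with equal determinant. -/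
def HSub (R : Type*) [CommRing R] : Subgroup (GL (Fin 2) R × GL (Fin 2) R) where
  carrier := {h | h.1.1.det = h.2.1.det}
  one_mem' := by simp
  mul_mem' := by
    intro a b ha hb
    simp only [Set.mem_ofPred_eq] at ha hb ⊢
    simp [ha, hb]
  inv_mem' := by
    intro a ha
    simp only [Set.mem_ofPred_eq] at ha ⊢
    have : Matrix.GeneralLinearGroup.det a.1 = Matrix.GeneralLinearGroup.det a.2 :=
      Units.ext ha
    have h2 : Matrix.GeneralLinearGroup.det (a⁻¹).1 = Matrix.GeneralLinearGroup.det (a⁻¹).2 := by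
      simp [this]
    exact congrArg Units.val h2

/-- The group of `ℚ_ℓ`-points of `GSp₄ ×_{GL₁} GL₂`. -/
abbrev GQ (ℓ : ℕ) [Fact ℓ.Prime] : Type := GSub ℚ_[ℓ]

/-- The group of `ℚ_ℓ`-points of `GL₂ ×_{GL₁} GL₂`. -/
abbrev HQ (ℓ : ℕ) [Fact ℓ.Prime] : Type := HSub ℚ_[ℓ]

variable (ℓ : ℕ) [Fact ℓ.Prime]

/-- The `GSp₄`-component of the embedding of `H` in `G`. -/
def iotaMat : HQ ℓ →* Matrix (Fin 4) (Fin 4) ℚ_[ℓ] where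
  toFun h := !![h.1.1 0 0, 0, 0, h.1.1 0 1;
                0, h.1.2 0 0, h.1.2 0 1, 0;
                0, h.1.2 1 0, h.1.2 1 1, 0;
                h.1.1 1 0, 0, 0, h.1.1 1 1]
  map_one' := by
    ext i j; fin_cases i <;> fin_cases j <;> simp
  map_mul' := by
    intro a b
    ext i j
    fin_cases i <;> fin_cases j <;>
      simp [Matrix.mul_apply, Fin.sum_univ_succ]

/-- The embedding of `H = GL₂ ×_{GL₁} GL₂` in `G = GSp₄ ×_{GL₁} GL₂`. -/
def iota : HQ ℓ →* GQ ℓ where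
  toFun h := ⟨((iotaMat ℓ).toHomUnits h, h.1.2), by
    have hd : h.1.1.1.det = h.1.2.1.det := h.2
    rw [Matrix.det_fin_two, Matrix.det_fin_two] at hd
    change (iotaMat ℓ h).transpose * J _ * iotaMat ℓ h = h.1.2.1.det • J _
    rw [Matrix.det_fin_two]
    ext i j
    fin_cases i <;> fin_cases j <;>
      simp [iotaMat, J, Matrix.mul_apply, Fin.sum_univ_succ] <;>
      first
        | linear_combination hd
        | linear_combination -hd
        | ring⟩
  map_one' := by ext1; simp
  map_mul' := by intro a b; ext1; simp

theorem continuous_iota : Continuous (iota ℓ) := by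
  have hm : Continuous (iotaMat ℓ) := by
    have h1 : Continuous (fun h : HQ ℓ => h.1.1.1) := by fun_prop
    have h2 : Continuous (fun h : HQ ℓ => h.1.2.1) := by fun_prop
    refine continuous_matrix fun i j => ?_
    fin_cases i <;> fin_cases j <;> simp [iotaMat] <;>
      first
        | exact continuous_const
        | exact h1.matrix_elem _ _
        | exact h2.matrix_elem _ _
  refine Continuous.subtype_mk (Continuous.prodMk ?_ (by fun_prop)) _
  refine Units.continuous_iff.2 ⟨hm, ?_⟩
  have : (fun h : HQ ℓ => (((iotaMat ℓ).toHomUnits h)⁻¹).1) = fun h => iotaMat ℓ h⁻¹ := by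
    funext h
    rw [← map_inv]
    rfl
  rw [this]
  exact hm.comp continuous_inv

/-- An element of `G(ℚ_ℓ)` from its two matrices. -/
def mkG (A : Matrix (Fin 4) (Fin 4) ℚ_[ℓ]) (B : Matrix (Fin 2) (Fin 2) ℚ_[ℓ])
    (hB : B.det ≠ 0) (h : A.transpose * J ℚ_[ℓ] * A = B.det • J ℚ_[ℓ]) : GQ ℓ :=
  ⟨(Matrix.GeneralLinearGroup.mkOfDetNeZero A (by
      have hJ : (J ℚ_[ℓ]).det ≠ 0 := by
        simp [J, Matrix.det_succ_row_zero, Fin.sum_univ_succ, Fin.succAbove]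
      intro hA
      have := congrArg Matrix.det h
      rw [Matrix.det_mul, hA, mul_zero, Matrix.det_smul] at this
      exact mul_ne_zero (pow_ne_zero _ hB) hJ this.symm),
    Matrix.GeneralLinearGroup.mkOfDetNeZero B hB), h⟩

/-! ### Compact open subgroups -/

/-- `GL_n(ℤ_ℓ)` inside `GL_n(ℚ_ℓ)`. -/
def GLint (n : ℕ) : Set (GL (Fin n) ℚ_[ℓ]) :=
  {g | (∀ i j, ‖g i j‖ ≤ 1) ∧ ‖g.1.det‖ = 1}

theorem one_mem_GLint (n : ℕ) : (1 : GL (Fin n) ℚ_[ℓ]) ∈ GLint ℓ n := by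
  refine ⟨fun i j => ?_, by simp⟩
  by_cases h : i = j <;> simp [h]

theorem isClopen_GLint (n : ℕ) : IsClopen (GLint ℓ n) := by
  have hv : Continuous (fun g : GL (Fin n) ℚ_[ℓ] => g.1) := Units.continuous_val
  have h1 : IsClopen {x : ℚ_[ℓ] | ‖x‖ ≤ 1} := by
    simpa [Metric.closedBall, dist_eq_norm] using
      IsUltrametricDist.isClopen_closedBall (0 : ℚ_[ℓ]) one_ne_zero
  have h2 : IsClopen {x : ℚ_[ℓ] | ‖x‖ = 1} := by
    simpa [Metric.sphere, dist_eq_norm] using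
      IsUltrametricDist.isClopen_sphere (0 : ℚ_[ℓ]) one_ne_zero
  have h3 : GLint ℓ n = (⋂ i, ⋂ j, (fun g : GL (Fin n) ℚ_[ℓ] => g.1 i j) ⁻¹' {x | ‖x‖ ≤ 1}) ∩
      (fun g : GL (Fin n) ℚ_[ℓ] => g.1.det) ⁻¹' {x | ‖x‖ = 1} := by
    ext g
    simp [GLint]
  rw [h3]
  exact (isClopen_iInter_of_finite fun i => isClopen_iInter_of_finite fun j =>
    h1.preimage (hv.matrix_elem i j)).inter (h2.preimage hv.matrix_det)

theorem isCompact_GLint (n : ℕ) : IsCompact (GLint ℓ n) := by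
  have hc : Continuous (Units.map ((PadicInt.Coe.ringHom (p := ℓ)).mapMatrix (m := Fin n)).toMonoidHom) := by
    refine Continuous.units_map _ ?_
    refine continuous_matrix fun i j => ?_
    exact continuous_subtype_val.comp (continuous_id.matrix_elem i j)
  have : CompactSpace (Matrix (Fin n) (Fin n) ℤ_[ℓ]) :=
    inferInstanceAs (CompactSpace (Fin n → Fin n → ℤ_[ℓ]))
  refine (isCompact_range hc).of_isClosed_subset (isClopen_GLint ℓ n).1 ?_
  rintro g ⟨hg, hd⟩
  let A : Matrix (Fin n) (Fin n) ℤ_[ℓ] := fun i j => ⟨g i j, hg i j⟩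
  have hA : (PadicInt.Coe.ringHom (p := ℓ)).mapMatrix A = g.1 := by
    ext i j; rfl
  have hdet : ((A.det : ℤ_[ℓ]) : ℚ_[ℓ]) = g.1.det := by
    rw [← hA, ← RingHom.map_det]; rfl
  have hu : IsUnit A.det := by
    rw [PadicInt.isUnit_iff, PadicInt.norm_def, hdet]
    exact hd
  have hu' : IsUnit A := (Matrix.isUnit_iff_isUnit_det A).2 hu
  exact ⟨hu'.unit, Units.ext hA⟩

/-- `G(ℤ_ℓ)` inside `G(ℚ_ℓ)`. -/
def Gint : Set (GQ ℓ) := {g | g.1.1 ∈ GLint ℓ 4 ∧ g.1.2 ∈ GLint ℓ 2}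

/-- `H(ℤ_ℓ)` inside `H(ℚ_ℓ)`. -/
def Hint : Set (HQ ℓ) := {h | h.1.1 ∈ GLint ℓ 2 ∧ h.1.2 ∈ GLint ℓ 2}

theorem isClopen_Gint : IsClopen (Gint ℓ) :=
  ((isClopen_GLint ℓ 4).preimage (continuous_fst.comp continuous_subtype_val)).inter
    ((isClopen_GLint ℓ 2).preimage (continuous_snd.comp continuous_subtype_val))

theorem isClopen_Hint : IsClopen (Hint ℓ) :=
  ((isClopen_GLint ℓ 2).preimage (continuous_fst.comp continuous_subtype_val)).inter
    ((isClopen_GLint ℓ 2).preimage (continuous_snd.comp continuous_subtype_val))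

theorem isCompact_Gint : IsCompact (Gint ℓ) := by
  have hcl : IsClosed (GSub ℚ_[ℓ] : Set (GL (Fin 4) ℚ_[ℓ] × GL (Fin 2) ℚ_[ℓ])) := by
    have h1 : Continuous (fun g : GL (Fin 4) ℚ_[ℓ] × GL (Fin 2) ℚ_[ℓ] => g.1.1) := by fun_prop
    have h2 : Continuous (fun g : GL (Fin 4) ℚ_[ℓ] × GL (Fin 2) ℚ_[ℓ] => g.2.1) := by fun_prop
    exact isClosed_eq ((h1.matrix_transpose.matrix_mul continuous_const).matrix_mul h1)
      (h2.matrix_det.smul continuous_const)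
  exact hcl.isClosedEmbedding_subtypeVal.isCompact_preimage
    ((isCompact_GLint ℓ 4).prod (isCompact_GLint ℓ 2))

theorem isCompact_Hint : IsCompact (Hint ℓ) := by
  have hcl : IsClosed (HSub ℚ_[ℓ] : Set (GL (Fin 2) ℚ_[ℓ] × GL (Fin 2) ℚ_[ℓ])) := by
    have h1 : Continuous (fun g : GL (Fin 2) ℚ_[ℓ] × GL (Fin 2) ℚ_[ℓ] => g.1.1) := by fun_prop
    have h2 : Continuous (fun g : GL (Fin 2) ℚ_[ℓ] × GL (Fin 2) ℚ_[ℓ] => g.2.1) := by fun_prop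
    exact isClosed_eq h1.matrix_det h2.matrix_det
  exact hcl.isClosedEmbedding_subtypeVal.isCompact_preimage
    ((isCompact_GLint ℓ 2).prod (isCompact_GLint ℓ 2))

/-- Haar measure on `GL₂(ℚ_ℓ)` with `Vol GL₂(ℤ_ℓ) = 1`. -/
def haarGL2 : @MeasureTheory.Measure (GL (Fin 2) ℚ_[ℓ]) (borel _) :=
  haarOne (posCompact ⟨⟨GLint ℓ 2, isCompact_GLint ℓ 2⟩, (isClopen_GLint ℓ 2).2⟩
    ⟨1, one_mem_GLint ℓ 2⟩)

/-- Haar measure on `G(ℚ_ℓ)` with `Vol G(ℤ_ℓ) = 1`. -/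
def haarG : @MeasureTheory.Measure (GQ ℓ) (borel _) :=
  haarOne (posCompact ⟨⟨Gint ℓ, isCompact_Gint ℓ⟩, (isClopen_Gint ℓ).2⟩
    ⟨1, one_mem_GLint ℓ 4, one_mem_GLint ℓ 2⟩)

/-- Haar measure on `H(ℚ_ℓ)` with `Vol H(ℤ_ℓ) = 1`. -/
def haarH : @MeasureTheory.Measure (HQ ℓ) (borel _) :=
  haarOne (posCompact ⟨⟨Hint ℓ, isCompact_Hint ℓ⟩, (isClopen_Hint ℓ).2⟩
    ⟨1, one_mem_GLint ℓ 2, one_mem_GLint ℓ 2⟩)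

theorem isClopen_le {X : Type*} [TopologicalSpace X] (F : X → ℚ_[ℓ]) (hF : Continuous F)
    (n : ℕ) : IsClopen {x | ‖F x‖ ≤ (ℓ : ℝ) ^ (-(n : ℤ))} := by
  have hpos : (ℓ : ℝ) ^ (-(n : ℤ)) ≠ 0 :=
    zpow_ne_zero _ (Nat.cast_ne_zero.2 (Fact.out : ℓ.Prime).ne_zero)
  have h1 : IsClopen {x : ℚ_[ℓ] | ‖x‖ ≤ (ℓ : ℝ) ^ (-(n : ℤ))} := by
    simpa [Metric.closedBall, dist_eq_norm] using
      IsUltrametricDist.isClopen_closedBall (0 : ℚ_[ℓ]) hpos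
  exact h1.preimage hF

/-- The subgroup `K_{m,n}` of `G(ℤ_ℓ)`: modulo `ℓ^n` the first component has the block shape
`(* * * *; 0 * * *; 0 * * *; 0 0 0 *)`, and the multiplier is `1` modulo `ℓ^m`. -/
def Kset (m n : ℕ) : Set (GQ ℓ) :=
  {g | g ∈ Gint ℓ ∧
    (‖g.1.1 1 0‖ ≤ (ℓ : ℝ) ^ (-(n : ℤ)) ∧ ‖g.1.1 2 0‖ ≤ (ℓ : ℝ) ^ (-(n : ℤ)) ∧
      ‖g.1.1 3 0‖ ≤ (ℓ : ℝ) ^ (-(n : ℤ)) ∧ ‖g.1.1 3 1‖ ≤ (ℓ : ℝ) ^ (-(n : ℤ)) ∧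
      ‖g.1.1 3 2‖ ≤ (ℓ : ℝ) ^ (-(n : ℤ))) ∧
    ‖g.1.2.1.det - 1‖ ≤ (ℓ : ℝ) ^ (-(m : ℤ))}

theorem isClopen_Kset (m n : ℕ) : IsClopen (Kset ℓ m n) := by
  have h1 : Continuous (fun g : GQ ℓ => g.1.1.1) := by fun_prop
  have h2 : Continuous (fun g : GQ ℓ => g.1.2.1.det - 1) :=
    (Continuous.matrix_det (by fun_prop)).sub continuous_const
  have e (i j : Fin 4) := isClopen_le ℓ _ (h1.matrix_elem i j) n
  exact (isClopen_Gint ℓ).inter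
    (((e 1 0).inter ((e 2 0).inter ((e 3 0).inter ((e 3 1).inter (e 3 2))))).inter
      (isClopen_le ℓ _ h2 m))

/-- `K_{m,n}` as a compact open subset of `G(ℚ_ℓ)`. -/
def K (m n : ℕ) : TopologicalSpace.CompactOpens (GQ ℓ) :=
  ⟨⟨Kset ℓ m n, (isCompact_Gint ℓ).of_isClosed_subset (isClopen_Kset ℓ m n).1 fun _ h => h.1⟩,
    (isClopen_Kset ℓ m n).2⟩

/-- The coset `g S`. -/
def coset (g : GQ ℓ) (S : TopologicalSpace.CompactOpens (GQ ℓ)) :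
    TopologicalSpace.CompactOpens (GQ ℓ) :=
  ⟨⟨(fun x => g * x) '' S, S.isCompact.image (continuous_const_mul g)⟩,
    isOpenMap_mul_left g _ S.isOpen⟩

/-- The double coset `S u T`. -/
def doubleCoset (S : TopologicalSpace.CompactOpens (GQ ℓ)) (u : GQ ℓ)
    (T : TopologicalSpace.CompactOpens (GQ ℓ)) : TopologicalSpace.CompactOpens (GQ ℓ) :=
  ⟨⟨(fun p : GQ ℓ × GQ ℓ => p.1 * u * p.2) '' ((S : Set (GQ ℓ)) ×ˢ (T : Set (GQ ℓ))),
      (S.isCompact.prod T.isCompact).image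
        ((continuous_fst.mul continuous_const).mul continuous_snd)⟩, by
    have : (fun p : GQ ℓ × GQ ℓ => p.1 * u * p.2) '' ((S : Set (GQ ℓ)) ×ˢ (T : Set (GQ ℓ)))
        = ⋃ a ∈ (S : Set (GQ ℓ)), (fun x => (a * u) * x) '' (T : Set (GQ ℓ)) := by
      ext x
      constructor
      · rintro ⟨⟨a, b⟩, ⟨ha, hb⟩, rfl⟩
        exact Set.mem_biUnion ha ⟨b, hb, rfl⟩
      · intro hx
        obtain ⟨a, ha, b, hb, rfl⟩ := Set.mem_iUnion₂.1 hx
        exact ⟨(a, b), ⟨ha, hb⟩, rfl⟩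
    change IsOpen (_ '' _)
    rw [this]
    exact isOpen_biUnion fun a _ => isOpenMap_mul_left (a * u) _ T.isOpen⟩

/-- The subgroup `K_1(ℓ^s, ℓ^t)` of `GL₂(ℤ_ℓ)`: bottom row congruent to `(0, 1)` modulo
`(ℓ^s, ℓ^t)`. -/
def K1GL2 (s t : ℕ) : Set (GL (Fin 2) ℚ_[ℓ]) :=
  {g | g ∈ GLint ℓ 2 ∧ ‖g 1 0‖ ≤ (ℓ : ℝ) ^ (-(s : ℤ)) ∧ ‖g 1 1 - 1‖ ≤ (ℓ : ℝ) ^ (-(t : ℤ))}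

/-! ### Schwartz functions, Hecke algebras and their actions -/

/-- The Schwartz space of `ℚ_ℓ²`. -/
abbrev Schwartz : Type := LCC (Fin 2 → ℚ_[ℓ])

/-- The Hecke algebra of `G(ℚ_ℓ)`. -/
abbrev HeckeG : Type := LCC (GQ ℓ)

/-- The Hecke algebra of `H(ℚ_ℓ)`. -/
abbrev HeckeH : Type := LCC (HQ ℓ)

/-- The action of the Hecke algebra of `H` on Schwartz functions coming from
`(h φ)(x) = φ(x · pr₁ h)` (row vectors). -/
def actS (f : HeckeH ℓ) (φ : Schwartz ℓ) : Schwartz ℓ :=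
  ⟨fun x => ∫ h, f.1 h * φ.1 (Matrix.vecMul x h.1.1.1) ∂(haarH ℓ),
    average_mem (haarH ℓ) (fun h x => Matrix.vecMul x h.1.1.1)
      (fun h x => Matrix.vecMul x (h⁻¹).1.1.1)
      (continuous_fst.matrix_vecMul (by fun_prop))
      (continuous_fst.matrix_vecMul (by fun_prop))
      (fun h x => by
        have : h.1.1.1 * (h⁻¹).1.1.1 = 1 := by
          change (h.1.1 * (h.1.1)⁻¹).1 = 1
          simp
        simp only [Matrix.vecMul_vecMul, this, Matrix.vecMul_one]) f φ⟩

/-- The right action of the Hecke algebra of `H` on that of `G` coming from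
`(ξ h)(x) = ξ(ι(h) x)`. -/
def actR (ξ : HeckeG ℓ) (f : HeckeH ℓ) : HeckeG ℓ :=
  ⟨fun x => ∫ h, f.1 h * ξ.1 (iota ℓ h * x) ∂(haarH ℓ),
    average_mem (haarH ℓ) (fun h x => iota ℓ h * x) (fun h x => (iota ℓ h)⁻¹ * x)
      (((continuous_iota ℓ).comp continuous_snd).mul continuous_fst)
      (((continuous_iota ℓ).comp continuous_snd).inv.mul continuous_fst)
      (fun h x => by simp) f ξ⟩

/-- The left action of the Hecke algebra of `G` on itself coming from `(g ξ)(x) = ξ(x g)`. -/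
def actL (ξ₁ ξ₂ : HeckeG ℓ) : HeckeG ℓ :=
  ⟨fun x => ∫ g, ξ₁.1 g * ξ₂.1 (x * g) ∂(haarG ℓ),
    average_mem (haarG ℓ) (fun g x => x * g) (fun g x => x * g⁻¹)
      (by fun_prop) (by fun_prop) (fun g x => by simp) ξ₁ ξ₂⟩

/-- The relations `(f φ) ⊗ ξ = φ ⊗ (ξ f)`. -/
def balanced : Submodule ℂ (Schwartz ℓ ⊗[ℂ] HeckeG ℓ) :=
  Submodule.span ℂ {z | ∃ (f : HeckeH ℓ) (φ : Schwartz ℓ) (ξ : HeckeG ℓ),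
    z = actS ℓ f φ ⊗ₜ[ℂ] ξ - φ ⊗ₜ[ℂ] actR ℓ ξ f}

/-- The tensor product of the Schwartz space with the Hecke algebra of `G` over the Hecke
algebra of `H`. -/
abbrev HeckeTensor : Type := (Schwartz ℓ ⊗[ℂ] HeckeG ℓ) ⧸ balanced ℓ

/-- The pure tensor `φ ⊗ ξ`. -/
def tmul (φ : Schwartz ℓ) (ξ : HeckeG ℓ) : HeckeTensor ℓ :=
  (balanced ℓ).mkQ (φ ⊗ₜ[ℂ] ξ)

/-! ### Smooth representations and equivariant homomorphisms -/

/-- The subspace of vectors with open stabilizer. -/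
def smoothVectors {G V : Type*} [Group G] [TopologicalSpace G] [AddCommGroup V] [Module ℂ V]
    (σ : Representation ℂ G V) : Submodule ℂ V where
  carrier := {v | ∃ U : OpenSubgroup G, ∀ g ∈ U, σ g v = v}
  zero_mem' := ⟨⊤, fun g _ => map_zero _⟩
  add_mem' := by
    rintro v w ⟨U, hU⟩ ⟨U', hU'⟩
    exact ⟨U ⊓ U', fun g hg => by rw [map_add, hU g hg.1, hU' g hg.2]⟩
  smul_mem' := by
    rintro c v ⟨U, hU⟩
    exact ⟨U, fun g hg => by rw [map_smul, hU g hg]⟩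

/-- A representation is smooth if every vector has open stabilizer. -/
def IsSmooth {G V : Type*} [Group G] [TopologicalSpace G] [AddCommGroup V] [Module ℂ V]
    (σ : Representation ℂ G V) : Prop :=
  smoothVectors σ = ⊤

/-- The contragredient: smooth vectors of the dual representation `(g Φ)(v) = Φ(g⁻¹ v)`. -/
abbrev Contragredient {G V : Type*} [Group G] [TopologicalSpace G] [AddCommGroup V] [Module ℂ V]
    (σ : Representation ℂ G V) : Type _ :=
  smoothVectors σ.dual

/-- The action of the Hecke algebra of `G` on the contragredient, `ξ Φ = ∫ ξ(g) (g Φ) dg`,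
as a function on the space of `σ`. -/
def actDual {V : Type*} [AddCommGroup V] [Module ℂ V] (σ : Representation ℂ (GQ ℓ) V)
    (ξ : HeckeG ℓ) (Φ : Contragredient σ) : V → ℂ :=
  fun v => ∫ g, ξ.1 g * (σ.dual g Φ.1) v ∂(haarG ℓ)

/-- The linear maps from `S(ℚ_ℓ²) ⊗ H(G)` to the contragredient of `σ` that are linear over the
Hecke algebra of `G` (which acts on the second factor); it suffices to say this on pure tensors. -/
def heckeHom {V : Type*} [AddCommGroup V] [Module ℂ V] (σ : Representation ℂ (GQ ℓ) V) :
    Set (HeckeTensor ℓ →ₗ[ℂ] Contragredient σ) :=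
  {Z | ∀ (φ : Schwartz ℓ) (ξ₁ ξ₂ : HeckeG ℓ) (v : V),
    (Z (tmul ℓ φ (actL ℓ ξ₁ ξ₂))).1 v = actDual ℓ σ ξ₁ (Z (tmul ℓ φ ξ₂)) v}

/-! ### The functions `φ_{s,t}` and the value at `φ_∞` -/

/-- The support of `φ_{s,t}`. -/
def phiSet (s t : ℕ) : Set (Fin 2 → ℚ_[ℓ]) :=
  {x | ‖x 0‖ ≤ (ℓ : ℝ) ^ (-(s : ℤ)) ∧
    if 0 < t then ‖x 1 - 1‖ ≤ (ℓ : ℝ) ^ (-(t : ℤ))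
    else if 0 < s then ‖x 1‖ = 1
    else ‖x 1‖ ≤ 1}

theorem isClopen_phiSet (s t : ℕ) : IsClopen (phiSet ℓ s t) := by
  have h0 := isClopen_le ℓ (fun x : Fin 2 → ℚ_[ℓ] => x 0) (by fun_prop) s
  unfold phiSet
  split_ifs
  all_goals refine h0.inter ?_
  · exact isClopen_le ℓ (fun x : Fin 2 → ℚ_[ℓ] => x 1 - 1) (by fun_prop) t
  · have h2 : IsClopen {x : ℚ_[ℓ] | ‖x‖ = 1} := by
      simpa [Metric.sphere, dist_eq_norm] using
        IsUltrametricDist.isClopen_sphere (0 : ℚ_[ℓ]) one_ne_zero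
    exact h2.preimage (f := fun x : Fin 2 → ℚ_[ℓ] => x 1) (by fun_prop)
  · have h2 := isClopen_le ℓ (fun x : Fin 2 → ℚ_[ℓ] => x 1) (by fun_prop) 0
    simp only [Nat.cast_zero, neg_zero, zpow_zero] at h2
    exact h2

theorem isCompact_phiSet (s t : ℕ) : IsCompact (phiSet ℓ s t) := by
  have hℓ : (1 : ℝ) ≤ ℓ := by exact_mod_cast (Fact.out : ℓ.Prime).one_le
  have hle (n : ℕ) : (ℓ : ℝ) ^ (-(n : ℤ)) ≤ 1 := by
    rw [zpow_neg, zpow_natCast]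
    exact inv_le_one_of_one_le₀ (one_le_pow₀ hℓ)
  refine (isCompact_closedBall (0 : Fin 2 → ℚ_[ℓ]) 2).of_isClosed_subset
    (isClopen_phiSet ℓ s t).1 fun x hx => ?_
  obtain ⟨h0, h1⟩ := hx
  have h1' : ‖x 1‖ ≤ 2 := by
    split_ifs at h1
    · calc ‖x 1‖ = ‖(x 1 - 1) + 1‖ := by rw [sub_add_cancel]
        _ ≤ ‖x 1 - 1‖ + ‖(1 : ℚ_[ℓ])‖ := norm_add_le _ _
        _ ≤ 2 := by rw [norm_one]; linarith [hle t]
    · linarith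
    · linarith
  rw [mem_closedBall_zero_iff, pi_norm_le_iff_of_nonneg (by norm_num)]
  intro i
  fin_cases i
  · exact (h0.trans (hle s)).trans (by norm_num)
  · exact h1'

/-- The Schwartz function `φ_{s,t}`: the characteristic function of `ℓ^s ℤ_ℓ × (1 + ℓ^t ℤ_ℓ)` if
`t > 0`, of `ℓ^s ℤ_ℓ × ℤ_ℓ^×` if `s > 0 = t`, and of `ℤ_ℓ × ℤ_ℓ` if `s = t = 0`. -/
def phi (s t : ℕ) : Schwartz ℓ :=
  ch ⟨⟨phiSet ℓ s t, isCompact_phiSet ℓ s t⟩, (isClopen_phiSet ℓ s t).2⟩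

/-- `w` is the value `Z(φ_∞ ⊗ ξ)`: the eventually constant value, for `s ≥ t` large, of
`Vol(K_1(ℓ^s, ℓ^t))⁻¹ Z(φ_{s,t} ⊗ ξ)`. -/
def HasValueAtPhiInfty {W : Type*} [AddCommGroup W] [Module ℂ W] (Z : HeckeTensor ℓ →ₗ[ℂ] W)
    (ξ : HeckeG ℓ) (w : W) : Prop :=
  ∃ T : ℕ, ∀ s t : ℕ, T ≤ t → t ≤ s →
    (((haarGL2 ℓ (K1GL2 ℓ s t)).toReal : ℂ)⁻¹) • Z (tmul ℓ (phi ℓ s t) ξ) = w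

/-! ### The two Hecke algebra elements -/

/-- The element of `G(ℚ_ℓ)` with diagonal components `(ℓ^a₀, ℓ^a₁, ℓ^a₂, ℓ^a₃)` and
`(ℓ^b₀, ℓ^b₁)`. -/
def diagG (a : Fin 4 → ℕ) (b : Fin 2 → ℕ) (h₀ : a 0 + a 3 = b 0 + b 1)
    (h₁ : a 1 + a 2 = b 0 + b 1) : GQ ℓ :=
  mkG ℓ (Matrix.diagonal fun i => (ℓ : ℚ_[ℓ]) ^ a i) (Matrix.diagonal fun i => (ℓ : ℚ_[ℓ]) ^ b i)
    (by
      have hℓ : (ℓ : ℚ_[ℓ]) ≠ 0 := Nat.cast_ne_zero.2 (Fact.out : ℓ.Prime).ne_zero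
      simp [Matrix.det_diagonal, Fin.prod_univ_two, hℓ])
    (by
      have e0 : (ℓ : ℚ_[ℓ]) ^ a 0 * (ℓ : ℚ_[ℓ]) ^ a 3 = (ℓ : ℚ_[ℓ]) ^ b 0 * (ℓ : ℚ_[ℓ]) ^ b 1 := by
        rw [← pow_add, ← pow_add, h₀]
      have e1 : (ℓ : ℚ_[ℓ]) ^ a 1 * (ℓ : ℚ_[ℓ]) ^ a 2 = (ℓ : ℚ_[ℓ]) ^ b 0 * (ℓ : ℚ_[ℓ]) ^ b 1 := by
        rw [← pow_add, ← pow_add, h₁]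
      rw [Matrix.det_diagonal, Fin.prod_univ_two]
      ext i j
      fin_cases i <;> fin_cases j <;>
        simp [J, Matrix.diagonal_mul, Matrix.mul_diagonal] <;>
        first
          | linear_combination e0
          | linear_combination e1)

/-- The diagonal element `u₁` of `G(ℚ_ℓ)`. -/
def u₁ : GQ ℓ := diagG ℓ ![1, 1, 0, 0] ![1, 0] rfl rfl
/-- The diagonal element `u₂` of `G(ℚ_ℓ)`. -/
def u₂ : GQ ℓ := diagG ℓ ![2, 1, 1, 0] ![1, 1] rfl rfl
/-- The diagonal element `u₃` of `G(ℚ_ℓ)`. -/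
def u₃ : GQ ℓ := diagG ℓ ![2, 1, 1, 0] ![2, 0] rfl rfl
/-- The diagonal element `u₄` of `G(ℚ_ℓ)`. -/
def u₄ : GQ ℓ := diagG ℓ ![2, 2, 0, 0] ![1, 1] rfl rfl
/-- The diagonal element `u₅` of `G(ℚ_ℓ)`. -/
def u₅ : GQ ℓ := diagG ℓ ![3, 2, 1, 0] ![2, 1] rfl rfl
/-- The diagonal element `u₆` of `G(ℚ_ℓ)`. -/
def u₆ : GQ ℓ := diagG ℓ ![4, 2, 2, 0] ![2, 2] rfl rfl

/-- The unipotent element `η_{i,j}^{a,b,c}`. -/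
def eta (i j : ℕ) (a b c : ℚ_[ℓ]) : GQ ℓ :=
  mkG ℓ
    !![1, a / (ℓ : ℚ_[ℓ]) ^ i, b / (ℓ : ℚ_[ℓ]) ^ i, 0;
       0, 1, 0, b / (ℓ : ℚ_[ℓ]) ^ i;
       0, 0, 1, -a / (ℓ : ℚ_[ℓ]) ^ i;
       0, 0, 0, 1]
    !![1, c / (ℓ : ℚ_[ℓ]) ^ j; 0, 1]
    (by simp [Matrix.det_fin_two])
    (by
      rw [Matrix.det_fin_two]
      ext p q
      fin_cases p <;> fin_cases q <;>
        simp [J, Matrix.mul_apply, Fin.sum_univ_succ] <;> ring)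

/-- The Hecke operator `ch(K_{m,n} u K_{1,0})`, which for `u = u₁, …, u₆` does not depend on
`m, n ≥ 1`; here `m = n = 1`. -/
def U (u : GQ ℓ) : HeckeG ℓ := ch (doubleCoset ℓ (K ℓ 1 1) u (K ℓ 1 0))

/-- The element `ξ₀` of level `K_{1,0}`. -/
def xi₀ : HeckeG ℓ :=
  ch (K ℓ 1 0)
    - ((ℓ : ℂ) ^ 2)⁻¹ • U ℓ (u₁ ℓ)
    + (2 * ((ℓ : ℂ) ^ 3)⁻¹) • U ℓ (u₂ ℓ)
    + ((ℓ : ℂ) ^ 3)⁻¹ • U ℓ (u₃ ℓ)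
    + ((ℓ : ℂ) ^ 3)⁻¹ • U ℓ (u₄ ℓ)
    - ((ℓ : ℂ) ^ 4)⁻¹ • U ℓ (u₅ ℓ)
    + ((ℓ : ℂ) ^ 4)⁻¹ • U ℓ (u₆ ℓ)

/-- The characteristic function of the coset `η_{i,j}^{a,b,c} K_{m,0}`. -/
def chEta (m i j : ℕ) (a b c : ℚ_[ℓ]) : HeckeG ℓ := ch (coset ℓ (eta ℓ i j a b c) (K ℓ m 0))

/-- The element `ξ^Simple`. -/
def xiSimple : HeckeG ℓ :=
  ((ℓ : ℂ) * ((ℓ : ℂ) - 1) ^ 3 * ((ℓ : ℂ) + 1) ^ 2) •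
      (ch (K ℓ 1 0)
        - chEta ℓ 1 1 0 1 0 0
        - chEta ℓ 1 0 1 0 0 1
        + (ℓ : ℂ) • chEta ℓ 1 1 1 1 0 1
        - ((ℓ : ℂ) - 1) • chEta ℓ 1 1 1 0 1 1
        + (ℓ : ℂ) • chEta ℓ 1 2 1 (-(ℓ : ℚ_[ℓ])) 1 1)
    - ((ℓ : ℂ) ^ 2 * ((ℓ : ℂ) - 1) ^ 2 * ((ℓ : ℂ) + 1) ^ 2) • chEta ℓ 0 2 1 0 1 1

end GSp4Tame

end

/-!
For a functional `Z` on the balanced tensor product, only its invariance under `H` matters. The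
function `φ_{s,t}` is a sum of `ℓ` translates of `φ_{s,t+1}`, and for `s < t` of `φ_{s+1,t}`, so
`Z(φ_{s,t} ⊗ ξ)` decays like `ℓ^{-(s+t)}` (`exists_phi_constant`), as does the volume of `K_1(ℓ^s,
ℓ^t)` (`exists_volume_constant`). Hence `Z(φ_∞ ⊗ ξ)` exists for every `ξ`, and at the cosets `g
K_{1,0}` it gives a function `z` on `G` that is right invariant under `K_{1,0}` and transforms
through `‖det‖` under the subgroup of `H` whose first component stabilizes the row vector `(0, 1)`
(`exists_cosetValue`). This subgroup contains the centre of the Heisenberg group and the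
diagonally embedded `GL₂` in the Levi subgroup of the Klingen parabolic. So `z` is determined by
its values `hval z p q m` at elements with Heisenberg coordinates `(p, q, 0)` and Levi component
`m`, where `m` may be read as a pair of lattices in `ℚ_ℓ²` up to the diagonal action of `GL₂`.

The Iwahori factorization of `K_{1,1}` (`exists_parabolic_of_mem_K11`) writes each of the six
double cosets as one or two orbits of the integral Heisenberg group and the diagonal `SL₂(ℤ_ℓ)`
(`mem_doubleCoset_iff_of_scalar_snd`, `mem_doubleCoset_iff_of_scalar_fst`,
`mem_doubleCoset_iff_of_diagonal`). Counting representatives turns the values of the Hecke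
operators into sums of `hval` over `ℓ^{-b}ℤ/ℤ × ℓ^{-a}ℤ/ℤ` (`IsEquivariant.sum_orbitRep`), in
which the two lattices either coincide (`m = 1`) or are at distance two (`m = gam`). In the first
case the value depends only on the order of `(p, q)` in `(ℚ_ℓ/ℤ_ℓ)²`, since `SL₂(ℤ_ℓ)` is
transitive on primitive vectors; in the second case the classes are those of `(0, 1/ℓⁿ)` with `n ≤
2` and of `(1/ℓ, c/ℓ²)` with `c` modulo `ℓ` (`IsEquivariant.hval_gam_unit`).

The unipotent elements `η` represent the same classes, by `IsEquivariant.hval_ups`, and the coset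
of `K_{0,0}` splits into `ℓ - 1` cosets of `K_{1,0}` that give the classes with `c ≠ 0`. Both
elements of the Hecke algebra thus become linear combinations of the same class values, and the
two combinations are proportional (`class_value_identity`).
-/

noncomputable section

namespace GSp4Tame

section Functionals

open Topology Filter

/-! ### Equivariance of balanced functionals -/

/-- A locally constant compactly supported function is fixed by all group elements near `1`. -/
theorem eventually_invariant {X Y : Type*} [TopologicalSpace X] [Group Y] [TopologicalSpace Y]
    [IsTopologicalGroup Y] (act : Y → X → X) (hact : Continuous fun p : X × Y => act p.2 p.1)
    (h1 : ∀ x, act 1 x = x) (hinv : ∀ y x, act y⁻¹ (act y x) = x) (f : LCC X) :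
    ∀ᶠ y in 𝓝 (1 : Y), ∀ x, f.1 (act y x) = f.1 x := by
  have hA : ∀ᶠ y in 𝓝 (1 : Y), ∀ x ∈ tsupport f.1, f.1 (act y x) = f.1 x := by
    have hn : IsOpen {p : X × Y | f.1 (act p.2 p.1) = f.1 p.1} := by
      have h3 : IsLocallyConstant (fun p : X × Y => f.1 (act p.2 p.1) - f.1 p.1) :=
        (f.2.1.comp_continuous hact).sub (f.2.1.comp_continuous continuous_fst)
      convert h3.isOpen_fiber 0 using 1
      ext p
      exact sub_eq_zero.symm
    obtain ⟨u, v, -, hv, hu, h1v, huv⟩ := generalized_tube_lemma f.2.2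
      (isCompact_singleton (x := (1 : Y))) hn (by
        rintro ⟨x, y⟩ ⟨-, hy⟩
        have hy' : y = 1 := hy
        subst hy'
        change f.1 (act 1 x) = f.1 x
        rw [h1])
    filter_upwards [hv.mem_nhds (h1v rfl)] with y hy x hx
    exact huv (Set.mk_mem_prod (hu hx) hy)
  have hB : ∀ᶠ y in 𝓝 (1 : Y), ∀ x ∈ tsupport f.1, f.1 (act y⁻¹ x) = f.1 x := by
    have : Tendsto (fun y : Y => y⁻¹) (𝓝 1) (𝓝 1) := by
      simpa using (continuous_inv (G := Y)).tendsto 1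
    exact this.eventually hA
  filter_upwards [hA, hB] with y hy hy' x
  by_cases hx : x ∈ tsupport f.1
  · exact hy x hx
  · rw [image_eq_zero_of_notMem_tsupport hx]
    by_contra hne
    have := hy' (act y x) (subset_tsupport _ hne)
    rw [hinv, image_eq_zero_of_notMem_tsupport hx] at this
    exact hne this.symm

variable (ℓ : ℕ) [Fact ℓ.Prime]

theorem vecMul_inv_cancel (h : HQ ℓ) (x : Fin 2 → ℚ_[ℓ]) :
    Matrix.vecMul (Matrix.vecMul x h.1.1.1) (h⁻¹).1.1.1 = x := by
  have : h.1.1.1 * (h⁻¹).1.1.1 = 1 := by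
    change (h.1.1 * (h.1.1)⁻¹).1 = 1
    simp
  rw [Matrix.vecMul_vecMul, this, Matrix.vecMul_one]

theorem vecMul_inv_cancel' (h : HQ ℓ) (x : Fin 2 → ℚ_[ℓ]) :
    Matrix.vecMul (Matrix.vecMul x (h⁻¹).1.1.1) h.1.1.1 = x := by
  simp

theorem continuous_vecMul_act :
    Continuous fun p : (Fin 2 → ℚ_[ℓ]) × HQ ℓ => Matrix.vecMul p.1 p.2.1.1.1 :=
  continuous_fst.matrix_vecMul (by fun_prop)

/-- The translate `x ↦ φ(x · pr₁ h)` of a Schwartz function. -/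
def translateS (h : HQ ℓ) : Schwartz ℓ →ₗ[ℂ] Schwartz ℓ where
  toFun φ := ⟨fun x => φ.1 (Matrix.vecMul x h.1.1.1), by
    have hc : Continuous fun x : Fin 2 → ℚ_[ℓ] => Matrix.vecMul x h.1.1.1 :=
      (continuous_vecMul_act ℓ).comp (continuous_id.prodMk continuous_const)
    have hc' : Continuous fun x : Fin 2 → ℚ_[ℓ] => Matrix.vecMul x (h⁻¹).1.1.1 :=
      (continuous_vecMul_act ℓ).comp (continuous_id.prodMk continuous_const)
    refine ⟨φ.2.1.comp_continuous hc, ?_⟩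
    exact φ.2.2.comp_homeomorph (φ :=
      ⟨⟨fun x => Matrix.vecMul x h.1.1.1, fun x => Matrix.vecMul x (h⁻¹).1.1.1,
        vecMul_inv_cancel ℓ h, vecMul_inv_cancel' ℓ h⟩, hc, hc'⟩)⟩
  map_add' _ _ := rfl
  map_smul' _ _ := rfl

/-- The translate `x ↦ ξ(ι(h) x)` of a function on `G`. -/
def translateG (h : HQ ℓ) (ξ : HeckeG ℓ) : HeckeG ℓ :=
  ⟨fun x => ξ.1 (iota ℓ h * x),
    ξ.2.1.comp_continuous (continuous_const_mul _),
    ξ.2.2.comp_homeomorph (φ := Homeomorph.mulLeft (iota ℓ h))⟩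

theorem translateS_one (φ : Schwartz ℓ) : translateS ℓ 1 φ = φ := by
  apply Subtype.ext; funext x
  change φ.1 (Matrix.vecMul x 1) = _
  rw [Matrix.vecMul_one]

theorem translateS_mul (h k : HQ ℓ) (φ : Schwartz ℓ) :
    translateS ℓ (h * k) φ = translateS ℓ h (translateS ℓ k φ) := by
  apply Subtype.ext; funext x
  change φ.1 (Matrix.vecMul x (h.1.1.1 * k.1.1.1)) =
    φ.1 (Matrix.vecMul (Matrix.vecMul x h.1.1.1) k.1.1.1)
  rw [Matrix.vecMul_vecMul]

theorem translateG_one (ξ : HeckeG ℓ) : translateG ℓ 1 ξ = ξ := by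
  apply Subtype.ext; funext x
  change ξ.1 (iota ℓ 1 * x) = _
  rw [map_one, one_mul]

theorem translateG_mul (h k : HQ ℓ) (ξ : HeckeG ℓ) :
    translateG ℓ (h * k) ξ = translateG ℓ k (translateG ℓ h ξ) := by
  apply Subtype.ext; funext x
  change ξ.1 (iota ℓ (h * k) * x) = ξ.1 (iota ℓ h * (iota ℓ k * x))
  rw [map_mul, mul_assoc]

/-- The elements of `H` fixing both a Schwartz function and a function on `G`. -/
def fixer (φ : Schwartz ℓ) (ξ : HeckeG ℓ) : Subgroup (HQ ℓ) where
  carrier := {u | translateS ℓ u φ = φ ∧ translateG ℓ u ξ = ξ}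
  one_mem' := ⟨translateS_one ℓ φ, translateG_one ℓ ξ⟩
  mul_mem' := by
    rintro a b ⟨ha, ha'⟩ ⟨hb, hb'⟩
    exact ⟨by rw [translateS_mul, hb, ha], by rw [translateG_mul, ha', hb']⟩
  inv_mem' := by
    rintro a ⟨ha, ha'⟩
    constructor
    · calc translateS ℓ a⁻¹ φ = translateS ℓ a⁻¹ (translateS ℓ a φ) := by rw [ha]
        _ = φ := by rw [← translateS_mul, inv_mul_cancel, translateS_one]
    · calc translateG ℓ a⁻¹ ξ = translateG ℓ a⁻¹ (translateG ℓ a ξ) := by rw [ha']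
        _ = ξ := by rw [← translateG_mul, mul_inv_cancel, translateG_one]

theorem isOpen_fixer (φ : Schwartz ℓ) (ξ : HeckeG ℓ) : IsOpen (fixer ℓ φ ξ : Set (HQ ℓ)) := by
  refine Subgroup.isOpen_of_mem_nhds _ (g := 1) ?_
  have h1 := eventually_invariant (fun (h : HQ ℓ) x => Matrix.vecMul x h.1.1.1)
    (continuous_vecMul_act ℓ) (fun x => Matrix.vecMul_one x) (vecMul_inv_cancel ℓ) φ
  have h2 := eventually_invariant (fun (h : HQ ℓ) (x : GQ ℓ) => iota ℓ h * x)
    (((continuous_iota ℓ).comp continuous_snd).mul continuous_fst) (by simp) (by simp) ξ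
  filter_upwards [h1, h2] with u hu hu'
  exact ⟨Subtype.ext (funext hu), Subtype.ext (funext hu')⟩

/-- A functional on the balanced tensor product is invariant under the group `H`: testing the
balancing relation on the characteristic function of a small coset `h U` gives the relation for
the point mass at `h`. -/
theorem apply_tmul_translate {W : Type*} [AddCommGroup W] [Module ℂ W]
    (Z : HeckeTensor ℓ →ₗ[ℂ] W) (h : HQ ℓ) (φ : Schwartz ℓ) (ξ : HeckeG ℓ) :
    Z (tmul ℓ (translateS ℓ h φ) ξ) = Z (tmul ℓ φ (translateG ℓ h ξ)) := by
  let _ : MeasurableSpace (HQ ℓ) := borel _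
  have _ : BorelSpace (HQ ℓ) := ⟨rfl⟩
  set ξ' := translateG ℓ h ξ with hξ'
  let A : Set (HQ ℓ) := (fun x => h * x) '' (Hint ℓ ∩ fixer ℓ φ ξ')
  have hclosed : IsClosed (fixer ℓ φ ξ' : Set (HQ ℓ)) :=
    Subgroup.isClosed_of_isOpen _ (isOpen_fixer ℓ φ ξ')
  have hAc : IsCompact A :=
    ((isCompact_Hint ℓ).inter_right hclosed).image (continuous_const_mul h)
  have hAo : IsOpen A :=
    isOpenMap_mul_left h _ ((isClopen_Hint ℓ).2.inter (isOpen_fixer ℓ φ ξ'))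
  have hAn : A.Nonempty :=
    ⟨h * 1, 1, ⟨⟨one_mem_GLint ℓ 2, one_mem_GLint ℓ 2⟩, one_mem _⟩, rfl⟩
  let f : HeckeH ℓ := ch ⟨⟨A, hAc⟩, hAo⟩
  let c : ℂ := ((haarH ℓ).real A : ℂ)
  have hHaar : (haarH ℓ).IsHaarMeasure := by unfold haarH haarOne; infer_instance
  have hc : c ≠ 0 := by
    have h1 : haarH ℓ A ≠ 0 := (hAo.measure_pos _ hAn).ne'
    have h2 : haarH ℓ A ≠ ⊤ := hAc.measure_lt_top.ne
    exact Complex.ofReal_ne_zero.2 (ENNReal.toReal_ne_zero.2 ⟨h1, h2⟩)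
  have key (F : HQ ℓ → ℂ) (v : ℂ) (hF : ∀ y ∈ A, F y = v) :
      ∫ y, f.1 y * F y ∂(haarH ℓ) = c * v := by
    have : (fun y => f.1 y * F y) = A.indicator (fun _ => v) := by
      funext y
      change A.indicator (fun _ => (1 : ℂ)) y * F y = _
      by_cases hy : y ∈ A
      · rw [Set.indicator_of_mem hy, Set.indicator_of_mem hy, hF y hy, one_mul]
      · rw [Set.indicator_of_notMem hy, Set.indicator_of_notMem hy, zero_mul]
    rw [this, MeasureTheory.integral_indicator_const _ hAo.measurableSet]
    simp [c]
  have e1 : actS ℓ f φ = c • translateS ℓ h φ := by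
    apply Subtype.ext; funext x
    refine key _ (φ.1 (Matrix.vecMul x h.1.1.1)) ?_
    rintro _ ⟨u, ⟨-, hu⟩, rfl⟩
    have := congrFun (congrArg Subtype.val hu.1) (Matrix.vecMul x h.1.1.1)
    change φ.1 (Matrix.vecMul (Matrix.vecMul x h.1.1.1) u.1.1.1) = _ at this
    rw [Matrix.vecMul_vecMul] at this
    exact this
  have e2 : actR ℓ ξ f = c • ξ' := by
    apply Subtype.ext; funext x
    refine key _ (ξ'.1 x) ?_
    rintro _ ⟨u, ⟨-, hu⟩, rfl⟩
    have := congrFun (congrArg Subtype.val hu.2) x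
    change ξ.1 (iota ℓ h * (iota ℓ u * x)) = _ at this
    rw [← mul_assoc, ← map_mul] at this
    exact this
  have e3 : tmul ℓ (actS ℓ f φ) ξ = tmul ℓ φ (actR ℓ ξ f) := by
    rw [tmul, tmul, ← sub_eq_zero, ← map_sub]
    exact (Submodule.Quotient.mk_eq_zero _).2 (Submodule.subset_span ⟨f, φ, ξ, rfl⟩)
  rw [e1, e2] at e3
  have e4 : c • Z (tmul ℓ (translateS ℓ h φ) ξ) = c • Z (tmul ℓ φ ξ') := by
    rw [← map_smul, ← map_smul]
    simp only [tmul] at e3 ⊢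
    rw [← map_smul, ← map_smul, TensorProduct.smul_tmul', ← TensorProduct.tmul_smul]
    rw [e3]
  exact smul_right_injective _ hc e4

/-! ### Integrality and digits in `ℚ_ℓ` -/

variable {ℓ} in
theorem norm_add_le_of_le {x y : ℚ_[ℓ]} {r : ℝ} (hx : ‖x‖ ≤ r) (hy : ‖y‖ ≤ r) : ‖x + y‖ ≤ r :=
  (IsUltrametricDist.norm_add_le_max x y).trans (max_le hx hy)

variable {ℓ} in
theorem norm_sub_le_of_le {x y : ℚ_[ℓ]} {r : ℝ} (hx : ‖x‖ ≤ r) (hy : ‖y‖ ≤ r) : ‖x - y‖ ≤ r := by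
  rw [sub_eq_add_neg]
  exact norm_add_le_of_le hx (by rwa [norm_neg])

theorem prime_ne_zero : (ℓ : ℚ_[ℓ]) ≠ 0 := Nat.cast_ne_zero.2 (Fact.out : ℓ.Prime).ne_zero

theorem prime_real_pos : (0 : ℝ) < ℓ := Nat.cast_pos.2 (Fact.out : ℓ.Prime).pos

theorem zpow_neg_le_one (n : ℕ) : (ℓ : ℝ) ^ (-(n : ℤ)) ≤ 1 := by
  rw [zpow_neg, zpow_natCast]
  exact inv_le_one_of_one_le₀ (one_le_pow₀ (by exact_mod_cast (Fact.out : ℓ.Prime).one_le))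

theorem zpow_neg_lt_one {n : ℕ} (hn : 1 ≤ n) : (ℓ : ℝ) ^ (-(n : ℤ)) < 1 := by
  rw [zpow_neg, zpow_natCast]
  exact inv_lt_one_of_one_lt₀
    (one_lt_pow₀ (by exact_mod_cast (Fact.out : ℓ.Prime).one_lt) (by omega))

theorem zpow_neg_anti {m n : ℕ} (h : m ≤ n) : (ℓ : ℝ) ^ (-(n : ℤ)) ≤ (ℓ : ℝ) ^ (-(m : ℤ)) :=
  zpow_le_zpow_right₀ (by exact_mod_cast (Fact.out : ℓ.Prime).one_le) (by omega)

theorem norm_prime_pow (n : ℕ) : ‖(ℓ : ℚ_[ℓ]) ^ n‖ = (ℓ : ℝ) ^ (-(n : ℤ)) := by simp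

variable {ℓ} in
/-- Membership in `ℓ^n ℤ_ℓ` as integrality of a quotient. -/
theorem norm_le_zpow_iff {x : ℚ_[ℓ]} {n : ℕ} :
    ‖x‖ ≤ (ℓ : ℝ) ^ (-(n : ℤ)) ↔ ‖x / (ℓ : ℚ_[ℓ]) ^ n‖ ≤ 1 := by
  rw [norm_div, norm_prime_pow, div_le_one (zpow_pos (prime_real_pos ℓ) _)]

variable {ℓ} in
/-- Approximation of a `p`-adic integer by one of the residues `0, …, ℓⁿ - 1`. -/
theorem exists_digit {x : ℚ_[ℓ]} (hx : ‖x‖ ≤ 1) (n : ℕ) :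
    ∃ j : Fin (ℓ ^ n), ‖x - (j : ℕ)‖ ≤ (ℓ : ℝ) ^ (-(n : ℤ)) := by
  let y : ℤ_[ℓ] := ⟨x, hx⟩
  refine ⟨⟨y.appr n, y.appr_lt n⟩, ?_⟩
  have := (PadicInt.norm_le_pow_iff_mem_span_pow _ _).2 (PadicInt.appr_spec n y)
  rwa [PadicInt.norm_def, PadicInt.coe_sub, PadicInt.coe_natCast] at this

variable {ℓ} in
theorem digit_unique {n : ℕ} {i j : Fin (ℓ ^ n)}
    (h : ‖((i : ℕ) : ℚ_[ℓ]) - (j : ℕ)‖ ≤ (ℓ : ℝ) ^ (-(n : ℤ))) : i = j := by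
  have h' : ‖(((i : ℤ) - (j : ℤ) : ℤ) : ℚ_[ℓ])‖ ≤ (ℓ : ℝ) ^ (-(n : ℤ)) := by
    exact_mod_cast h
  rw [Padic.norm_int_le_pow_iff_dvd] at h'
  have hi := i.2
  have hj := j.2
  have := Int.eq_zero_of_abs_lt_dvd h' (by
    rw [abs_lt]
    have hi' : (i : ℤ) < (ℓ : ℤ) ^ n := by exact_mod_cast hi
    have hj' : (j : ℤ) < (ℓ : ℤ) ^ n := by exact_mod_cast hj
    constructor <;> omega)
  exact Fin.ext (by omega)

/-! ### The dependence on `s` and `t` -/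

theorem indicator_eq_sum {X ι : Type*} [Fintype ι] {S : Set X} {T : ι → Set X}
    (h : ∀ x, x ∈ S ↔ ∃ i, x ∈ T i) (hd : ∀ x i j, x ∈ T i → x ∈ T j → i = j) (x : X) :
    S.indicator (fun _ => (1 : ℂ)) x = ∑ i, (T i).indicator (fun _ => (1 : ℂ)) x := by
  by_cases hx : x ∈ S
  · obtain ⟨i, hi⟩ := (h x).1 hx
    rw [Set.indicator_of_mem hx, Finset.sum_eq_single i, Set.indicator_of_mem hi]
    · intro j _ hj
      exact Set.indicator_of_notMem (fun hjx => hj (hd x j i hjx hi)) _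
    · simp
  · rw [Set.indicator_of_notMem hx]
    exact (Finset.sum_eq_zero fun i _ =>
      Set.indicator_of_notMem (fun hi => hx ((h x).2 ⟨i, hi⟩)) _).symm

variable {ℓ} in
/-- The lower triangular unipotent matrix with entry `c`. -/
def lowerGL (c : ℚ_[ℓ]) : GL (Fin 2) ℚ_[ℓ] :=
  ⟨!![1, 0; c, 1], !![1, 0; -c, 1], by simp [Matrix.one_fin_two], by simp [Matrix.one_fin_two]⟩

variable {ℓ} in
/-- The matrix `diag(1, δ)`. -/
def diagGL (δ : ℚ_[ℓ]ˣ) : GL (Fin 2) ℚ_[ℓ] :=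
  ⟨!![1, 0; 0, δ], !![1, 0; 0, (δ⁻¹ : ℚ_[ℓ]ˣ)], by simp [Matrix.one_fin_two],
    by simp [Matrix.one_fin_two]⟩

theorem continuous_lowerGL : Continuous (lowerGL (ℓ := ℓ)) := by
  refine Units.continuous_iff.2 ⟨?_, ?_⟩ <;>
  · refine continuous_matrix fun i j => ?_
    fin_cases i <;> fin_cases j <;> simp [lowerGL] <;> fun_prop

theorem continuous_diagGL : Continuous (diagGL (ℓ := ℓ)) := by
  refine Units.continuous_iff.2 ⟨?_, ?_⟩ <;>
  · refine continuous_matrix fun i j => ?_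
    fin_cases i <;> fin_cases j <;> simp [diagGL, -Units.val_inv_eq_inv_val] <;>
      first
        | exact continuous_const
        | exact Units.continuous_val
        | exact Units.continuous_val.comp continuous_inv

variable {ℓ} in
/-- The pair `(h, h)`. -/
def diagonalH (h : GL (Fin 2) ℚ_[ℓ]) : HQ ℓ := ⟨(h, h), rfl⟩

theorem continuous_diagonalH : Continuous (diagonalH (ℓ := ℓ)) :=
  (continuous_id.prodMk continuous_id).subtype_mk _

/-- An open condition on `H` holding at `1` holds for all sufficiently small unipotent and
torus elements. -/
theorem exists_level {P : HQ ℓ → Prop} (hP : ∀ᶠ h in 𝓝 (1 : HQ ℓ), P h) :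
    ∃ N : ℕ, 1 ≤ N ∧ (∀ c : ℚ_[ℓ], ‖c‖ ≤ (ℓ : ℝ) ^ (-(N : ℤ)) → P (diagonalH (lowerGL c))) ∧
      ∀ δ : ℚ_[ℓ]ˣ, ‖(δ : ℚ_[ℓ]) - 1‖ ≤ (ℓ : ℝ) ^ (-(N : ℤ)) → P (diagonalH (diagGL δ)) := by
  have hball (x : ℚ_[ℓ]) (A : Set ℚ_[ℓ]) (hA : A ∈ 𝓝 x) :
      ∃ N : ℕ, ∀ y, ‖y - x‖ ≤ (ℓ : ℝ) ^ (-(N : ℤ)) → y ∈ A := by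
    obtain ⟨ε, hε, hA⟩ := Metric.mem_nhds_iff.1 hA
    obtain ⟨N, hN⟩ := exists_pow_lt_of_lt_one hε
      (inv_lt_one_of_one_lt₀ (show (1 : ℝ) < ℓ by exact_mod_cast (Fact.out : ℓ.Prime).one_lt))
    refine ⟨N, fun y hy => hA ?_⟩
    rw [Metric.mem_ball, dist_eq_norm]
    refine hy.trans_lt ?_
    rwa [zpow_neg, zpow_natCast, ← inv_pow]
  have h1 : ∀ᶠ c in 𝓝 (0 : ℚ_[ℓ]), P (diagonalH (lowerGL c)) := by
    have hc := ((continuous_diagonalH ℓ).comp (continuous_lowerGL ℓ)).tendsto 0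
    have e : (diagonalH ∘ lowerGL) (0 : ℚ_[ℓ]) = 1 := by
      apply Subtype.ext
      have : lowerGL (0 : ℚ_[ℓ]) = 1 := Units.ext (by simp [lowerGL, Matrix.one_fin_two])
      simp [diagonalH, this]
    rw [e] at hc
    exact hc.eventually hP
  have h2 : ∀ᶠ δ in 𝓝 (1 : ℚ_[ℓ]ˣ), P (diagonalH (diagGL δ)) := by
    have hc := ((continuous_diagonalH ℓ).comp (continuous_diagGL ℓ)).tendsto 1
    have e : (diagonalH ∘ diagGL) (1 : ℚ_[ℓ]ˣ) = 1 := by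
      apply Subtype.ext
      have : diagGL (1 : ℚ_[ℓ]ˣ) = 1 := Units.ext (by simp [diagGL, Matrix.one_fin_two])
      simp [diagonalH, this]
    rw [e] at hc
    exact hc.eventually hP
  obtain ⟨N₁, hN₁⟩ := hball 0 _ h1
  rw [Units.isEmbedding_val₀.nhds_eq_comap] at h2
  obtain ⟨A, hA, hAP⟩ := Filter.mem_comap.1 h2
  obtain ⟨N₂, hN₂⟩ := hball _ A hA
  refine ⟨max (max N₁ N₂) 1, le_max_right _ _, fun c hc => hN₁ c ?_, fun δ hδ => hAP (hN₂ δ ?_)⟩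
  · rw [sub_zero]
    exact hc.trans (zpow_neg_anti ℓ ((le_max_left _ _).trans (le_max_left _ _)))
  · exact hδ.trans (zpow_neg_anti ℓ ((le_max_right _ _).trans (le_max_left _ _)))

variable {ℓ} in
/-- The inverse of the unit `1 + j ℓ^t`. -/
theorem exists_unit_inv {t : ℕ} (ht : 1 ≤ t) (j : ℕ) : ∃ δ : ℚ_[ℓ]ˣ, ‖(δ : ℚ_[ℓ])‖ = 1 ∧
    (δ : ℚ_[ℓ]) * (1 + j * (ℓ : ℚ_[ℓ]) ^ t) = 1 ∧ ‖(δ : ℚ_[ℓ]) - 1‖ ≤ (ℓ : ℝ) ^ (-(t : ℤ)) := by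
  have hs : ‖(j : ℚ_[ℓ]) * (ℓ : ℚ_[ℓ]) ^ t‖ ≤ (ℓ : ℝ) ^ (-(t : ℤ)) := by
    rw [norm_mul, norm_prime_pow]
    refine mul_le_of_le_one_left (zpow_pos (prime_real_pos ℓ) _).le ?_
    exact_mod_cast Padic.norm_int_le_one (j : ℤ)
  have h1 : ‖1 + (j : ℚ_[ℓ]) * (ℓ : ℚ_[ℓ]) ^ t‖ = 1 := by
    have hlt := hs.trans_lt (zpow_neg_lt_one ℓ ht)
    rw [IsUltrametricDist.norm_add_eq_max_of_norm_ne_norm (by rw [norm_one]; exact hlt.ne'),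
      norm_one, max_eq_left hlt.le]
  have hne : 1 + (j : ℚ_[ℓ]) * (ℓ : ℚ_[ℓ]) ^ t ≠ 0 := by
    rw [← norm_ne_zero_iff, h1]; exact one_ne_zero
  refine ⟨(Units.mk0 _ hne)⁻¹, by simp [h1], by simp [hne], ?_⟩
  have : ((Units.mk0 _ hne)⁻¹ : ℚ_[ℓ]ˣ).1 - 1
      = -((j : ℚ_[ℓ]) * (ℓ : ℚ_[ℓ]) ^ t) / (1 + (j : ℚ_[ℓ]) * (ℓ : ℚ_[ℓ]) ^ t) := by
    rw [Units.val_inv_eq_inv_val, Units.val_mk0]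
    field_simp
    ring
  rwa [this, norm_div, h1, div_one, norm_neg]

variable {ℓ} in
/-- A ball of radius `ℓ^{-t}` is the disjoint union of `ℓ` balls of radius `ℓ^{-(t+1)}`. -/
theorem ball_split {x a : ℚ_[ℓ]} {t : ℕ} (ha : ‖a‖ = 1) :
    ‖x‖ ≤ (ℓ : ℝ) ^ (-(t : ℤ)) ↔
      ∃ j : Fin (ℓ ^ 1), ‖x - (j : ℕ) * (ℓ : ℚ_[ℓ]) ^ t * a‖ ≤ (ℓ : ℝ) ^ (-((t + 1 : ℕ) : ℤ)) := by
  have ha0 : a ≠ 0 := by rw [← norm_ne_zero_iff, ha]; exact one_ne_zero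
  have hp := pow_ne_zero t (prime_ne_zero ℓ)
  have hpos := zpow_pos (prime_real_pos ℓ) (-(t : ℤ))
  have key (j : ℕ) : ‖x - j * (ℓ : ℚ_[ℓ]) ^ t * a‖
      = ‖x / ((ℓ : ℚ_[ℓ]) ^ t * a) - j‖ * (ℓ : ℝ) ^ (-(t : ℤ)) := by
    have : x - j * (ℓ : ℚ_[ℓ]) ^ t * a
        = (x / ((ℓ : ℚ_[ℓ]) ^ t * a) - j) * ((ℓ : ℚ_[ℓ]) ^ t * a) := by
      field_simp
    rw [this, norm_mul, norm_mul, ha, mul_one, norm_prime_pow]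
  have hz : (ℓ : ℝ) ^ (-((t + 1 : ℕ) : ℤ)) = (ℓ : ℝ) ^ (-((1 : ℕ) : ℤ)) * (ℓ : ℝ) ^ (-(t : ℤ)) := by
    rw [← zpow_add₀ (prime_real_pos ℓ).ne']
    congr 1
    push_cast; ring
  simp only [key, hz, mul_le_mul_iff_left₀ hpos]
  constructor
  · intro hx
    apply exists_digit
    rw [norm_div, norm_mul, ha, mul_one, norm_prime_pow, div_le_one hpos]
    exact hx
  · rintro ⟨j, hj⟩
    have h1 : ‖x / ((ℓ : ℚ_[ℓ]) ^ t * a)‖ ≤ 1 := by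
      have h2 : ‖((j : ℕ) : ℚ_[ℓ])‖ ≤ 1 := by
        exact_mod_cast Padic.norm_int_le_one ((j : ℕ) : ℤ)
      have := norm_add_le_of_le (hj.trans (zpow_neg_le_one ℓ 1)) h2
      rwa [sub_add_cancel] at this
    rwa [norm_div, norm_mul, ha, mul_one, norm_prime_pow, div_le_one hpos] at h1

variable {ℓ} in
theorem ball_split_unique {x a : ℚ_[ℓ]} {t : ℕ} (ha : ‖a‖ = 1) {i j : Fin (ℓ ^ 1)}
    (hi : ‖x - (i : ℕ) * (ℓ : ℚ_[ℓ]) ^ t * a‖ ≤ (ℓ : ℝ) ^ (-((t + 1 : ℕ) : ℤ)))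
    (hj : ‖x - (j : ℕ) * (ℓ : ℚ_[ℓ]) ^ t * a‖ ≤ (ℓ : ℝ) ^ (-((t + 1 : ℕ) : ℤ))) : i = j := by
  apply digit_unique
  have := norm_sub_le_of_le hj hi
  have e : x - (j : ℕ) * (ℓ : ℚ_[ℓ]) ^ t * a - (x - (i : ℕ) * (ℓ : ℚ_[ℓ]) ^ t * a)
      = (((i : ℕ) : ℚ_[ℓ]) - (j : ℕ)) * ((ℓ : ℚ_[ℓ]) ^ t * a) := by ring
  have hz : (ℓ : ℝ) ^ (-((t + 1 : ℕ) : ℤ)) = (ℓ : ℝ) ^ (-((1 : ℕ) : ℤ)) * (ℓ : ℝ) ^ (-(t : ℤ)) := by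
    rw [← zpow_add₀ (prime_real_pos ℓ).ne']
    congr 1
    push_cast; ring
  rw [e, norm_mul, norm_mul, ha, mul_one, norm_prime_pow, hz] at this
  exact le_of_mul_le_mul_right this (zpow_pos (prime_real_pos ℓ) _)

theorem mem_phiSet {s t : ℕ} (ht : 1 ≤ t) (x : Fin 2 → ℚ_[ℓ]) : x ∈ phiSet ℓ s t ↔
    ‖x 0‖ ≤ (ℓ : ℝ) ^ (-(s : ℤ)) ∧ ‖x 1 - 1‖ ≤ (ℓ : ℝ) ^ (-(t : ℤ)) := by
  simp only [phiSet, Set.mem_ofPred_eq, if_pos (show 0 < t from ht)]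

theorem vecMul_lowerGL (x : Fin 2 → ℚ_[ℓ]) (c : ℚ_[ℓ]) :
    Matrix.vecMul x (diagonalH (lowerGL c)).1.1.1 = ![x 0 + c * x 1, x 1] := by
  change Matrix.vecMul x !![1, 0; c, 1] = _
  ext i
  fin_cases i <;> simp [Matrix.vecMul, dotProduct, Fin.sum_univ_two, mul_comm]

theorem vecMul_diagGL (x : Fin 2 → ℚ_[ℓ]) (δ : ℚ_[ℓ]ˣ) :
    Matrix.vecMul x (diagonalH (diagGL δ)).1.1.1 = ![x 0, δ * x 1] := by
  change Matrix.vecMul x !![1, 0; 0, (δ : ℚ_[ℓ])] = _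
  ext i
  fin_cases i <;> simp [Matrix.vecMul, dotProduct, Fin.sum_univ_two, mul_comm]

variable {ℓ} in
theorem unit_split {t : ℕ} {y δ : ℚ_[ℓ]} {j : ℕ} (hδ : ‖δ‖ = 1)
    (hj : δ * (1 + j * (ℓ : ℚ_[ℓ]) ^ t) = 1) {r : ℝ} :
    ‖δ * y - 1‖ ≤ r ↔ ‖(y - 1) - j * (ℓ : ℚ_[ℓ]) ^ t * 1‖ ≤ r := by
  have : δ * y - 1 = δ * ((y - 1) - j * (ℓ : ℚ_[ℓ]) ^ t * 1) := by
    linear_combination hj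
  rw [this, norm_mul, hδ, one_mul]

section Functional

variable {ℓ} {W : Type*} [AddCommGroup W] [Module ℂ W] {L : Schwartz ℓ →ₗ[ℂ] W} {N : ℕ}

/-- `φ_{s,t}` is the sum of `ℓ` translates of `φ_{s,t+1}` by elements `diag(1, δ)` with `δ` in
`1 + ℓ^t ℤ_ℓ`. -/
theorem phi_step_right (hN : 1 ≤ N)
    (hL : ∀ δ : ℚ_[ℓ]ˣ, ‖(δ : ℚ_[ℓ]) - 1‖ ≤ (ℓ : ℝ) ^ (-(N : ℤ)) →
      ∀ φ, L (translateS ℓ (diagonalH (diagGL δ)) φ) = L φ)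
    (s : ℕ) {t : ℕ} (ht : N ≤ t) : L (phi ℓ s t) = (ℓ : ℂ) • L (phi ℓ s (t + 1)) := by
  choose δ hδ1 hδ2 hδ3 using fun j : Fin (ℓ ^ 1) =>
    exists_unit_inv (ℓ := ℓ) (hN.trans ht) (j : ℕ)
  have e : phi ℓ s t
      = ∑ j, translateS ℓ (diagonalH (diagGL (δ j))) (phi ℓ s (t + 1)) := by
    apply Subtype.ext
    funext x
    rw [AddSubmonoidClass.coe_finsetSum, Finset.sum_apply]
    have hT (j : Fin (ℓ ^ 1)) : x ∈ {x | Matrix.vecMul x (diagonalH (diagGL (δ j))).1.1.1 ∈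
        phiSet ℓ s (t + 1)} ↔ ‖x 0‖ ≤ (ℓ : ℝ) ^ (-(s : ℤ)) ∧
        ‖(x 1 - 1) - (j : ℕ) * (ℓ : ℚ_[ℓ]) ^ t * 1‖ ≤ (ℓ : ℝ) ^ (-((t + 1 : ℕ) : ℤ)) := by
      rw [Set.mem_ofPred_eq, mem_phiSet ℓ (by omega), vecMul_diagGL]
      simp only [Matrix.cons_val_zero, Matrix.cons_val_one]
      rw [unit_split (hδ1 j) (hδ2 j)]
    have hS : (phiSet ℓ s t).indicator (fun _ => (1 : ℂ)) x = ∑ j,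
        ({x | Matrix.vecMul x (diagonalH (diagGL (δ j))).1.1.1 ∈ phiSet ℓ s (t + 1)} :
          Set (Fin 2 → ℚ_[ℓ])).indicator (fun _ => (1 : ℂ)) x := by
      by_cases hx : ‖x 0‖ ≤ (ℓ : ℝ) ^ (-(s : ℤ)) ∧ ‖x 1 - 1‖ ≤ (ℓ : ℝ) ^ (-(t : ℤ))
      · obtain ⟨j, hj⟩ := (ball_split norm_one).1 hx.2
        rw [Set.indicator_of_mem ((mem_phiSet ℓ (hN.trans ht) x).2 hx),
          Finset.sum_eq_single j, Set.indicator_of_mem ((hT j).2 ⟨hx.1, hj⟩)]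
        · intro i _ hij
          exact Set.indicator_of_notMem
            (fun hi => hij (ball_split_unique norm_one ((hT i).1 hi).2 hj)) _
        · simp
      · rw [Set.indicator_of_notMem (fun h => hx ((mem_phiSet ℓ (hN.trans ht) x).1 h))]
        refine (Finset.sum_eq_zero fun j _ => Set.indicator_of_notMem (fun hj => hx ?_) _).symm
        exact ⟨((hT j).1 hj).1, (ball_split norm_one).2 ⟨j, ((hT j).1 hj).2⟩⟩
    exact hS
  rw [e, map_sum, Finset.sum_congr rfl fun j _ =>
    hL (δ j) ((hδ3 j).trans (zpow_neg_anti ℓ ht)) _]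
  simp [Nat.cast_smul_eq_nsmul]

/-- For `s < t` the function `φ_{s,t}` is the sum of `ℓ` translates of `φ_{s+1,t}` by lower
unipotent elements with entry `c ∈ ℓ^s ℤ_ℓ`. On its support `x₁` is `1` modulo `ℓ^{s+1}`, so these
shift `x₀` by `c` modulo `ℓ^{s+1}`. -/
theorem phi_step_left
    (hL : ∀ c : ℚ_[ℓ], ‖c‖ ≤ (ℓ : ℝ) ^ (-(N : ℤ)) →
      ∀ φ, L (translateS ℓ (diagonalH (lowerGL c)) φ) = L φ)
    {s t : ℕ} (hs : N ≤ s) (hst : s < t) : L (phi ℓ s t) = (ℓ : ℂ) • L (phi ℓ (s + 1) t) := by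
  have hpow (j : ℕ) : ‖(j : ℚ_[ℓ]) * (ℓ : ℚ_[ℓ]) ^ s‖ ≤ (ℓ : ℝ) ^ (-(s : ℤ)) := by
    rw [norm_mul, norm_prime_pow]
    refine mul_le_of_le_one_left (zpow_pos (prime_real_pos ℓ) _).le ?_
    exact_mod_cast Padic.norm_int_le_one (j : ℤ)
  let c (j : Fin (ℓ ^ 1)) : ℚ_[ℓ] := -((j : ℕ) * (ℓ : ℚ_[ℓ]) ^ s)
  have e : phi ℓ s t
      = ∑ j, translateS ℓ (diagonalH (lowerGL (c j))) (phi ℓ (s + 1) t) := by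
    apply Subtype.ext
    funext x
    rw [AddSubmonoidClass.coe_finsetSum, Finset.sum_apply]
    have hT (j : Fin (ℓ ^ 1)) : x ∈ {x | Matrix.vecMul x (diagonalH (lowerGL (c j))).1.1.1 ∈
        phiSet ℓ (s + 1) t} ↔
        ‖x 0 - (j : ℕ) * (ℓ : ℚ_[ℓ]) ^ s * 1‖ ≤ (ℓ : ℝ) ^ (-((s + 1 : ℕ) : ℤ)) ∧
        ‖x 1 - 1‖ ≤ (ℓ : ℝ) ^ (-(t : ℤ)) := by
      rw [Set.mem_ofPred_eq, mem_phiSet ℓ (by omega), vecMul_lowerGL]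
      simp only [Matrix.cons_val_zero, Matrix.cons_val_one]
      refine and_congr_left fun h1 => ?_
      -- Since `t > s`, replacing `x 1` by `1` changes the first coordinate by `ℓ^(s+1) ℤ_ℓ` only.
      have hd : ‖c j * (x 1 - 1)‖ ≤ (ℓ : ℝ) ^ (-((s + 1 : ℕ) : ℤ)) := by
        rw [norm_mul]
        refine (mul_le_of_le_one_left (norm_nonneg _) ?_).trans
          (h1.trans (zpow_neg_anti ℓ hst))
        rw [norm_neg]
        exact (hpow j).trans (zpow_neg_le_one ℓ s)
      constructor
      · intro h
        convert norm_sub_le_of_le h hd using 2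
        simp only [c]; ring
      · intro h
        convert norm_add_le_of_le h hd using 2
        simp only [c]; ring
    have hS : (phiSet ℓ s t).indicator (fun _ => (1 : ℂ)) x = ∑ j,
        ({x | Matrix.vecMul x (diagonalH (lowerGL (c j))).1.1.1 ∈ phiSet ℓ (s + 1) t} :
          Set (Fin 2 → ℚ_[ℓ])).indicator (fun _ => (1 : ℂ)) x := by
      by_cases hx : ‖x 0‖ ≤ (ℓ : ℝ) ^ (-(s : ℤ)) ∧ ‖x 1 - 1‖ ≤ (ℓ : ℝ) ^ (-(t : ℤ))
      · obtain ⟨j, hj⟩ := (ball_split norm_one).1 hx.1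
        rw [Set.indicator_of_mem ((mem_phiSet ℓ (by omega) x).2 hx),
          Finset.sum_eq_single j, Set.indicator_of_mem ((hT j).2 ⟨hj, hx.2⟩)]
        · intro i _ hij
          exact Set.indicator_of_notMem
            (fun hi => hij (ball_split_unique norm_one ((hT i).1 hi).1 hj)) _
        · simp
      · rw [Set.indicator_of_notMem (fun h => hx ((mem_phiSet ℓ (by omega) x).1 h))]
        refine (Finset.sum_eq_zero fun j _ => Set.indicator_of_notMem (fun hj => hx ?_) _).symm
        exact ⟨(ball_split norm_one).2 ⟨j, ((hT j).1 hj).1⟩, ((hT j).1 hj).2⟩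
    exact hS
  rw [e, map_sum, Finset.sum_congr rfl fun j _ =>
    hL (c j) (by rw [norm_neg]; exact (hpow j).trans (zpow_neg_anti ℓ hs)) _]
  simp [Nat.cast_smul_eq_nsmul]

/-- A functional on Schwartz functions that is invariant under a small open subgroup takes on
`φ_{s,t}` a value proportional to `ℓ^{-(s+t)}` for large `s` and `t`. -/
theorem exists_phi_constant (hN : 1 ≤ N)
    (hL : ∀ c : ℚ_[ℓ], ‖c‖ ≤ (ℓ : ℝ) ^ (-(N : ℤ)) →
      ∀ φ, L (translateS ℓ (diagonalH (lowerGL c)) φ) = L φ)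
    (hL' : ∀ δ : ℚ_[ℓ]ˣ, ‖(δ : ℚ_[ℓ]) - 1‖ ≤ (ℓ : ℝ) ^ (-(N : ℤ)) →
      ∀ φ, L (translateS ℓ (diagonalH (diagGL δ)) φ) = L φ) :
    ∃ C : W, ∀ s t : ℕ, N ≤ s → N ≤ t → L (phi ℓ s t) = ((ℓ : ℂ) ^ (s + t))⁻¹ • C := by
  have hℓ : (ℓ : ℂ) ≠ 0 := Nat.cast_ne_zero.2 (Fact.out : ℓ.Prime).ne_zero
  have hr (s t k : ℕ) (ht : N ≤ t) : L (phi ℓ s t) = (ℓ : ℂ) ^ k • L (phi ℓ s (t + k)) := by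
    induction k with
    | zero => simp
    | succ k ih =>
      rw [ih, phi_step_right hN hL' s (show N ≤ t + k by omega), smul_smul, ← pow_succ]
      rfl
  have hl (s k : ℕ) (hs : N ≤ s) (t : ℕ) (ht : s + k ≤ t) :
      L (phi ℓ s t) = (ℓ : ℂ) ^ k • L (phi ℓ (s + k) t) := by
    induction k with
    | zero => simp
    | succ k ih =>
      rw [ih (by omega), phi_step_left hL (show N ≤ s + k by omega) (by omega), smul_smul,
        ← pow_succ]
      rfl
  refine ⟨(ℓ : ℂ) ^ (N + N) • L (phi ℓ N N), fun s t hs ht => ?_⟩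
  -- Both values are compared through `φ_{s,s+t}`.
  have h1 := hr s t s ht
  have h2 := hr N N (s + t - N) le_rfl
  have h3 := hl N (s - N) le_rfl (s + t) (by omega)
  rw [show N + (s + t - N) = s + t by omega] at h2
  rw [show N + (s - N) = s by omega] at h3
  rw [h1, h2, h3, smul_smul, smul_smul, smul_smul, show t + s = s + t by omega]
  congr 1
  rw [mul_assoc, mul_assoc, eq_inv_mul_iff_mul_eq₀ (pow_ne_zero _ hℓ), ← pow_add, ← pow_add,
    ← pow_add]
  congr 1
  omega

end Functional

/-! ### The volume of `K_1(ℓ^s, ℓ^t)` -/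

/-- `GL_n(ℤ_ℓ)` as a subgroup. -/
def GLintSubgroup (n : ℕ) : Subgroup (GL (Fin n) ℚ_[ℓ]) :=
  (Units.map ((PadicInt.Coe.ringHom (p := ℓ)).mapMatrix (m := Fin n)).toMonoidHom).range

theorem mem_GLintSubgroup {n : ℕ} {g : GL (Fin n) ℚ_[ℓ]} :
    g ∈ GLintSubgroup ℓ n ↔ g ∈ GLint ℓ n := by
  constructor
  · rintro ⟨u, rfl⟩
    refine ⟨fun i j => (u.1 i j).2, ?_⟩
    have h1 : ((u.1.det : ℤ_[ℓ]) : ℚ_[ℓ])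
        = (Units.map
            ((PadicInt.Coe.ringHom (p := ℓ)).mapMatrix (m := Fin n)).toMonoidHom u).1.det :=
      RingHom.map_det (PadicInt.Coe.ringHom (p := ℓ)) u.1
    rw [← h1, ← PadicInt.norm_def]
    exact PadicInt.isUnit_iff.1 ((Matrix.isUnit_iff_isUnit_det _).1 u.isUnit)
  · rintro ⟨hg, hd⟩
    let A : Matrix (Fin n) (Fin n) ℤ_[ℓ] := fun i j => ⟨g i j, hg i j⟩
    have hA : (PadicInt.Coe.ringHom (p := ℓ)).mapMatrix A = g.1 := by
      ext i j; rfl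
    have hdet : ((A.det : ℤ_[ℓ]) : ℚ_[ℓ]) = g.1.det := by
      rw [← hA, ← RingHom.map_det]; rfl
    have hu : IsUnit A.det := by
      rw [PadicInt.isUnit_iff, PadicInt.norm_def, hdet]
      exact hd
    exact ⟨((Matrix.isUnit_iff_isUnit_det A).2 hu).unit, Units.ext hA⟩

theorem lowerGL_mem {c : ℚ_[ℓ]} (hc : ‖c‖ ≤ 1) : lowerGL c ∈ GLint ℓ 2 := by
  refine ⟨fun i j => ?_, ?_⟩
  · fin_cases i <;> fin_cases j <;> simp [lowerGL, hc]
  · simp [lowerGL, Matrix.det_fin_two]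

theorem diagGL_mem {δ : ℚ_[ℓ]ˣ} (hδ : ‖(δ : ℚ_[ℓ])‖ = 1) : diagGL δ ∈ GLint ℓ 2 := by
  refine ⟨fun i j => ?_, ?_⟩
  · fin_cases i <;> fin_cases j <;> simp [diagGL, hδ]
  · simp [diagGL, Matrix.det_fin_two, hδ]

theorem mul_mem_GLint_iff {n : ℕ} {g h : GL (Fin n) ℚ_[ℓ]} (hg : g ∈ GLint ℓ n) :
    g * h ∈ GLint ℓ n ↔ h ∈ GLint ℓ n := by
  simp only [← mem_GLintSubgroup] at *
  exact Subgroup.mul_mem_cancel_left _ hg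

theorem isClopen_K1GL2 (s t : ℕ) : IsClopen (K1GL2 ℓ s t) := by
  have h1 : Continuous (fun g : GL (Fin 2) ℚ_[ℓ] => g.1 1 0) :=
    Units.continuous_val.matrix_elem 1 0
  have h2 : Continuous (fun g : GL (Fin 2) ℚ_[ℓ] => g.1 1 1 - 1) :=
    (Units.continuous_val.matrix_elem 1 1).sub continuous_const
  exact (isClopen_GLint ℓ 2).inter ((isClopen_le ℓ _ h1 s).inter (isClopen_le ℓ _ h2 t))

theorem haarGL2_eq_mul {S T : Set (GL (Fin 2) ℚ_[ℓ])} (hT : IsClopen T)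
    (g : Fin (ℓ ^ 1) → GL (Fin 2) ℚ_[ℓ]) (h : ∀ x, x ∈ S ↔ ∃ j, g j * x ∈ T)
    (hd : ∀ x i j, g i * x ∈ T → g j * x ∈ T → i = j) :
    (haarGL2 ℓ S).toReal = ℓ * (haarGL2 ℓ T).toReal := by
  let _ : MeasurableSpace (GL (Fin 2) ℚ_[ℓ]) := borel _
  have _ : BorelSpace (GL (Fin 2) ℚ_[ℓ]) := ⟨rfl⟩
  have hHaar : (haarGL2 ℓ).IsHaarMeasure := by unfold haarGL2 haarOne; infer_instance
  have hS : S = ⋃ j, (fun x => g j * x) ⁻¹' T := by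
    ext x; simp [h]
  rw [hS, MeasureTheory.measure_iUnion]
  · simp only [MeasureTheory.measure_preimage_mul, tsum_fintype, Finset.sum_const]
    simp [ENNReal.toReal_mul]
  · intro i j hij
    exact Set.disjoint_left.2 fun x hi hj => hij (hd x i j hi hj)
  · exact fun j => (hT.preimage (continuous_const_mul _)).2.measurableSet

theorem volume_step_right (s : ℕ) {t : ℕ} (ht : 1 ≤ t) :
    (haarGL2 ℓ (K1GL2 ℓ s t)).toReal = ℓ * (haarGL2 ℓ (K1GL2 ℓ s (t + 1))).toReal := by
  choose δ hδ1 hδ2 hδ3 using fun j : Fin (ℓ ^ 1) => exists_unit_inv (ℓ := ℓ) ht (j : ℕ)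
  have hT (x : GL (Fin 2) ℚ_[ℓ]) (j : Fin (ℓ ^ 1)) : diagGL (δ j) * x ∈ K1GL2 ℓ s (t + 1) ↔
      x ∈ GLint ℓ 2 ∧ ‖x.1 1 0‖ ≤ (ℓ : ℝ) ^ (-(s : ℤ)) ∧
      ‖(x.1 1 1 - 1) - (j : ℕ) * (ℓ : ℚ_[ℓ]) ^ t * 1‖ ≤ (ℓ : ℝ) ^ (-((t + 1 : ℕ) : ℤ)) := by
    have e1 : (diagGL (δ j) * x).1 1 0 = δ j * x.1 1 0 := by
      simp [diagGL, Matrix.mul_apply, Fin.sum_univ_two]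
    have e2 : (diagGL (δ j) * x).1 1 1 = δ j * x.1 1 1 := by
      simp [diagGL, Matrix.mul_apply, Fin.sum_univ_two]
    change (_ ∧ ‖(diagGL (δ j) * x).1 1 0‖ ≤ _ ∧ ‖(diagGL (δ j) * x).1 1 1 - 1‖ ≤ _) ↔ _
    rw [mul_mem_GLint_iff ℓ (diagGL_mem ℓ (hδ1 j)), e1, e2, unit_split (hδ1 j) (hδ2 j), norm_mul,
      hδ1, one_mul]
  refine haarGL2_eq_mul ℓ (isClopen_K1GL2 ℓ _ _) (fun j => diagGL (δ j)) (fun x => ?_)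
    fun x i j hi hj => ball_split_unique norm_one ((hT x i).1 hi).2.2 ((hT x j).1 hj).2.2
  constructor
  · rintro ⟨h1, h2, h3⟩
    obtain ⟨j, hj⟩ := (ball_split norm_one).1 h3
    exact ⟨j, (hT x j).2 ⟨h1, h2, hj⟩⟩
  · rintro ⟨j, hj⟩
    obtain ⟨h1, h2, h3⟩ := (hT x j).1 hj
    exact ⟨h1, h2, (ball_split norm_one).2 ⟨j, h3⟩⟩

theorem volume_step_left {s t : ℕ} (ht : 1 ≤ t) (hst : t ≤ s) :
    (haarGL2 ℓ (K1GL2 ℓ s t)).toReal = ℓ * (haarGL2 ℓ (K1GL2 ℓ (s + 1) t)).toReal := by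
  have hpow (j : ℕ) : ‖(j : ℚ_[ℓ]) * (ℓ : ℚ_[ℓ]) ^ s‖ ≤ (ℓ : ℝ) ^ (-(s : ℤ)) := by
    rw [norm_mul, norm_prime_pow]
    refine mul_le_of_le_one_left (zpow_pos (prime_real_pos ℓ) _).le ?_
    exact_mod_cast Padic.norm_int_le_one (j : ℤ)
  let c (j : Fin (ℓ ^ 1)) : ℚ_[ℓ] := -((j : ℕ) * (ℓ : ℚ_[ℓ]) ^ s)
  -- In `K_1(ℓ^s, ℓ^t)` the upper left entry is a unit.
  have hunit (x : GL (Fin 2) ℚ_[ℓ]) (hx : x ∈ GLint ℓ 2)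
      (h0 : ‖x.1 1 0‖ ≤ (ℓ : ℝ) ^ (-(s : ℤ))) : ‖x.1 0 0‖ = 1 := by
    refine le_antisymm (hx.1 0 0) ?_
    by_contra hlt
    push Not at hlt
    have hd := hx.2
    rw [Matrix.det_fin_two] at hd
    have h1 : ‖x.1 0 0 * x.1 1 1‖ < 1 := by
      rw [norm_mul]
      exact (mul_le_of_le_one_right (norm_nonneg _) (hx.1 1 1)).trans_lt hlt
    have h2 : ‖x.1 0 1 * x.1 1 0‖ < 1 := by
      rw [norm_mul]
      exact (mul_le_of_le_one_left (norm_nonneg _) (hx.1 0 1)).trans_lt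
        (h0.trans_lt (zpow_neg_lt_one ℓ (ht.trans hst)))
    have := IsUltrametricDist.norm_add_le_max (x.1 0 0 * x.1 1 1) (-(x.1 0 1 * x.1 1 0))
    rw [← sub_eq_add_neg, hd, norm_neg] at this
    exact absurd this (not_le.2 (max_lt h1 h2))
  have hT (x : GL (Fin 2) ℚ_[ℓ]) (j : Fin (ℓ ^ 1)) : lowerGL (c j) * x ∈ K1GL2 ℓ (s + 1) t ↔
      x ∈ GLint ℓ 2 ∧ ‖x.1 1 0 - (j : ℕ) * (ℓ : ℚ_[ℓ]) ^ s * x.1 0 0‖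
        ≤ (ℓ : ℝ) ^ (-((s + 1 : ℕ) : ℤ)) ∧ ‖x.1 1 1 - 1‖ ≤ (ℓ : ℝ) ^ (-(t : ℤ)) := by
    have e1 : (lowerGL (c j) * x).1 1 0 = x.1 1 0 - (j : ℕ) * (ℓ : ℚ_[ℓ]) ^ s * x.1 0 0 := by
      simp [lowerGL, c, Matrix.mul_apply, Fin.sum_univ_two]; ring
    have e2 : (lowerGL (c j) * x).1 1 1 - 1 = (x.1 1 1 - 1) + c j * x.1 0 1 := by
      simp [lowerGL, Matrix.mul_apply, Fin.sum_univ_two]; ring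
    change (_ ∧ ‖(lowerGL (c j) * x).1 1 0‖ ≤ _ ∧ ‖(lowerGL (c j) * x).1 1 1 - 1‖ ≤ _) ↔ _
    have hc : ‖c j‖ ≤ (ℓ : ℝ) ^ (-(s : ℤ)) := by rw [norm_neg]; exact hpow j
    rw [mul_mem_GLint_iff ℓ (lowerGL_mem ℓ (hc.trans (zpow_neg_le_one ℓ s))), e1, e2]
    refine and_congr_right fun hx => and_congr_right fun _ => ?_
    have hd : ‖c j * x.1 0 1‖ ≤ (ℓ : ℝ) ^ (-(t : ℤ)) := by
      rw [norm_mul]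
      exact (mul_le_of_le_one_right (norm_nonneg _) (hx.1 0 1)).trans
        (hc.trans (zpow_neg_anti ℓ hst))
    constructor
    · intro h
      simpa using norm_sub_le_of_le h hd
    · intro h
      exact norm_add_le_of_le h hd
  refine haarGL2_eq_mul ℓ (isClopen_K1GL2 ℓ _ _) (fun j => lowerGL (c j)) (fun x => ?_)
    fun x i j hi hj => ?_
  · constructor
    · rintro ⟨h1, h2, h3⟩
      obtain ⟨j, hj⟩ := (ball_split (hunit x h1 h2)).1 h2
      exact ⟨j, (hT x j).2 ⟨h1, hj, h3⟩⟩
    · rintro ⟨j, hj⟩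
      obtain ⟨h1, h2, h3⟩ := (hT x j).1 hj
      refine ⟨h1, ?_, h3⟩
      have hs : ‖(j : ℕ) * (ℓ : ℚ_[ℓ]) ^ s * x.1 0 0‖ ≤ (ℓ : ℝ) ^ (-(s : ℤ)) := by
        rw [norm_mul]
        exact (mul_le_of_le_one_right (norm_nonneg _) (h1.1 0 0)).trans (hpow j)
      simpa using norm_add_le_of_le (h2.trans (zpow_neg_anti ℓ (Nat.le_succ s))) hs
  · obtain ⟨h1, h2, h3⟩ := (hT x i).1 hi
    have h4 := ((hT x j).1 hj).2.1
    have hs : ‖(i : ℕ) * (ℓ : ℚ_[ℓ]) ^ s * x.1 0 0‖ ≤ (ℓ : ℝ) ^ (-(s : ℤ)) := by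
      rw [norm_mul]
      exact (mul_le_of_le_one_right (norm_nonneg _) (h1.1 0 0)).trans (hpow i)
    have h5 := norm_add_le_of_le (h2.trans (zpow_neg_anti ℓ (Nat.le_succ s))) hs
    rw [sub_add_cancel] at h5
    exact ball_split_unique (hunit x h1 h5) h2 h4

/-- The volume of `K_1(ℓ^s, ℓ^t)` is proportional to `ℓ^{-(s+t)}`, as the values in
`exists_phi_constant` are. -/
theorem exists_volume_constant : ∃ c : ℂ, ∀ s t : ℕ, 1 ≤ t → t ≤ s →
    ((haarGL2 ℓ (K1GL2 ℓ s t)).toReal : ℂ) = ((ℓ : ℂ) ^ (s + t))⁻¹ * c := by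
  have hℓ : (ℓ : ℂ) ≠ 0 := Nat.cast_ne_zero.2 (Fact.out : ℓ.Prime).ne_zero
  refine ⟨(ℓ : ℂ) ^ 2 * (haarGL2 ℓ (K1GL2 ℓ 1 1)).toReal, fun s t ht hts => ?_⟩
  have h1 : ∀ s : ℕ, ((haarGL2 ℓ (K1GL2 ℓ (s + 1) 1)).toReal : ℂ)
      = ((ℓ : ℂ) ^ s)⁻¹ * (haarGL2 ℓ (K1GL2 ℓ 1 1)).toReal := by
    intro s
    induction s with
    | zero => simp
    | succ s ih =>
      rw [volume_step_left ℓ le_rfl (by omega)] at ih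
      push_cast at ih
      rw [pow_succ, mul_inv, mul_right_comm, ← ih]
      field_simp
  have h2 : ∀ t : ℕ, ((haarGL2 ℓ (K1GL2 ℓ s (t + 1))).toReal : ℂ)
      = ((ℓ : ℂ) ^ t)⁻¹ * (haarGL2 ℓ (K1GL2 ℓ s 1)).toReal := by
    intro t
    induction t with
    | zero => simp
    | succ t ih =>
      rw [volume_step_right ℓ s (by omega)] at ih
      push_cast at ih
      rw [pow_succ, mul_inv, mul_right_comm, ← ih]
      field_simp
  obtain ⟨t, rfl⟩ : ∃ k, t = k + 1 := ⟨t - 1, by omega⟩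
  obtain ⟨s, rfl⟩ : ∃ k, s = k + 1 := ⟨s - 1, by omega⟩
  rw [h2, h1]
  field_simp
  ring

/-! ### Values at `φ_∞` -/

section Value

variable {ℓ} {W : Type*} [AddCommGroup W] [Module ℂ W] {Z : HeckeTensor ℓ →ₗ[ℂ] W}

/-- The normalized values at `φ_{s,t}` are eventually constant, because the volume and the value
both decay like `ℓ^{-(s+t)}`. -/
theorem exists_hasValue (Z : HeckeTensor ℓ →ₗ[ℂ] W) (ξ : HeckeG ℓ) :
    ∃ w, HasValueAtPhiInfty ℓ Z ξ w := by
  obtain ⟨N, hN, h1, h2⟩ := exists_level ℓ (P := fun h => translateG ℓ h ξ = ξ) (by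
    filter_upwards [eventually_invariant (fun (h : HQ ℓ) (x : GQ ℓ) => iota ℓ h * x)
      (((continuous_iota ℓ).comp continuous_snd).mul continuous_fst) (by simp) (by simp) ξ]
      with u hu
    exact Subtype.ext (funext hu))
  let L : Schwartz ℓ →ₗ[ℂ] W :=
    (Z ∘ₗ (balanced ℓ).mkQ) ∘ₗ (TensorProduct.mk ℂ (Schwartz ℓ) (HeckeG ℓ)).flip ξ
  have hL (h : HQ ℓ) (hh : translateG ℓ h ξ = ξ) (φ : Schwartz ℓ) :
      L (translateS ℓ h φ) = L φ := by
    have := apply_tmul_translate ℓ Z h φ ξ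
    rwa [hh] at this
  obtain ⟨C, hC⟩ := exists_phi_constant (L := L) hN (fun c hc => hL _ (h1 c hc))
    (fun δ hδ => hL _ (h2 δ hδ))
  obtain ⟨c, hc⟩ := exists_volume_constant ℓ
  refine ⟨c⁻¹ • C, N, fun s t ht hst => ?_⟩
  have hℓ : (ℓ : ℂ) ≠ 0 := Nat.cast_ne_zero.2 (Fact.out : ℓ.Prime).ne_zero
  rw [hc s t (hN.trans ht) hst]
  change _ • L (phi ℓ s t) = _
  rw [hC s t (ht.trans hst) ht, smul_smul, mul_inv, inv_inv, mul_right_comm,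
    mul_inv_cancel₀ (pow_ne_zero _ hℓ), one_mul]

theorem HasValueAtPhiInfty.add {ξ ξ' : HeckeG ℓ} {w w' : W} (h : HasValueAtPhiInfty ℓ Z ξ w)
    (h' : HasValueAtPhiInfty ℓ Z ξ' w') : HasValueAtPhiInfty ℓ Z (ξ + ξ') (w + w') := by
  obtain ⟨T, hT⟩ := h
  obtain ⟨T', hT'⟩ := h'
  refine ⟨max T T', fun s t ht hst => ?_⟩
  rw [← hT s t ((le_max_left _ _).trans ht) hst, ← hT' s t ((le_max_right _ _).trans ht) hst]
  simp [tmul, TensorProduct.tmul_add]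

theorem HasValueAtPhiInfty.smul {ξ : HeckeG ℓ} {w : W} (h : HasValueAtPhiInfty ℓ Z ξ w) (c : ℂ) :
    HasValueAtPhiInfty ℓ Z (c • ξ) (c • w) := by
  obtain ⟨T, hT⟩ := h
  refine ⟨T, fun s t ht hst => ?_⟩
  rw [← hT s t ht hst, smul_comm]
  simp [tmul, TensorProduct.tmul_smul]

theorem HasValueAtPhiInfty.sub {ξ ξ' : HeckeG ℓ} {w w' : W} (h : HasValueAtPhiInfty ℓ Z ξ w)
    (h' : HasValueAtPhiInfty ℓ Z ξ' w') : HasValueAtPhiInfty ℓ Z (ξ - ξ') (w - w') := by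
  have := h.add (h'.smul (-1))
  simpa [sub_eq_add_neg] using this

theorem HasValueAtPhiInfty.sum {ι : Type*} [Fintype ι] {ξ : ι → HeckeG ℓ} {w : ι → W}
    (h : ∀ i, HasValueAtPhiInfty ℓ Z (ξ i) (w i)) :
    HasValueAtPhiInfty ℓ Z (∑ i, ξ i) (∑ i, w i) := by
  choose T hT using h
  refine ⟨∑ i, T i, fun s t ht hst => ?_⟩
  rw [Finset.sum_congr rfl fun i _ => (hT i s t
    ((Finset.single_le_sum (fun _ _ => Nat.zero_le _) (Finset.mem_univ i)).trans ht) hst).symm]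
  simp [tmul, TensorProduct.tmul_sum, Finset.smul_sum]

/-- The value at `φ_∞` transforms under the stabilizer of the row vector `(0, 1)` in `H` through
the character `‖det‖`. -/
theorem HasValueAtPhiInfty.translate {ξ ξ' : HeckeG ℓ} {w w' : W} {q : HQ ℓ}
    (h : HasValueAtPhiInfty ℓ Z ξ w) (h' : HasValueAtPhiInfty ℓ Z ξ' w')
    (hξ : translateG ℓ q ξ' = ξ) (h0 : q.1.1.1 1 0 = 0) (h1 : q.1.1.1 1 1 = 1) :
    w' = (‖q.1.1.1.det‖ : ℂ) • w := by
  have hℓ : (ℓ : ℂ) ≠ 0 := Nat.cast_ne_zero.2 (Fact.out : ℓ.Prime).ne_zero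
  have hpos := prime_real_pos ℓ
  set a := q.1.1.1 0 0 with ha
  set b := q.1.1.1 0 1 with hb
  have hdet : q.1.1.1.det = a := by rw [Matrix.det_fin_two, h0, h1]; ring
  have ha0 : a ≠ 0 := by
    rw [← hdet]
    exact ((Matrix.isUnit_iff_isUnit_det _).1 q.1.1.isUnit).ne_zero
  have hna : ‖a‖ = (ℓ : ℝ) ^ (-a.valuation) := Padic.norm_eq_zpow_neg_valuation ha0
  obtain ⟨M, hM⟩ : ∃ M : ℕ, ‖b‖ ≤ (ℓ : ℝ) ^ M :=
    (pow_unbounded_of_one_lt ‖b‖ (show (1 : ℝ) < ℓ by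
      exact_mod_cast (Fact.out : ℓ.Prime).one_lt)).imp fun _ h => h.le
  obtain ⟨T, hT⟩ := h
  obtain ⟨T', hT'⟩ := h'
  obtain ⟨c, hc⟩ := exists_volume_constant ℓ
  -- With `s' = s + v(a)`, translation by `q` carries `φ_{s',t}` to `φ_{s,t}` once `s` is large
  -- enough for the entry `b` not to disturb the second coordinate.
  let t := T + T' + 1
  let s := t + M + a.valuation.natAbs
  obtain ⟨s', hs'⟩ : ∃ s' : ℕ, (s' : ℤ) = s + a.valuation :=
    ⟨(s + a.valuation).toNat, Int.toNat_of_nonneg (by omega)⟩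
  have hs't : t ≤ s' := by omega
  have hst : t ≤ s := by omega
  have hφ : translateS ℓ q (phi ℓ s' t) = phi ℓ s t := by
    apply Subtype.ext
    funext y
    have hy0 : Matrix.vecMul y q.1.1.1 0 = a * y 0 := by
      simp [Matrix.vecMul, dotProduct, Fin.sum_univ_two, h0, ha, mul_comm]
    have hy1 : Matrix.vecMul y q.1.1.1 1 = b * y 0 + y 1 := by
      simp [Matrix.vecMul, dotProduct, Fin.sum_univ_two, h1, hb, mul_comm]
    have hiff : Matrix.vecMul y q.1.1.1 ∈ phiSet ℓ s' t ↔ y ∈ phiSet ℓ s t := by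
      rw [mem_phiSet ℓ (show 1 ≤ t by omega), mem_phiSet ℓ (show 1 ≤ t by omega), hy0, hy1]
      have e : (ℓ : ℝ) ^ (-(s' : ℤ)) = ‖a‖ * (ℓ : ℝ) ^ (-(s : ℤ)) := by
        rw [hna, ← zpow_add₀ hpos.ne', hs']
        congr 1; ring
      rw [norm_mul, e, mul_le_mul_iff_right₀ (norm_pos_iff.2 ha0)]
      refine and_congr_right fun hy => ?_
      have hby : ‖b * y 0‖ ≤ (ℓ : ℝ) ^ (-(t : ℤ)) := by
        rw [norm_mul]
        refine (mul_le_mul hM hy (norm_nonneg _) (pow_nonneg hpos.le _)).trans ?_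
        rw [← zpow_natCast, ← zpow_add₀ hpos.ne']
        exact zpow_le_zpow_right₀ (by exact_mod_cast (Fact.out : ℓ.Prime).one_le) (by omega)
      constructor
      · intro h
        convert norm_sub_le_of_le h hby using 2
        ring
      · intro h
        convert norm_add_le_of_le h hby using 2
        ring
    change (phiSet ℓ s' t).indicator (fun _ => (1 : ℂ)) (Matrix.vecMul y q.1.1.1)
      = (phiSet ℓ s t).indicator (fun _ => (1 : ℂ)) y
    by_cases hy : y ∈ phiSet ℓ s t
    · rw [Set.indicator_of_mem hy, Set.indicator_of_mem (hiff.2 hy)]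
    · rw [Set.indicator_of_notMem hy, Set.indicator_of_notMem (fun h => hy (hiff.1 h))]
  have key := apply_tmul_translate ℓ Z q (phi ℓ s' t) ξ'
  rw [hξ, hφ] at key
  rw [← hT s' t (by omega) hs't, ← hT' s t (by omega) hst, key, smul_smul,
    hc s' t (by omega) hs't, hc s t (by omega) hst, hdet, hna]
  congr 1
  have e : (ℓ : ℂ) ^ s' = (ℓ : ℂ) ^ s * (ℓ : ℂ) ^ a.valuation := by
    rw [← zpow_natCast, hs', zpow_add₀ hℓ, zpow_natCast]
  rw [mul_inv, mul_inv, inv_inv, inv_inv, pow_add _ s t, pow_add _ s' t, e]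
  push_cast
  rw [zpow_neg]
  have := zpow_ne_zero a.valuation hℓ
  field_simp

end Value

/-! ### The group `K_{1,0}` and its cosets -/

variable {ℓ} in
/-- The determinant of the symplectic component is, up to sign, the square of the multiplier. -/
theorem norm_det_fst_eq_one {g : GQ ℓ} (h : ‖g.1.2.1.det‖ = 1) : ‖g.1.1.1.det‖ = 1 := by
  have h1 := congrArg Matrix.det (show g.1.1.1.transpose * J ℚ_[ℓ] * g.1.1.1 = _ from g.2)
  have hJ : (J ℚ_[ℓ]).det ≠ 0 := by
    simp [J, Matrix.det_succ_row_zero, Fin.sum_univ_succ, Fin.succAbove]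
  rw [Matrix.det_mul, Matrix.det_mul, Matrix.det_transpose, Matrix.det_smul] at h1
  have h2 : g.1.1.1.det * g.1.1.1.det = g.1.2.1.det ^ 4 := by
    apply mul_right_cancel₀ hJ
    rw [Fintype.card_fin] at h1
    linear_combination h1
  have h3 := congrArg norm h2
  rw [norm_mul, norm_pow, h, one_pow] at h3
  nlinarith [norm_nonneg g.1.1.1.det]

variable {ℓ} in
theorem norm_eq_one_of_sub {x : ℚ_[ℓ]} (h : ‖x - 1‖ ≤ (ℓ : ℝ) ^ (-((1 : ℕ) : ℤ))) : ‖x‖ = 1 := by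
  have hlt := h.trans_lt (zpow_neg_lt_one ℓ le_rfl)
  have : x = (x - 1) + 1 := by ring
  rw [this, IsUltrametricDist.norm_add_eq_max_of_norm_ne_norm (by rw [norm_one]; exact hlt.ne),
    norm_one, max_eq_right hlt.le]

/-- The group `K_{1,0}` as a subgroup of `G`. -/
def K10 : Subgroup (GQ ℓ) where
  carrier := {g | (g.1.1 ∈ GLintSubgroup ℓ 4 ∧ g.1.2 ∈ GLintSubgroup ℓ 2) ∧
    ‖g.1.2.1.det - 1‖ ≤ (ℓ : ℝ) ^ (-((1 : ℕ) : ℤ))}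
  one_mem' := ⟨⟨one_mem _, one_mem _⟩, by simp⟩
  mul_mem' := by
    rintro a b ⟨⟨ha, ha'⟩, hda⟩ ⟨⟨hb, hb'⟩, hdb⟩
    refine ⟨⟨mul_mem ha hb, mul_mem ha' hb'⟩, ?_⟩
    have e : (a * b).1.2.1.det - 1
        = a.1.2.1.det * (b.1.2.1.det - 1) + (a.1.2.1.det - 1) := by
      have : (a * b).1.2.1.det = a.1.2.1.det * b.1.2.1.det := Matrix.det_mul _ _
      rw [this]; ring
    rw [e]
    refine norm_add_le_of_le ?_ hda
    rwa [norm_mul, norm_eq_one_of_sub hda, one_mul]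
  inv_mem' := by
    rintro a ⟨⟨ha, ha'⟩, hda⟩
    refine ⟨⟨inv_mem ha, inv_mem ha'⟩, ?_⟩
    have h1 := norm_eq_one_of_sub hda
    have e : (a⁻¹).1.2.1.det * a.1.2.1.det = 1 := by
      rw [← Matrix.det_mul]
      have : (a⁻¹).1.2.1 * a.1.2.1 = 1 := by
        change ((a.1.2)⁻¹).1 * a.1.2.1 = 1
        simp
      rw [this, Matrix.det_one]
    have e2 : ‖(a⁻¹).1.2.1.det - 1‖ * ‖a.1.2.1.det‖ = ‖a.1.2.1.det - 1‖ := by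
      rw [← norm_mul, sub_mul, e, one_mul, norm_sub_rev]
    rw [h1, mul_one] at e2
    change ‖(a⁻¹).1.2.1.det - 1‖ ≤ _
    rwa [e2]

variable {ℓ}

theorem mem_K10_iff {g : GQ ℓ} : g ∈ K10 ℓ ↔ (∀ i j, ‖g.1.1.1 i j‖ ≤ 1) ∧
    (∀ i j, ‖g.1.2.1 i j‖ ≤ 1) ∧ ‖g.1.2.1.det - 1‖ ≤ (ℓ : ℝ) ^ (-((1 : ℕ) : ℤ)) := by
  constructor
  · rintro ⟨⟨h1, h2⟩, h3⟩
    exact ⟨((mem_GLintSubgroup ℓ).1 h1).1, ((mem_GLintSubgroup ℓ).1 h2).1, h3⟩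
  · rintro ⟨h1, h2, h3⟩
    have hd := norm_eq_one_of_sub h3
    exact ⟨⟨(mem_GLintSubgroup ℓ).2 ⟨h1, norm_det_fst_eq_one hd⟩,
      (mem_GLintSubgroup ℓ).2 ⟨h2, hd⟩⟩, h3⟩

theorem mem_K_iff {g : GQ ℓ} : g ∈ K ℓ 1 0 ↔ g ∈ K10 ℓ := by
  rw [mem_K10_iff]
  constructor
  · rintro ⟨⟨h1, h2⟩, -, h3⟩
    exact ⟨h1.1, h2.1, h3⟩
  · rintro ⟨h1, h2, h3⟩
    have hd := norm_eq_one_of_sub h3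
    exact ⟨⟨⟨h1, norm_det_fst_eq_one hd⟩, h2, hd⟩, by simp [h1], h3⟩

theorem mem_coset_iff {g x : GQ ℓ} : x ∈ coset ℓ g (K ℓ 1 0) ↔ g⁻¹ * x ∈ K10 ℓ := by
  rw [← mem_K_iff]
  constructor
  · rintro ⟨k, hk, rfl⟩
    change g⁻¹ * (g * k) ∈ _
    rwa [inv_mul_cancel_left]
  · intro h
    exact ⟨_, h, mul_inv_cancel_left g x⟩

theorem coset_mul_right (g : GQ ℓ) {k : GQ ℓ} (hk : k ∈ K10 ℓ) :
    coset ℓ (g * k) (K ℓ 1 0) = coset ℓ g (K ℓ 1 0) := by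
  apply SetLike.ext
  intro x
  rw [mem_coset_iff, mem_coset_iff, mul_inv_rev, mul_assoc,
    Subgroup.mul_mem_cancel_left _ (inv_mem hk)]

theorem ch_apply_congr {S T : TopologicalSpace.CompactOpens (GQ ℓ)} {x y : GQ ℓ}
    (h : x ∈ S ↔ y ∈ T) : (ch S).1 x = (ch T).1 y := by
  change (S : Set (GQ ℓ)).indicator (fun _ => (1 : ℂ)) x = (T : Set (GQ ℓ)).indicator (fun _ => 1) y
  by_cases hx : x ∈ S
  · rw [Set.indicator_of_mem (SetLike.mem_coe.2 hx),
      Set.indicator_of_mem (SetLike.mem_coe.2 (h.1 hx))]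
  · rw [Set.indicator_of_notMem (fun h' => hx h'),
      Set.indicator_of_notMem (fun h' => hx (h.2 h'))]

theorem translateG_coset (q : HQ ℓ) (g : GQ ℓ) :
    translateG ℓ q (ch (coset ℓ (iota ℓ q * g) (K ℓ 1 0))) = ch (coset ℓ g (K ℓ 1 0)) := by
  apply Subtype.ext
  funext x
  refine ch_apply_congr ?_
  rw [mem_coset_iff, mem_coset_iff]
  simp [mul_assoc]

/-- The characteristic function of a set that is partitioned into cosets of `K_{1,0}`. -/
theorem ch_eq_sum_coset {ι : Type*} [Fintype ι] {S : TopologicalSpace.CompactOpens (GQ ℓ)}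
    (g : ι → GQ ℓ) (hS : ∀ x, x ∈ S ↔ ∃ i, (g i)⁻¹ * x ∈ K10 ℓ)
    (hd : ∀ i j, (g i)⁻¹ * g j ∈ K10 ℓ → i = j) :
    ch S = ∑ i, ch (coset ℓ (g i) (K ℓ 1 0)) := by
  apply Subtype.ext
  funext x
  rw [AddSubmonoidClass.coe_finsetSum, Finset.sum_apply]
  refine indicator_eq_sum (S := (S : Set (GQ ℓ)))
    (T := fun i => (coset ℓ (g i) (K ℓ 1 0) : Set (GQ ℓ)))
    (fun x => ?_) (fun x i j hi hj => ?_) x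
  · simpa only [SetLike.mem_coe, mem_coset_iff] using hS x
  · rw [SetLike.mem_coe, mem_coset_iff] at hi hj
    refine hd i j ?_
    have := mul_mem hi (inv_mem hj)
    simpa [mul_assoc] using this

/-- The value at `φ_∞` as a function on `G / K_{1,0}`: its invariance properties. -/
theorem exists_cosetValue {W : Type*} [AddCommGroup W] [Module ℂ W]
    (Z : HeckeTensor ℓ →ₗ[ℂ] W) : ∃ z : GQ ℓ → W,
      (∀ g, HasValueAtPhiInfty ℓ Z (ch (coset ℓ g (K ℓ 1 0))) (z g)) ∧
      (∀ g, ∀ k ∈ K10 ℓ, z (g * k) = z g) ∧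
      ∀ (q : HQ ℓ) (g : GQ ℓ), q.1.1.1 1 0 = 0 → q.1.1.1 1 1 = 1 →
        z (iota ℓ q * g) = (‖q.1.1.1.det‖ : ℂ) • z g := by
  choose v hv using exists_hasValue Z
  refine ⟨fun g => v (ch (coset ℓ g (K ℓ 1 0))), fun g => hv _, fun g k hk => ?_,
    fun q g h0 h1 => (hv _).translate (hv _) (translateG_coset q g) h0 h1⟩
  simp only [coset_mul_right g hk]

end Functionals

section Cosets

variable {ℓ : ℕ} [Fact ℓ.Prime]

/-! ### The Klingen parabolic subgroup -/

theorem GQ_ext {g h : GQ ℓ} (h1 : g.1.1.1 = h.1.1.1) (h2 : g.1.2.1 = h.1.2.1) : g = h :=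
  Subtype.ext (Prod.ext (Units.ext h1) (Units.ext h2))

theorem HQ_ext {g h : HQ ℓ} (h1 : g.1.1.1 = h.1.1.1) (h2 : g.1.2.1 = h.1.2.1) : g = h :=
  Subtype.ext (Prod.ext (Units.ext h1) (Units.ext h2))

/-- The matrix `diag(det A, A, 1)` for `h = (A, B)`. -/
def levMat : HQ ℓ →* Matrix (Fin 4) (Fin 4) ℚ_[ℓ] where
  toFun h := !![h.1.1.1 0 0 * h.1.1.1 1 1 - h.1.1.1 0 1 * h.1.1.1 1 0, 0, 0, 0;
                0, h.1.1.1 0 0, h.1.1.1 0 1, 0;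
                0, h.1.1.1 1 0, h.1.1.1 1 1, 0;
                0, 0, 0, 1]
  map_one' := by
    ext i j; fin_cases i <;> fin_cases j <;> simp
  map_mul' := by
    intro a b
    ext i j
    fin_cases i <;> fin_cases j <;>
      simp [Matrix.mul_apply, Fin.sum_univ_succ]
    ring

/-- The embedding `(A, B) ↦ (diag(det A, A, 1), B)` of `GL₂ ×_{GL₁} GL₂` into the Levi subgroup of
the Klingen parabolic. -/
def lev : HQ ℓ →* GQ ℓ where
  toFun h := ⟨(levMat.toHomUnits h, h.1.2), by
    have hd : h.1.1.1.det = h.1.2.1.det := h.2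
    change (levMat h).transpose * J _ * levMat h = h.1.2.1.det • J _
    rw [← hd, Matrix.det_fin_two]
    ext i j
    fin_cases i <;> fin_cases j <;>
      simp [levMat, J, Matrix.mul_apply, Fin.sum_univ_succ] <;> ring⟩
  map_one' := by ext1; simp
  map_mul' := by intro a b; ext1; simp

/-- The element of the unipotent radical of the Klingen parabolic with first row `(1, x, y, z)`. -/
def heis (x y z : ℚ_[ℓ]) : GQ ℓ :=
  mkG ℓ !![1, x, y, z; 0, 1, 0, y; 0, 0, 1, -x; 0, 0, 0, 1] 1 (by simp) (by
    ext p q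
    fin_cases p <;> fin_cases q <;>
      simp [J, Matrix.mul_apply, Fin.sum_univ_succ] <;> ring)

theorem lev_fst (m : HQ ℓ) : (lev m).1.1.1 =
    !![m.1.1.1 0 0 * m.1.1.1 1 1 - m.1.1.1 0 1 * m.1.1.1 1 0, 0, 0, 0;
       0, m.1.1.1 0 0, m.1.1.1 0 1, 0; 0, m.1.1.1 1 0, m.1.1.1 1 1, 0; 0, 0, 0, 1] := rfl

theorem lev_snd (m : HQ ℓ) : (lev m).1.2.1 = m.1.2.1 := rfl

theorem heis_fst (x y z : ℚ_[ℓ]) : (heis x y z).1.1.1 =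
    !![1, x, y, z; 0, 1, 0, y; 0, 0, 1, -x; 0, 0, 0, 1] := rfl

theorem heis_snd (x y z : ℚ_[ℓ]) : (heis x y z).1.2.1 = 1 := rfl

theorem mul_fst (g h : GQ ℓ) : (g * h).1.1.1 = g.1.1.1 * h.1.1.1 := rfl

theorem mul_snd (g h : GQ ℓ) : (g * h).1.2.1 = g.1.2.1 * h.1.2.1 := rfl

theorem heis_mul (x y z x' y' z' : ℚ_[ℓ]) :
    heis x y z * heis x' y' z' = heis (x + x') (y + y') (z + z' + (x * y' - y * x')) := by
  refine GQ_ext ?_ ?_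
  · rw [mul_fst, heis_fst, heis_fst, heis_fst]
    ext i j
    fin_cases i <;> fin_cases j <;> simp [Matrix.mul_apply, Fin.sum_univ_succ] <;> ring
  · simp [heis_snd]

theorem heis_zero : heis (0 : ℚ_[ℓ]) 0 0 = 1 := by
  refine GQ_ext ?_ rfl
  rw [heis_fst]
  ext i j
  fin_cases i <;> fin_cases j <;> simp

theorem heis_inv (x y z : ℚ_[ℓ]) : (heis x y z)⁻¹ = heis (-x) (-y) (-z) := by
  rw [inv_eq_iff_mul_eq_one, heis_mul, ← heis_zero]
  congr 1 <;> ring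

/-- Conjugation by `(A, B)` acts on `(x, y)` through the adjugate of `A`. -/
theorem lev_mul_heis (m : HQ ℓ) (x y z : ℚ_[ℓ]) :
    lev m * heis x y z = heis (x * m.1.1.1 1 1 - y * m.1.1.1 1 0)
      (y * m.1.1.1 0 0 - x * m.1.1.1 0 1) (m.1.1.1.det * z) * lev m := by
  refine GQ_ext ?_ ?_
  · rw [mul_fst, mul_fst, heis_fst, heis_fst, lev_fst, Matrix.det_fin_two]
    ext i j
    fin_cases i <;> fin_cases j <;> simp [Matrix.mul_apply, Fin.sum_univ_succ] <;> ring
  · simp [heis_snd]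

theorem heis_lev_fst (x y z : ℚ_[ℓ]) (m : HQ ℓ) : (heis x y z * lev m).1.1.1 =
    !![m.1.1.1.det, x * m.1.1.1 0 0 + y * m.1.1.1 1 0, x * m.1.1.1 0 1 + y * m.1.1.1 1 1, z;
       0, m.1.1.1 0 0, m.1.1.1 0 1, y; 0, m.1.1.1 1 0, m.1.1.1 1 1, -x; 0, 0, 0, 1] := by
  rw [mul_fst, heis_fst, lev_fst, Matrix.det_fin_two]
  ext i j
  fin_cases i <;> fin_cases j <;> simp [Matrix.mul_apply, Fin.sum_univ_succ]

/-- Integrality of both components of an element of `H`, with determinant `1` modulo `ℓ`: the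
condition for `lev m` to lie in `K_{1,0}`. -/
def IsIntegralH (m : HQ ℓ) : Prop :=
  (∀ i j, ‖m.1.1.1 i j‖ ≤ 1) ∧ (∀ i j, ‖m.1.2.1 i j‖ ≤ 1) ∧
    ‖m.1.2.1.det - 1‖ ≤ (ℓ : ℝ) ^ (-((1 : ℕ) : ℤ))

theorem norm_mul_le_one {x y : ℚ_[ℓ]} (hx : ‖x‖ ≤ 1) (hy : ‖y‖ ≤ 1) : ‖x * y‖ ≤ 1 := by
  rw [norm_mul]
  exact mul_le_one₀ hx (norm_nonneg _) hy

theorem heis_lev_mem_K10 {x y z : ℚ_[ℓ]} {m : HQ ℓ} : heis x y z * lev m ∈ K10 ℓ ↔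
    ‖x‖ ≤ 1 ∧ ‖y‖ ≤ 1 ∧ ‖z‖ ≤ 1 ∧ IsIntegralH m := by
  have hs : (heis x y z * lev m).1.2.1 = m.1.2.1 := by rw [mul_snd, heis_snd, lev_snd, one_mul]
  rw [mem_K10_iff, hs, heis_lev_fst]
  constructor
  · rintro ⟨h1, h2, h3⟩
    refine ⟨by simpa using h1 2 3, by simpa using h1 1 3, by simpa using h1 0 3,
      fun i j => ?_, h2, h3⟩
    have e := h1 i.succ.castSucc j.succ.castSucc
    fin_cases i <;> fin_cases j <;> simpa using e
  · rintro ⟨hx, hy, hz, h1, h2, h3⟩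
    refine ⟨fun i j => ?_, h2, h3⟩
    have hd : ‖m.1.1.1.det‖ ≤ 1 := by
      rw [show m.1.1.1.det = m.1.2.1.det from m.2]
      exact (norm_eq_one_of_sub h3).le
    fin_cases i <;> fin_cases j <;> simp [hx, hy, hz, hd, h1] <;>
      exact norm_add_le_of_le (norm_mul_le_one hx (h1 _ _)) (norm_mul_le_one hy (h1 _ _))

theorem lev_mem_K10 {m : HQ ℓ} : lev m ∈ K10 ℓ ↔ IsIntegralH m := by
  rw [← one_mul (lev m), ← heis_zero, heis_lev_mem_K10]
  simp

theorem heis_mem_K10 {x y z : ℚ_[ℓ]} (hx : ‖x‖ ≤ 1) (hy : ‖y‖ ≤ 1) (hz : ‖z‖ ≤ 1) :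
    heis x y z ∈ K10 ℓ := by
  rw [← mul_one (heis x y z), ← map_one lev, heis_lev_mem_K10]
  refine ⟨hx, hy, hz, lev_mem_K10.1 ?_⟩
  rw [map_one]
  exact one_mem _

/-- The Levi component of a quotient of two elements `lev(h,h) n lev(m)` of the parabolic. -/
theorem isIntegralH_of_inv_mul_mem {τ τ' : GL (Fin 2) ℚ_[ℓ]} {x y z x' y' z' : ℚ_[ℓ]}
    {m m' : HQ ℓ}
    (h : (lev (diagonalH τ) * heis x y z * lev m)⁻¹ *
      (lev (diagonalH τ') * heis x' y' z' * lev m') ∈ K10 ℓ) :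
    IsIntegralH (m⁻¹ * (diagonalH τ)⁻¹ * diagonalH τ' * m') := by
  have e : ∃ a b c : ℚ_[ℓ], (lev (diagonalH τ) * heis x y z * lev m)⁻¹ *
      (lev (diagonalH τ') * heis x' y' z' * lev m')
      = heis a b c * lev (m⁻¹ * (diagonalH τ)⁻¹ * diagonalH τ' * m') := by
    have e1 : (lev (diagonalH τ) * heis x y z * lev m)⁻¹ *
      (lev (diagonalH τ') * heis x' y' z' * lev m')
      = lev m⁻¹ * (heis (-x) (-y) (-z) * (lev ((diagonalH τ)⁻¹ * diagonalH τ')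
        * heis x' y' z')) * lev m' := by
      rw [← heis_inv, map_mul, map_inv, map_inv]; group
    rw [e1, lev_mul_heis, ← mul_assoc (heis _ _ _), heis_mul, ← mul_assoc (lev m⁻¹), lev_mul_heis]
    simp only [map_mul, mul_assoc]
    exact ⟨_, _, _, rfl⟩
  obtain ⟨a, b, c, e⟩ := e
  rw [e] at h
  exact (heis_lev_mem_K10.1 h).2.2.2

/-! ### Matrices of determinant one -/

variable (ℓ) in
/-- The subgroup `SL₂(ℤ_ℓ)` of `GL₂(ℚ_ℓ)`. -/
def SLint : Subgroup (GL (Fin 2) ℚ_[ℓ]) :=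
  GLintSubgroup ℓ 2 ⊓ (Matrix.GeneralLinearGroup.det).ker

theorem mem_SLint {h : GL (Fin 2) ℚ_[ℓ]} :
    h ∈ SLint ℓ ↔ (∀ i j, ‖h.1 i j‖ ≤ 1) ∧ h.1.det = 1 := by
  rw [SLint, Subgroup.mem_inf, mem_GLintSubgroup, MonoidHom.mem_ker, Units.ext_iff]
  change (_ ∧ _) ∧ h.1.det = 1 ↔ _
  constructor
  · rintro ⟨⟨h1, -⟩, h2⟩
    exact ⟨h1, h2⟩
  · rintro ⟨h1, h2⟩
    exact ⟨⟨h1, by rw [h2, norm_one]⟩, h2⟩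

/-- The matrix with rows `(a, b)` and `(c, d)` of determinant one. -/
def sl (a b c d : ℚ_[ℓ]) (h : a * d - b * c = 1) : GL (Fin 2) ℚ_[ℓ] :=
  ⟨!![a, b; c, d], !![d, -b; -c, a],
    by
      ext i j
      fin_cases i <;> fin_cases j <;> simp <;> first | linear_combination h | ring,
    by
      ext i j
      fin_cases i <;> fin_cases j <;> simp <;> first | linear_combination h | ring⟩

theorem sl_val (a b c d : ℚ_[ℓ]) (h) : (sl a b c d h).1 = !![a, b; c, d] := rfl

theorem sl_det (a b c d : ℚ_[ℓ]) (h) : (sl a b c d h).1.det = 1 := by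
  rw [sl_val, Matrix.det_fin_two]
  simpa using h

theorem sl_mem_SLint {a b c d : ℚ_[ℓ]} {h} (ha : ‖a‖ ≤ 1) (hb : ‖b‖ ≤ 1) (hc : ‖c‖ ≤ 1)
    (hd : ‖d‖ ≤ 1) : sl a b c d h ∈ SLint ℓ := by
  refine mem_SLint.2 ⟨fun i j => ?_, sl_det _ _ _ _ _⟩
  rw [sl_val]
  fin_cases i <;> fin_cases j <;> simp [ha, hb, hc, hd]

/-- The diagonal matrix `diag(r, s)`. -/
def dg (r s : ℚ_[ℓ]) (hr : r ≠ 0) (hs : s ≠ 0) : GL (Fin 2) ℚ_[ℓ] :=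
  ⟨!![r, 0; 0, s], !![r⁻¹, 0; 0, s⁻¹],
    by simp [hr, hs, Matrix.one_fin_two], by simp [hr, hs, Matrix.one_fin_two]⟩

theorem dg_val (r s : ℚ_[ℓ]) (hr hs) : (dg r s hr hs).1 = !![r, 0; 0, s] := rfl

variable (ℓ) in
/-- The matrix `diag(ℓ^a, ℓ^b)`. -/
def dgp (a b : ℕ) : GL (Fin 2) ℚ_[ℓ] :=
  dg ((ℓ : ℚ_[ℓ]) ^ a) ((ℓ : ℚ_[ℓ]) ^ b) (pow_ne_zero _ (prime_ne_zero ℓ))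
    (pow_ne_zero _ (prime_ne_zero ℓ))

/-- A pair of matrices of equal determinant. -/
def pairH (A B : GL (Fin 2) ℚ_[ℓ]) (h : A.1.det = B.1.det) : HQ ℓ := ⟨(A, B), h⟩

theorem isIntegralH_of_SLint {m : HQ ℓ} (h1 : m.1.1 ∈ SLint ℓ) (h2 : m.1.2 ∈ SLint ℓ) :
    IsIntegralH m :=
  ⟨(mem_SLint.1 h1).1, (mem_SLint.1 h2).1, by
    rw [(mem_SLint.1 h2).2, sub_self, norm_zero]; exact (zpow_pos (prime_real_pos ℓ) _).le⟩

variable (ℓ) in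
/-- The element `(diag(ℓ^a, ℓ^b), diag(ℓ^a', ℓ^b'))` of `H`. -/
def dH (a b a' b' : ℕ) (h : a + b = a' + b') : HQ ℓ :=
  pairH (dgp ℓ a b) (dgp ℓ a' b') (by
    rw [dgp, dgp, dg_val, dg_val, Matrix.det_fin_two, Matrix.det_fin_two]
    simp [← pow_add, h])

theorem lev_dH_conj_heis (a b a' b' : ℕ) (h) (x y z : ℚ_[ℓ]) :
    heis x y z * lev (dH ℓ a b a' b' h) = lev (dH ℓ a b a' b' h) *
      heis (x / (ℓ : ℚ_[ℓ]) ^ b) (y / (ℓ : ℚ_[ℓ]) ^ a) (z / (ℓ : ℚ_[ℓ]) ^ (a + b)) := by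
  have hℓ := prime_ne_zero ℓ
  have e : (dH ℓ a b a' b' h).1.1.1
    = !![(ℓ : ℚ_[ℓ]) ^ a, 0; 0, (ℓ : ℚ_[ℓ]) ^ b] := rfl
  rw [lev_mul_heis, e, Matrix.det_fin_two]
  congr 2 <;> simp [pow_add] <;> field_simp

/-! ### Orbits of the diagonal group and the Heisenberg group on cosets -/

theorem diagonalH_mul (h k : GL (Fin 2) ℚ_[ℓ]) :
    diagonalH (h * k) = diagonalH h * diagonalH k := rfl

theorem diagonalH_inv (h : GL (Fin 2) ℚ_[ℓ]) : diagonalH h⁻¹ = (diagonalH h)⁻¹ := rfl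

theorem norm_natCast_le_one (n : ℕ) : ‖(n : ℚ_[ℓ])‖ ≤ 1 := by
  exact_mod_cast Padic.norm_int_le_one (n : ℤ)

theorem norm_prime_pow_le_one (n : ℕ) : ‖(ℓ : ℚ_[ℓ]) ^ n‖ ≤ 1 := by
  exact_mod_cast norm_natCast_le_one (ℓ ^ n)

/-- The union of the cosets `p m K_{1,0}`, where `p` runs through the products of the diagonal
`SL₂(ℤ_ℓ)` and the integral Heisenberg group. -/
def orbitSet (m : HQ ℓ) : Set (GQ ℓ) :=
  {g | ∃ h ∈ SLint ℓ, ∃ x y z : ℚ_[ℓ], ‖x‖ ≤ 1 ∧ ‖y‖ ≤ 1 ∧ ‖z‖ ≤ 1 ∧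
    (lev (diagonalH h) * heis x y z * lev m)⁻¹ * g ∈ K10 ℓ}

/-- A family of representatives for `SL₂(ℤ_ℓ)` modulo the elements whose conjugate by `m` is
integral. -/
structure IsTransversal {R : Type*} (m : HQ ℓ) (τ : R → GL (Fin 2) ℚ_[ℓ]) : Prop where
  mem : ∀ r, τ r ∈ SLint ℓ
  cover : ∀ h ∈ SLint ℓ, ∃ r, IsIntegralH (m⁻¹ * diagonalH ((τ r)⁻¹ * h) * m)
  inj : ∀ r r', IsIntegralH (m⁻¹ * diagonalH ((τ r)⁻¹ * τ r') * m) → r = r'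

/-- Representatives for the cosets of `K_{1,0}` in `orbitSet m`, for `m` diagonal with first
component `diag(ℓ^a, ℓ^b)`. -/
def orbitRep {R : Type*} (a b : ℕ) (m : HQ ℓ) (τ : R → GL (Fin 2) ℚ_[ℓ])
    (i : R × Fin (ℓ ^ b) × Fin (ℓ ^ a) × Fin (ℓ ^ (a + b))) : GQ ℓ :=
  lev (diagonalH (τ i.1)) * heis ((i.2.1 : ℕ) : ℚ_[ℓ]) ((i.2.2.1 : ℕ) : ℚ_[ℓ])
    ((i.2.2.2 : ℕ) : ℚ_[ℓ]) * lev m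

theorem norm_sub_mul_le_one {x y u v : ℚ_[ℓ]} (hx : ‖x‖ ≤ 1) (hy : ‖y‖ ≤ 1) (hu : ‖u‖ ≤ 1)
    (hv : ‖v‖ ≤ 1) : ‖x * u - y * v‖ ≤ 1 :=
  norm_sub_le_of_le (norm_mul_le_one hx hu) (norm_mul_le_one hy hv)

theorem mem_orbitSet_iff {R : Type*} {a b a' b' : ℕ} {h : a + b = a' + b'}
    {τ : R → GL (Fin 2) ℚ_[ℓ]} (hτ : IsTransversal (dH ℓ a b a' b' h) τ) (g : GQ ℓ) :
    g ∈ orbitSet (dH ℓ a b a' b' h) ↔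
      ∃ i, (orbitRep a b (dH ℓ a b a' b' h) τ i)⁻¹ * g ∈ K10 ℓ := by
  set m := dH ℓ a b a' b' h with hm
  constructor
  · rintro ⟨k, hk, x, y, z, hx, hy, hz, hg⟩
    obtain ⟨r, hr⟩ := hτ.cover k hk
    set k₀ := (τ r)⁻¹ * k with hk₀
    have hk₀S := mem_SLint.1 (mul_mem (inv_mem (hτ.mem r)) hk)
    rw [← hk₀] at hk₀S
    have hkk : k = τ r * k₀ := by rw [hk₀, mul_inv_cancel_left]
    -- The part `k₀` of `k` that `lev m` absorbs on the right is moved past the Heisenberg element;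
    -- the new coordinates are then reduced to digits.
    set x₁ := x * k₀.1 1 1 - y * k₀.1 1 0
    set y₁ := y * k₀.1 0 0 - x * k₀.1 0 1
    have hx₁ : ‖x₁‖ ≤ 1 := norm_sub_mul_le_one hx hy (hk₀S.1 _ _) (hk₀S.1 _ _)
    have hy₁ : ‖y₁‖ ≤ 1 := norm_sub_mul_le_one hy hx (hk₀S.1 _ _) (hk₀S.1 _ _)
    obtain ⟨i, hi⟩ := exists_digit hx₁ b
    obtain ⟨j, hj⟩ := exists_digit hy₁ a
    have hi' := norm_sub_le_of_le hx₁ (norm_natCast_le_one (ℓ := ℓ) i)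
    have hj' := norm_sub_le_of_le hy₁ (norm_natCast_le_one (ℓ := ℓ) j)
    have hz₁ : ‖z - ((i : ℕ) * (y₁ - (j : ℕ)) - (j : ℕ) * (x₁ - (i : ℕ)))‖ ≤ 1 :=
      norm_sub_le_of_le hz (norm_sub_mul_le_one (norm_natCast_le_one _) (norm_natCast_le_one _)
        hj' hi')
    obtain ⟨l, hl⟩ := exists_digit hz₁ (a + b)
    refine ⟨(r, i, j, l), ?_⟩
    have key : (orbitRep a b m τ (r, i, j, l))⁻¹ *
        (lev (diagonalH k) * heis x y z * lev m) ∈ K10 ℓ := by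
      have e1 : lev (diagonalH k) * heis x y z * lev m
          = lev (diagonalH (τ r)) * heis ((i : ℕ) : ℚ_[ℓ]) ((j : ℕ) : ℚ_[ℓ]) ((l : ℕ) : ℚ_[ℓ]) *
            (heis (x₁ - ((i : ℕ) : ℚ_[ℓ])) (y₁ - ((j : ℕ) : ℚ_[ℓ]))
              (z - (((i : ℕ) : ℚ_[ℓ]) * (y₁ - ((j : ℕ) : ℚ_[ℓ]))
                - ((j : ℕ) : ℚ_[ℓ]) * (x₁ - ((i : ℕ) : ℚ_[ℓ]))) - ((l : ℕ) : ℚ_[ℓ])) * lev m) *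
            lev (m⁻¹ * diagonalH k₀ * m) := by
        have e2 : heis ((i : ℕ) : ℚ_[ℓ]) ((j : ℕ) : ℚ_[ℓ]) ((l : ℕ) : ℚ_[ℓ]) *
          heis (x₁ - ((i : ℕ) : ℚ_[ℓ])) (y₁ - ((j : ℕ) : ℚ_[ℓ]))
            (z - (((i : ℕ) : ℚ_[ℓ]) * (y₁ - ((j : ℕ) : ℚ_[ℓ]))
              - ((j : ℕ) : ℚ_[ℓ]) * (x₁ - ((i : ℕ) : ℚ_[ℓ]))) - ((l : ℕ) : ℚ_[ℓ]))
            = heis x₁ y₁ z := by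
          rw [heis_mul]; congr 1 <;> ring
        have e3 : lev (diagonalH k₀) * heis x y z = heis x₁ y₁ z * lev (diagonalH k₀) := by
          rw [lev_mul_heis, show (diagonalH k₀).1.1.1.det = 1 from hk₀S.2, one_mul]
          rfl
        rw [hkk, diagonalH_mul, map_mul, mul_assoc (lev (diagonalH (τ r))), e3, ← e2]
        simp only [map_mul, map_inv]
        group
      rw [e1, hm, lev_dH_conj_heis, ← hm]
      have e4 (u v n k : GQ ℓ) : (u * n * v)⁻¹ * (u * n * (v * k) * lev (m⁻¹ * diagonalH k₀ * m))
          = k * lev (m⁻¹ * diagonalH k₀ * m) := by group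
      rw [orbitRep, e4, heis_lev_mem_K10]
      exact ⟨norm_le_zpow_iff.1 hi, norm_le_zpow_iff.1 hj, norm_le_zpow_iff.1 hl, hr⟩
    have := mul_mem key hg
    rwa [mul_assoc, mul_inv_cancel_left] at this
  · rintro ⟨⟨r, i, j, l⟩, hi⟩
    exact ⟨τ r, hτ.mem r, _, _, _, norm_natCast_le_one _, norm_natCast_le_one _,
      norm_natCast_le_one _, hi⟩

theorem orbitRep_injective {R : Type*} {a b a' b' : ℕ} {h : a + b = a' + b'}
    {τ : R → GL (Fin 2) ℚ_[ℓ]} (hτ : IsTransversal (dH ℓ a b a' b' h) τ)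
    (i j : R × Fin (ℓ ^ b) × Fin (ℓ ^ a) × Fin (ℓ ^ (a + b)))
    (hij : (orbitRep a b (dH ℓ a b a' b' h) τ i)⁻¹ *
      orbitRep a b (dH ℓ a b a' b' h) τ j ∈ K10 ℓ) : i = j := by
  obtain ⟨r, x, y, z⟩ := i
  obtain ⟨r', x', y', z'⟩ := j
  obtain rfl : r = r' := by
    refine hτ.inj r r' ?_
    have := isIntegralH_of_inv_mul_mem hij
    rwa [mul_assoc _ (diagonalH (τ r))⁻¹] at this
  have e (u v n k : GQ ℓ) : (u * n * v)⁻¹ * (u * k * v) = v⁻¹ * (n⁻¹ * k * v) := by group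
  rw [orbitRep, orbitRep, e, heis_inv, heis_mul, lev_dH_conj_heis, inv_mul_cancel_left,
    ← mul_one (heis _ _ _), ← map_one lev, heis_lev_mem_K10] at hij
  obtain ⟨h1, h2, h3, -⟩ := hij
  dsimp only at h1 h2 h3
  rw [neg_add_eq_sub] at h1 h2
  obtain rfl := digit_unique (norm_le_zpow_iff.2 h1)
  obtain rfl := digit_unique (norm_le_zpow_iff.2 h2)
  have e2 : -((z : ℕ) : ℚ_[ℓ]) + (z' : ℕ) + (-((x' : ℕ) : ℚ_[ℓ]) * (y' : ℕ)
    - -((y' : ℕ) : ℚ_[ℓ]) * (x' : ℕ)) = (z' : ℕ) - (z : ℕ) := by ring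
  rw [e2] at h3
  obtain rfl := digit_unique (norm_le_zpow_iff.2 h3)
  rfl

/-! ### Equivariant functions -/

/-- The invariance properties of the value at `φ_∞` as a function on `G`: invariance on the right
under `K_{1,0}`, and equivariance on the left under the elements of `H` whose first component has
bottom row `(0, 1)`. -/
structure IsEquivariant {W : Type*} [AddCommGroup W] [Module ℂ W] (z : GQ ℓ → W) : Prop where
  right : ∀ g, ∀ k ∈ K10 ℓ, z (g * k) = z g
  left : ∀ (q : HQ ℓ) (g : GQ ℓ), q.1.1.1 1 0 = 0 → q.1.1.1 1 1 = 1 →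
    z (iota ℓ q * g) = (‖q.1.1.1.det‖ : ℂ) • z g

/-- The value on the element with Heisenberg coordinates `(p, q, 0)` and Levi component `m`. -/
def hval {W : Type*} (z : GQ ℓ → W) (p q : ℚ_[ℓ]) (m : HQ ℓ) : W := z (heis p q 0 * lev m)

section Equivariant

variable {W : Type*} [AddCommGroup W] [Module ℂ W] {z : GQ ℓ → W}

/-- The centre of the Heisenberg group is the upper unipotent subgroup of the first factor of `H`.
-/
theorem IsEquivariant.heis_left (hz : IsEquivariant z) (c : ℚ_[ℓ]) (g : GQ ℓ) :
    z (heis 0 0 c * g) = z g := by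
  have hs : (1 : ℚ_[ℓ]) * 1 - c * 0 = 1 := by ring
  have h0 : (sl 1 c 0 1 hs).1.det = (1 : GL (Fin 2) ℚ_[ℓ]).1.det := by rw [sl_det]; simp
  have := hz.left (pairH _ 1 h0) g rfl rfl
  have e : (pairH _ 1 h0).1.1.1.det = 1 := sl_det _ _ _ _ hs
  have e2 : iota ℓ (pairH _ 1 h0) = heis 0 0 c := by
    refine GQ_ext ?_ rfl
    change iotaMat ℓ _ = _
    rw [heis_fst]
    ext i j
    fin_cases i <;> fin_cases j <;> simp [iotaMat, pairH, sl]
  rw [e, e2] at this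
  simpa using this

/-- The element `lev (h, h)` is the image of `(diag(det h, 1), h)` under the embedding of `H`. -/
theorem IsEquivariant.diagonal_left (hz : IsEquivariant z) (h : GL (Fin 2) ℚ_[ℓ]) (g : GQ ℓ) :
    z (lev (diagonalH h) * g) = (‖h.1.det‖ : ℂ) • z g := by
  have hd : h.1.det ≠ 0 := ((Matrix.isUnit_iff_isUnit_det _).1 h.isUnit).ne_zero
  have e0 : (dg h.1.det 1 hd one_ne_zero).1.det = h.1.det := by
    rw [dg_val, Matrix.det_fin_two]; simp
  have := hz.left (pairH (dg h.1.det 1 hd one_ne_zero) h e0) g rfl rfl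
  have e : (pairH (dg h.1.det 1 hd one_ne_zero) h e0 : HQ ℓ).1.1.1.det = h.1.det := e0
  have e2 : iota ℓ (pairH (dg h.1.det 1 hd one_ne_zero) h e0) = lev (diagonalH h) := by
    refine GQ_ext ?_ rfl
    change iotaMat ℓ _ = levMat _
    ext i j
    fin_cases i <;> fin_cases j <;>
      simp [iotaMat, levMat, pairH, dg, diagonalH, Matrix.det_fin_two]
  rw [e, e2] at this
  exact this

theorem IsEquivariant.hval_eq (hz : IsEquivariant z) (p q c : ℚ_[ℓ]) (m : HQ ℓ) :
    z (heis p q c * lev m) = hval z p q m := by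
  have : heis p q c = heis 0 0 c * heis p q 0 := by
    rw [heis_mul]; congr 1 <;> ring
  rw [this, mul_assoc, hz.heis_left]
  rfl

theorem IsEquivariant.hval_mul_right (hz : IsEquivariant z) (p q : ℚ_[ℓ]) (m : HQ ℓ) {k : HQ ℓ}
    (hk : IsIntegralH k) : hval z p q (m * k) = hval z p q m := by
  rw [hval, map_mul, ← mul_assoc, hz.right _ _ (lev_mem_K10.2 hk)]
  rfl

theorem IsEquivariant.hval_add (hz : IsEquivariant z) (p q : ℚ_[ℓ]) (m : HQ ℓ)
    (hm : m.1.1 = 1) {s t : ℚ_[ℓ]} (hs : ‖s‖ ≤ 1) (ht : ‖t‖ ≤ 1) :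
    hval z (p + s) (q + t) m = hval z p q m := by
  have e : heis p q 0 * lev m * heis s t 0 = heis (p + s) (q + t) (p * t - q * s) * lev m := by
    rw [mul_assoc, lev_mul_heis, ← mul_assoc, heis_mul, hm]
    simp
  rw [← hz.hval_eq _ _ (p * t - q * s), ← e, hz.right _ _ (heis_mem_K10 hs ht (by simp))]
  rfl

theorem IsEquivariant.hval_diagonal (hz : IsEquivariant z) (p q : ℚ_[ℓ]) (m : HQ ℓ)
    (h : GL (Fin 2) ℚ_[ℓ]) :
    hval z (p * h.1 1 1 - q * h.1 1 0) (q * h.1 0 0 - p * h.1 0 1) (diagonalH h * m)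
      = (‖h.1.det‖ : ℂ) • hval z p q m := by
  rw [hval, map_mul, ← mul_assoc]
  have := lev_mul_heis (diagonalH h) p q 0
  rw [mul_zero] at this
  change z (heis _ _ _ * lev (diagonalH h) * lev m) = _
  erw [← this]
  rw [mul_assoc, hz.diagonal_left]
  rfl

/-- The sum of the values over the cosets in an orbit. The sum over the centre of the Heisenberg
group cancels the factor from the multiplier. -/
theorem IsEquivariant.sum_orbitRep (hz : IsEquivariant z) {R : Type*} [Fintype R]
    {a b a' b' : ℕ} {h : a + b = a' + b'} {τ : R → GL (Fin 2) ℚ_[ℓ]}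
    (hτ : IsTransversal (dH ℓ a b a' b' h) τ) {m₀ : HQ ℓ}
    (hm₀ : diagonalH (dgp ℓ a b) * m₀ = dH ℓ a b a' b' h) :
    ∑ i, z (orbitRep a b (dH ℓ a b a' b' h) τ i) = (Fintype.card R : ℂ) •
      ∑ x : Fin (ℓ ^ b), ∑ y : Fin (ℓ ^ a), hval z (((x : ℕ) : ℚ_[ℓ]) / (ℓ : ℚ_[ℓ]) ^ b)
        (((y : ℕ) : ℚ_[ℓ]) / (ℓ : ℚ_[ℓ]) ^ a) m₀ := by
  have hℓ := prime_ne_zero ℓ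
  have hℓ' : (ℓ : ℂ) ≠ 0 := Nat.cast_ne_zero.2 (Fact.out : ℓ.Prime).ne_zero
  have key (i : R × Fin (ℓ ^ b) × Fin (ℓ ^ a) × Fin (ℓ ^ (a + b))) :
      z (orbitRep a b (dH ℓ a b a' b' h) τ i) = ((ℓ : ℂ) ^ (a + b))⁻¹ •
        hval z (((i.2.1 : ℕ) : ℚ_[ℓ]) / (ℓ : ℚ_[ℓ]) ^ b)
          (((i.2.2.1 : ℕ) : ℚ_[ℓ]) / (ℓ : ℚ_[ℓ]) ^ a) m₀ := by
    rw [orbitRep, mul_assoc, hz.diagonal_left, (mem_SLint.1 (hτ.mem _)).2, norm_one,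
      Complex.ofReal_one, one_smul, hz.hval_eq]
    have := hz.hval_diagonal (((i.2.1 : ℕ) : ℚ_[ℓ]) / (ℓ : ℚ_[ℓ]) ^ b)
          (((i.2.2.1 : ℕ) : ℚ_[ℓ]) / (ℓ : ℚ_[ℓ]) ^ a) m₀ (dgp ℓ a b)
    rw [hm₀] at this
    have e : (dgp ℓ a b).1 = !![(ℓ : ℚ_[ℓ]) ^ a, 0; 0, (ℓ : ℚ_[ℓ]) ^ b] := rfl
    have ed : (‖(dgp ℓ a b).1.det‖ : ℂ) = ((ℓ : ℂ) ^ (a + b))⁻¹ := by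
      rw [e, Matrix.det_fin_two]
      simp [pow_add, mul_comm]
    rw [ed, e] at this
    rw [← this]
    congr 1 <;> simp
  simp only [key, ← Finset.smul_sum, Fintype.sum_prod_type, Finset.sum_const, Finset.card_univ,
    Fintype.card_fin]
  simp only [← Nat.cast_smul_eq_nsmul ℂ, smul_smul]
  congr 1
  push_cast
  field_simp

end Equivariant

/-! ### The double cosets as unions of orbits -/

theorem mem_doubleCoset_iff {u x : GQ ℓ} : x ∈ doubleCoset ℓ (K ℓ 1 1) u (K ℓ 1 0) ↔
    ∃ k ∈ K ℓ 1 1, (k * u)⁻¹ * x ∈ K10 ℓ := by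
  constructor
  · rintro ⟨⟨k, k'⟩, ⟨hk, hk'⟩, rfl⟩
    refine ⟨k, hk, ?_⟩
    change (k * u)⁻¹ * (k * u * k') ∈ _
    rw [inv_mul_cancel_left]
    exact mem_K_iff.1 hk'
  · rintro ⟨k, hk, h⟩
    exact ⟨⟨k, _⟩, ⟨hk, mem_K_iff.2 h⟩, mul_inv_cancel_left _ _⟩

theorem mem_K11_iff {g : GQ ℓ} : g ∈ K ℓ 1 1 ↔ g ∈ K10 ℓ ∧
    (‖g.1.1.1 1 0‖ ≤ (ℓ : ℝ) ^ (-((1 : ℕ) : ℤ)) ∧ ‖g.1.1.1 2 0‖ ≤ (ℓ : ℝ) ^ (-((1 : ℕ) : ℤ)) ∧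
      ‖g.1.1.1 3 0‖ ≤ (ℓ : ℝ) ^ (-((1 : ℕ) : ℤ)) ∧ ‖g.1.1.1 3 1‖ ≤ (ℓ : ℝ) ^ (-((1 : ℕ) : ℤ)) ∧
      ‖g.1.1.1 3 2‖ ≤ (ℓ : ℝ) ^ (-((1 : ℕ) : ℤ))) := by
  rw [mem_K10_iff]
  constructor
  · rintro ⟨⟨h1, h2⟩, h4, h3⟩
    exact ⟨⟨h1.1, h2.1, h3⟩, h4⟩
  · rintro ⟨⟨h1, h2, h3⟩, h4⟩
    have hd := norm_eq_one_of_sub h3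
    exact ⟨⟨⟨h1, norm_det_fst_eq_one hd⟩, h2, hd⟩, h4, h3⟩

theorem heis_lev_mem_K11 {x y z : ℚ_[ℓ]} {m : HQ ℓ} (hx : ‖x‖ ≤ 1) (hy : ‖y‖ ≤ 1) (hz : ‖z‖ ≤ 1)
    (hm : IsIntegralH m) : heis x y z * lev m ∈ K ℓ 1 1 := by
  rw [mem_K11_iff, heis_lev_fst]
  refine ⟨heis_lev_mem_K10.2 ⟨hx, hy, hz, hm⟩, ?_⟩
  simp

theorem norm_div_le_one {x y : ℚ_[ℓ]} (hx : ‖x‖ ≤ 1) (hy : ‖y‖ = 1) : ‖x / y‖ ≤ 1 := by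
  rwa [norm_div, hy, div_one]

/-- Conjugation by the inverse of a dominant diagonal element keeps lower triangular integral
elements integral. -/
theorem conj_lower_mem_K10 {k : GQ ℓ} (hk : k ∈ K10 ℓ) {p q r s t u v w o r' t' : ℚ_[ℓ]}
    (h1 : k.1.1.1 = !![p, 0, 0, 0; q, r, 0, 0; s, 0, t, 0; u, v, w, o])
    (h2 : k.1.2.1 = !![r', 0; 0, t']) (a b a' b' : ℕ) (h) :
    (lev (dH ℓ a b a' b' h))⁻¹ * k * lev (dH ℓ a b a' b' h) ∈ K10 ℓ := by
  have hℓ := prime_ne_zero ℓ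
  have hp := norm_prime_pow_le_one (ℓ := ℓ)
  rw [mem_K10_iff, h1, h2] at hk
  obtain ⟨hk1, hk2, hk3⟩ := hk
  have e1 : ((lev (dH ℓ a b a' b' h))⁻¹ * k * lev (dH ℓ a b a' b' h)).1.1.1
      = !![p, 0, 0, 0; q * (ℓ : ℚ_[ℓ]) ^ b, r, 0, 0; s * (ℓ : ℚ_[ℓ]) ^ a, 0, t, 0;
          u * (ℓ : ℚ_[ℓ]) ^ (a + b), v * (ℓ : ℚ_[ℓ]) ^ a, w * (ℓ : ℚ_[ℓ]) ^ b, o] := by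
    rw [← map_inv, mul_fst, mul_fst, h1, lev_fst, lev_fst]
    have ei : ((dH ℓ a b a' b' h)⁻¹).1.1.1
        = !![((ℓ : ℚ_[ℓ]) ^ a)⁻¹, 0; 0, ((ℓ : ℚ_[ℓ]) ^ b)⁻¹] := rfl
    have ed : (dH ℓ a b a' b' h).1.1.1 = !![(ℓ : ℚ_[ℓ]) ^ a, 0; 0, (ℓ : ℚ_[ℓ]) ^ b] := rfl
    rw [ei, ed]
    ext i j
    fin_cases i <;> fin_cases j <;> simp [Matrix.mul_apply, Fin.sum_univ_succ, pow_add] <;>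
      field_simp
  have e2 : ((lev (dH ℓ a b a' b' h))⁻¹ * k * lev (dH ℓ a b a' b' h)).1.2.1 = !![r', 0; 0, t'] := by
    rw [← map_inv, mul_snd, mul_snd, h2, lev_snd, lev_snd]
    have ei : ((dH ℓ a b a' b' h)⁻¹).1.2.1
        = !![((ℓ : ℚ_[ℓ]) ^ a')⁻¹, 0; 0, ((ℓ : ℚ_[ℓ]) ^ b')⁻¹] := rfl
    have ed : (dH ℓ a b a' b' h).1.2.1 = !![(ℓ : ℚ_[ℓ]) ^ a', 0; 0, (ℓ : ℚ_[ℓ]) ^ b'] := rfl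
    rw [ei, ed]
    ext i j
    fin_cases i <;> fin_cases j <;> simp [Matrix.mul_apply, Fin.sum_univ_succ] <;>
      field_simp
  rw [mem_K10_iff, e1, e2]
  refine ⟨?_, hk2, hk3⟩
  have hp0 : ‖p‖ ≤ 1 := by simpa using hk1 0 0
  have hr : ‖r‖ ≤ 1 := by simpa using hk1 1 1
  have ht : ‖t‖ ≤ 1 := by simpa using hk1 2 2
  have ho : ‖o‖ ≤ 1 := by simpa using hk1 3 3
  have hq := norm_mul_le_one (show ‖q‖ ≤ 1 by simpa using hk1 1 0) (hp b)
  have hs := norm_mul_le_one (show ‖s‖ ≤ 1 by simpa using hk1 2 0) (hp a)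
  have hu := norm_mul_le_one (show ‖u‖ ≤ 1 by simpa using hk1 3 0) (hp (a + b))
  have hv := norm_mul_le_one (show ‖v‖ ≤ 1 by simpa using hk1 3 1) (hp a)
  have hw := norm_mul_le_one (show ‖w‖ ≤ 1 by simpa using hk1 3 2) (hp b)
  clear e1 e2
  generalize q * (ℓ : ℚ_[ℓ]) ^ b = q at *
  generalize s * (ℓ : ℚ_[ℓ]) ^ a = s at *
  generalize u * (ℓ : ℚ_[ℓ]) ^ (a + b) = u at *
  generalize v * (ℓ : ℚ_[ℓ]) ^ a = v at *
  generalize w * (ℓ : ℚ_[ℓ]) ^ b = w at *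
  intro i j
  fin_cases i <;> fin_cases j <;> simp [*]

/-- The Iwahori factorization of `K_{1,1}`: up to an integral element of the parabolic an element
is lower triangular, and so is absorbed on the right by `K_{1,0}` after a dominant diagonal
element. -/
theorem exists_parabolic_of_mem_K11 {k : GQ ℓ} (hk : k ∈ K ℓ 1 1) :
    ∃ A ∈ SLint ℓ, ∃ B ∈ SLint ℓ, ∃ hAB : A.1.det = B.1.det, ∃ x y z : ℚ_[ℓ],
      ‖x‖ ≤ 1 ∧ ‖y‖ ≤ 1 ∧ ‖z‖ ≤ 1 ∧ ∀ a b a' b' h,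
        (heis x y z * lev (pairH A B hAB) * lev (dH ℓ a b a' b' h))⁻¹ *
          (k * lev (dH ℓ a b a' b' h)) ∈ K10 ℓ := by
  obtain ⟨hk10, h10, h20, h30, -, -⟩ := mem_K11_iff.1 hk
  obtain ⟨hM, hB, hμ1⟩ := mem_K10_iff.1 hk10
  have hμ := norm_eq_one_of_sub hμ1
  set M := k.1.1.1 with hMdef
  -- The multiplier relation in the corner shows that the last diagonal entry is a unit.
  have hlam : ‖M 3 3‖ = 1 := by
    have hrel := congrFun (congrFun (show M.transpose * J ℚ_[ℓ] * M = _ from k.2) 0) 3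
    simp [J, Matrix.mul_apply, Fin.sum_univ_succ] at hrel
    have e : M 0 0 * M 3 3 - k.1.2.1.det = M 2 0 * M 1 3 + M 3 0 * M 0 3 - M 1 0 * M 2 3 := by
      linear_combination hrel
    have hle (x y : ℚ_[ℓ]) (hx : ‖x‖ ≤ (ℓ : ℝ) ^ (-((1 : ℕ) : ℤ))) (hy : ‖y‖ ≤ 1) :
        ‖x * y‖ ≤ (ℓ : ℝ) ^ (-((1 : ℕ) : ℤ)) := by
      rw [norm_mul]
      exact (mul_le_of_le_one_right (norm_nonneg _) hy).trans hx
    have h1 : ‖M 0 0 * M 3 3 - k.1.2.1.det‖ ≤ (ℓ : ℝ) ^ (-((1 : ℕ) : ℤ)) := by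
      rw [e]
      exact norm_sub_le_of_le (norm_add_le_of_le (hle _ _ h20 (hM _ _)) (hle _ _ h30 (hM _ _)))
        (hle _ _ h10 (hM _ _))
    have h2 : ‖M 0 0 * M 3 3‖ = 1 := by
      apply norm_eq_one_of_sub
      have := norm_add_le_of_le h1 hμ1
      rwa [sub_add_sub_cancel] at this
    refine le_antisymm (hM 3 3) ?_
    rw [norm_mul] at h2
    rw [← h2]
    exact mul_le_of_le_one_left (norm_nonneg _) (hM 0 0)
  have hlam0 : M 3 3 ≠ 0 := by rw [← norm_ne_zero_iff, hlam]; exact one_ne_zero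
  set x := -(M 2 3) / M 3 3 with hx
  set y := M 1 3 / M 3 3 with hy
  set z := M 0 3 / M 3 3 with hz
  have hx1 : ‖x‖ ≤ 1 := norm_div_le_one (by rw [norm_neg]; exact hM _ _) hlam
  have hy1 : ‖y‖ ≤ 1 := norm_div_le_one (hM _ _) hlam
  have hz1 : ‖z‖ ≤ 1 := norm_div_le_one (hM _ _) hlam
  set g := (heis x y z)⁻¹ * k with hg
  have hg10 : g ∈ K10 ℓ := mul_mem (inv_mem (heis_mem_K10 hx1 hy1 hz1)) hk10
  have hgs : g.1.2.1 = k.1.2.1 := by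
    rw [hg, heis_inv, mul_snd, heis_snd, one_mul]
  obtain ⟨hG, -, -⟩ := mem_K10_iff.1 hg10
  have hrel := show g.1.1.1.transpose * J ℚ_[ℓ] * g.1.1.1 = _ from g.2
  rw [hgs] at hrel
  set μ := k.1.2.1.det with hμdef
  have hμ0 : μ ≠ 0 := by rw [← norm_ne_zero_iff, hμ]; exact one_ne_zero
  have hcol : g.1.1.1 0 3 = 0 ∧ g.1.1.1 1 3 = 0 ∧ g.1.1.1 2 3 = 0 ∧ g.1.1.1 3 3 = M 3 3 := by
    have e : g.1.1.1 = (heis (-x) (-y) (-z)).1.1.1 * M := by rw [hg, heis_inv, mul_fst]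
    rw [e, heis_fst]
    simp only [Matrix.mul_apply, Fin.sum_univ_succ, hx, hy, hz]
    simp
    refine ⟨?_, ?_, ?_⟩ <;> field_simp <;> ring
  set G := g.1.1.1 with hGdef
  obtain ⟨c0, c1, c2, c3⟩ := hcol
  have r1 := congrFun (congrFun hrel 1) 3
  have r2 := congrFun (congrFun hrel 2) 3
  have r12 := congrFun (congrFun hrel 1) 2
  simp [J, Matrix.mul_apply, Fin.sum_univ_succ, c0, c1, c2, c3, hlam0] at r1 r2
  simp [J, Matrix.mul_apply, Fin.sum_univ_succ, r1, r2] at r12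
  have rμ : G 1 1 * G 2 2 - G 1 2 * G 2 1 = μ := by linear_combination r12
  have rB : k.1.2.1 0 0 * k.1.2.1 1 1 - k.1.2.1 0 1 * k.1.2.1 1 0 = μ := by
    rw [hμdef, Matrix.det_fin_two]
  have hA : G 1 1 / μ * G 2 2 - G 1 2 * (G 2 1 / μ) = 1 := by
    field_simp; linear_combination rμ
  have hB' : k.1.2.1 0 0 / μ * k.1.2.1 1 1 - k.1.2.1 0 1 * (k.1.2.1 1 0 / μ) = 1 := by
    field_simp; linear_combination rB
  have hAS : sl _ _ _ _ hA ∈ SLint ℓ := sl_mem_SLint (norm_div_le_one (hG _ _) hμ) (hG _ _)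
    (norm_div_le_one (hG _ _) hμ) (hG _ _)
  have hBS : sl _ _ _ _ hB' ∈ SLint ℓ := sl_mem_SLint (norm_div_le_one (hB _ _) hμ) (hB _ _)
    (norm_div_le_one (hB _ _) hμ) (hB _ _)
  have hAB : (sl _ _ _ _ hA).1.det = (sl _ _ _ _ hB').1.det := by rw [sl_det, sl_det]
  refine ⟨_, hAS, _, hBS, hAB, x, y, z, hx1, hy1, hz1, fun a b a' b' h => ?_⟩
  set P := pairH _ _ hAB with hP
  have hP10 : lev P ∈ K10 ℓ := lev_mem_K10.2 (isIntegralH_of_SLint hAS hBS)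
  have e : (heis x y z * lev P * lev (dH ℓ a b a' b' h))⁻¹ * (k * lev (dH ℓ a b a' b' h))
      = (lev (dH ℓ a b a' b' h))⁻¹ * ((lev P)⁻¹ * g) * lev (dH ℓ a b a' b' h) := by
    rw [hg]; group
  rw [e]
  have eP : (P⁻¹).1.1.1 = !![G 2 2, -G 1 2; -(G 2 1 / μ), G 1 1 / μ] := rfl
  have eP' : (P⁻¹).1.2.1 = !![k.1.2.1 1 1, -k.1.2.1 0 1; -(k.1.2.1 1 0 / μ), k.1.2.1 0 0 / μ] := rfl
  refine conj_lower_mem_K10 (mul_mem (inv_mem hP10) hg10)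
    (p := G 0 0) (q := G 2 2 * G 1 0 - G 1 2 * G 2 0) (r := μ)
    (s := -(G 2 1 / μ) * G 1 0 + G 1 1 / μ * G 2 0) (t := 1) (u := G 3 0) (v := G 3 1)
    (w := G 3 2) (o := G 3 3) (r' := μ) (t' := 1) ?_ ?_ a b a' b' h
  · rw [← map_inv, mul_fst, lev_fst, eP, ← hGdef]
    ext i j
    fin_cases i <;> fin_cases j <;>
      simp [Matrix.mul_apply, Fin.sum_univ_succ, c0, c1, c2, r1, r2] <;>
      field_simp <;> first | ring1 | linear_combination rμ | linear_combination G 0 0 * rμ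
  · rw [← map_inv, mul_snd, lev_snd, eP', hgs]
    ext i j
    fin_cases i <;> fin_cases j <;>
      simp [Matrix.mul_apply, Fin.sum_univ_succ] <;>
      field_simp <;> first | ring1 | linear_combination rB

theorem norm_div_prime_le_one {x : ℚ_[ℓ]} (hlt : ‖x‖ < 1) : ‖x / ℓ‖ ≤ 1 := by
  obtain ⟨w, hw⟩ := (PadicInt.norm_lt_one_iff_dvd (p := ℓ) (⟨x, hlt.le⟩ : ℤ_[ℓ])).1 hlt
  have hw' : x = ℓ * (w : ℚ_[ℓ]) := by
    have := congrArg (Subtype.val) hw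
    simpa using this
  rw [hw', mul_div_cancel_left₀ _ (prime_ne_zero ℓ)]
  exact w.2

/-- A Levi element that factors as `(h, h) m' k` with `k` integral lies in the orbit of `m'`. -/
theorem mem_orbitSet_of_factor {m m' k : HQ ℓ} {h : GL (Fin 2) ℚ_[ℓ]} (hh : h ∈ SLint ℓ)
    (hk : IsIntegralH k) (e : m = diagonalH h * m' * k) {x y z : ℚ_[ℓ]} (hx : ‖x‖ ≤ 1)
    (hy : ‖y‖ ≤ 1) (hz : ‖z‖ ≤ 1) {g : GQ ℓ} (hg : (heis x y z * lev m)⁻¹ * g ∈ K10 ℓ) :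
    g ∈ orbitSet m' := by
  have hi := mem_SLint.1 (inv_mem hh)
  have key := lev_mul_heis (diagonalH h⁻¹) x y z
  rw [show (diagonalH h⁻¹).1.1.1.det = 1 from hi.2, one_mul] at key
  refine ⟨h, hh, _, _, z, norm_sub_mul_le_one hx hy (hi.1 1 1) (hi.1 1 0),
    norm_sub_mul_le_one hy hx (hi.1 0 0) (hi.1 0 1), hz, ?_⟩
  have key2 : heis x y z * lev (diagonalH h) = lev (diagonalH h) *
      heis (x * (h⁻¹).1 1 1 - y * (h⁻¹).1 1 0) (y * (h⁻¹).1 0 0 - x * (h⁻¹).1 0 1) z := by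
    have e1 : heis (x * (h⁻¹).1 1 1 - y * (h⁻¹).1 1 0) (y * (h⁻¹).1 0 0 - x * (h⁻¹).1 0 1) z
        = lev (diagonalH h⁻¹) * heis x y z * (lev (diagonalH h⁻¹))⁻¹ :=
      eq_mul_inv_of_mul_eq key.symm
    rw [e1, diagonalH_inv, map_inv]
    group
  have e3 : heis x y z * lev m = lev (diagonalH h) *
      heis (x * (h⁻¹).1 1 1 - y * (h⁻¹).1 1 0) (y * (h⁻¹).1 0 0 - x * (h⁻¹).1 0 1) z
      * lev m' * lev k := by
    rw [e, map_mul, map_mul, ← mul_assoc, ← mul_assoc, key2]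
  rw [e3, mul_inv_rev, mul_assoc] at hg
  have := mul_mem (lev_mem_K10.2 hk) hg
  rwa [mul_inv_cancel_left] at this

/-- The orbit of `m` lies in the double coset of `u` if `lev m` and `u` differ by integral
elements of the second factor `GL₂`. -/
theorem mem_doubleCoset_of_mem_orbitSet {m m' : HQ ℓ} {B : GL (Fin 2) ℚ_[ℓ]} (hB : B ∈ SLint ℓ)
    {k : HQ ℓ} (hk : IsIntegralH k) (h1 : (1 : GL (Fin 2) ℚ_[ℓ]).1.det = B.1.det)
    (e : m' = pairH 1 B h1 * m * k) {g : GQ ℓ} (hg : g ∈ orbitSet m') :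
    g ∈ doubleCoset ℓ (K ℓ 1 1) (lev m) (K ℓ 1 0) := by
  obtain ⟨h, hh, x, y, z, hx, hy, hz, hg⟩ := hg
  have hS := mem_SLint.1 hh
  rw [mem_doubleCoset_iff]
  refine ⟨lev (diagonalH h) * heis x y z * lev (pairH 1 B h1), ?_, ?_⟩
  · rw [lev_mul_heis, show (diagonalH h).1.1.1.det = 1 from hS.2, one_mul, mul_assoc, ← map_mul]
    refine heis_lev_mem_K11 (norm_sub_mul_le_one hx hy (hS.1 1 1) (hS.1 1 0))
      (norm_sub_mul_le_one hy hx (hS.1 0 0) (hS.1 0 1)) hz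
      (isIntegralH_of_SLint (mul_mem hh (one_mem _)) (mul_mem hh hB))
  · rw [e] at hg
    simp only [map_mul] at hg
    have e3 (a b c d : GQ ℓ) : (a * (b * c * d))⁻¹ * g = d⁻¹ * ((a * b * c)⁻¹ * g) := by group
    rw [e3] at hg
    have := mul_mem (lev_mem_K10.2 hk) hg
    rwa [mul_inv_cancel_left] at this

theorem isIntegralH_one : IsIntegralH (1 : HQ ℓ) := lev_mem_K10.1 (by rw [map_one]; exact one_mem _)

theorem mem_doubleCoset_of_mem_orbitSet_self {m : HQ ℓ} {g : GQ ℓ} (hg : g ∈ orbitSet m) :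
    g ∈ doubleCoset ℓ (K ℓ 1 1) (lev m) (K ℓ 1 0) :=
  mem_doubleCoset_of_mem_orbitSet (one_mem _) isIntegralH_one rfl
    (by rw [mul_one]; exact (one_mul m).symm) hg

/-- Every element of the double coset of `lev m`, for `m` diagonal, lies in a coset
`n lev((A, B) m) K_{1,0}` with `A`, `B` in `SL₂(ℤ_ℓ)` and `n` in the integral Heisenberg group. -/
theorem exists_factor_of_mem_doubleCoset {a b a' b' : ℕ} {h : a + b = a' + b'} {g : GQ ℓ}
    (hg : g ∈ doubleCoset ℓ (K ℓ 1 1) (lev (dH ℓ a b a' b' h)) (K ℓ 1 0)) :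
    ∃ A ∈ SLint ℓ, ∃ B ∈ SLint ℓ, ∃ hAB : A.1.det = B.1.det, ∃ x y z : ℚ_[ℓ],
      ‖x‖ ≤ 1 ∧ ‖y‖ ≤ 1 ∧ ‖z‖ ≤ 1 ∧
        (heis x y z * lev (pairH A B hAB * dH ℓ a b a' b' h))⁻¹ * g ∈ K10 ℓ := by
  obtain ⟨k, hk, hg⟩ := mem_doubleCoset_iff.1 hg
  obtain ⟨A, hA, B, hB, hAB, x, y, z, hx, hy, hz, H⟩ := exists_parabolic_of_mem_K11 hk
  refine ⟨A, hA, B, hB, hAB, x, y, z, hx, hy, hz, ?_⟩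
  have := mul_mem (H a b a' b' h) hg
  rw [map_mul, ← mul_assoc]
  rwa [mul_assoc _ (k * _), mul_inv_cancel_left] at this

theorem mul_dgp_comm (g : GL (Fin 2) ℚ_[ℓ]) (c : ℕ) : g * dgp ℓ c c = dgp ℓ c c * g := by
  apply Units.ext
  change g.1 * !![_, 0; 0, _] = !![_, 0; 0, _] * g.1
  ext i j
  fin_cases i <;> fin_cases j <;> simp [Matrix.mul_apply, mul_comm]

theorem det_eq_one_of_mem {A : GL (Fin 2) ℚ_[ℓ]} (hA : A ∈ SLint ℓ) : A.1.det = 1 :=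
  (mem_SLint.1 hA).2

/-- If the second component of `m` is scalar, `B` in the factorization may be replaced by `A`, so
the double coset is a single orbit. -/
theorem mem_doubleCoset_iff_of_scalar_snd {a b c : ℕ} {h : a + b = c + c} {g : GQ ℓ} :
    g ∈ doubleCoset ℓ (K ℓ 1 1) (lev (dH ℓ a b c c h)) (K ℓ 1 0) ↔
      g ∈ orbitSet (dH ℓ a b c c h) := by
  refine ⟨fun hg => ?_, mem_doubleCoset_of_mem_orbitSet_self⟩
  obtain ⟨A, hA, B, hB, hAB, x, y, z, hx, hy, hz, hg⟩ := exists_factor_of_mem_doubleCoset hg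
  have hd : (1 : GL (Fin 2) ℚ_[ℓ]).1.det = (A⁻¹ * B).1.det := by
    rw [det_eq_one_of_mem (mul_mem (inv_mem hA) hB), det_eq_one_of_mem (one_mem _)]
  refine mem_orbitSet_of_factor hA
    (isIntegralH_of_SLint (m := pairH 1 (A⁻¹ * B) hd) (one_mem _) (mul_mem (inv_mem hA) hB))
    (Subtype.ext (Prod.ext ?_ ?_)) hx hy hz hg
  · exact (mul_one _).symm
  · change B * dgp ℓ c c = A * dgp ℓ c c * (A⁻¹ * B)
    rw [mul_dgp_comm, mul_dgp_comm]
    group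

theorem mem_doubleCoset_iff_of_scalar_fst {c a' b' : ℕ} {h : c + c = a' + b'} {g : GQ ℓ} :
    g ∈ doubleCoset ℓ (K ℓ 1 1) (lev (dH ℓ c c a' b' h)) (K ℓ 1 0) ↔
      g ∈ orbitSet (dH ℓ c c a' b' h) := by
  refine ⟨fun hg => ?_, mem_doubleCoset_of_mem_orbitSet_self⟩
  obtain ⟨A, hA, B, hB, hAB, x, y, z, hx, hy, hz, hg⟩ := exists_factor_of_mem_doubleCoset hg
  have hd : (B⁻¹ * A).1.det = (1 : GL (Fin 2) ℚ_[ℓ]).1.det := by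
    rw [det_eq_one_of_mem (mul_mem (inv_mem hB) hA), det_eq_one_of_mem (one_mem _)]
  refine mem_orbitSet_of_factor hB
    (isIntegralH_of_SLint (m := pairH (B⁻¹ * A) 1 hd) (mul_mem (inv_mem hB) hA) (one_mem _))
    (Subtype.ext (Prod.ext ?_ ?_)) hx hy hz hg
  · change A * dgp ℓ c c = B * dgp ℓ c c * (B⁻¹ * A)
    rw [mul_dgp_comm, mul_dgp_comm]
    group
  · exact (mul_one _).symm

/-- If both components are `diag(ℓ^{c+1}, ℓ^c)`, the double coset consists of two orbits,
according to whether the two lattices in the tree coincide or are at distance two. -/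
theorem mem_doubleCoset_iff_of_diagonal {c : ℕ} {g : GQ ℓ} :
    g ∈ doubleCoset ℓ (K ℓ 1 1) (lev (dH ℓ (c + 1) c (c + 1) c rfl)) (K ℓ 1 0) ↔
      g ∈ orbitSet (dH ℓ (c + 1) c (c + 1) c rfl) ∨
      g ∈ orbitSet (dH ℓ (c + 1) c c (c + 1) (add_comm _ _)) := by
  have hℓ := prime_ne_zero ℓ
  constructor
  · intro hg
    obtain ⟨A, hA, B, hB, hAB, x, y, z, hx, hy, hz, hg⟩ := exists_factor_of_mem_doubleCoset hg
    obtain ⟨C, hCS, hBC⟩ : ∃ C ∈ SLint ℓ, B = A * C :=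
      ⟨A⁻¹ * B, mul_mem (inv_mem hA) hB, (mul_inv_cancel_left _ _).symm⟩
    obtain ⟨hC1, hC2⟩ := mem_SLint.1 hCS
    have hCval : C.1 = !![C.1 0 0, C.1 0 1; C.1 1 0, C.1 1 1] := Matrix.eta_fin_two _
    rw [Matrix.det_fin_two] at hC2
    by_cases hlt : ‖C.1 0 1‖ < 1
    · left
      -- Here `C` normalizes the second lattice.
      have hle : ‖C.1 0 1 / ℓ‖ ≤ 1 := norm_div_prime_le_one hlt
      have hdet : C.1 0 0 * C.1 1 1 - C.1 0 1 / ℓ * (C.1 1 0 * ℓ) = 1 := by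
        rw [← hC2]; field_simp
      have hS : sl _ _ _ _ hdet ∈ SLint ℓ := sl_mem_SLint (hC1 _ _) hle
        (norm_mul_le_one (hC1 _ _) (norm_natCast_le_one ℓ)) (hC1 _ _)
      have hd : (1 : GL (Fin 2) ℚ_[ℓ]).1.det = (sl _ _ _ _ hdet).1.det := by
        rw [sl_det]; simp
      refine mem_orbitSet_of_factor hA
        (isIntegralH_of_SLint (m := pairH 1 _ hd) (one_mem _) hS)
        (Subtype.ext (Prod.ext ?_ ?_)) hx hy hz hg
      · exact (mul_one _).symm
      · change B * dgp ℓ (c + 1) c = A * dgp ℓ (c + 1) c * sl _ _ _ _ hdet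
        rw [hBC, mul_assoc, mul_assoc, mul_right_inj]
        apply Units.ext
        change C.1 * !![_, 0; 0, _] = !![_, 0; 0, _] * !![_, _; _, _]
        rw [hCval]
        ext i j
        fin_cases i <;> fin_cases j <;> simp [Matrix.mul_apply, pow_succ] <;> field_simp
    · right
      -- Here `C` carries the second lattice away from the first; the bottom row of `C` is cleared
      -- against its unit entry, which leaves the Weyl element.
      have hunit : ‖C.1 0 1‖ = 1 := le_antisymm (hC1 0 1) (not_lt.1 hlt)
      have hne : C.1 0 1 ≠ 0 := by rw [← norm_ne_zero_iff, hunit]; exact one_ne_zero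
      have hf : (1 : ℚ_[ℓ]) * 1 - 0 * (C.1 1 1 / C.1 0 1) = 1 := by ring
      have hfle : ‖C.1 1 1 / C.1 0 1‖ ≤ 1 := norm_div_le_one (hC1 _ _) hunit
      have hfS : sl _ _ _ _ hf ∈ SLint ℓ := sl_mem_SLint (by simp) (by simp) hfle (by simp)
      have hfl : (1 : ℚ_[ℓ]) * 1 - 0 * (-(C.1 1 1 / C.1 0 1) * ℓ) = 1 := by ring
      have hflS : sl _ _ _ _ hfl ∈ SLint ℓ := sl_mem_SLint (by simp) (by simp)
        (norm_mul_le_one (by rwa [norm_neg]) (norm_natCast_le_one ℓ)) (by simp)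
      have hk : C.1 0 0 * ℓ * 0 - C.1 0 1 * (-(1 / C.1 0 1)) = 1 := by field_simp; ring
      have hkS : sl _ _ _ _ hk ∈ SLint ℓ := sl_mem_SLint
        (norm_mul_le_one (hC1 _ _) (norm_natCast_le_one ℓ)) (hC1 _ _)
        (by rw [norm_neg]; exact norm_div_le_one (by simp) hunit) (by simp)
      have hd : (sl _ _ _ _ hfl).1.det = (sl _ _ _ _ hk).1.det := by rw [sl_det, sl_det]
      refine mem_orbitSet_of_factor (mul_mem hA hfS)
        (isIntegralH_of_SLint (m := pairH _ _ hd) hflS hkS)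
        (Subtype.ext (Prod.ext ?_ ?_)) hx hy hz hg
      · change A * dgp ℓ (c + 1) c = A * sl _ _ _ _ hf * dgp ℓ (c + 1) c * sl _ _ _ _ hfl
        rw [mul_assoc, mul_assoc, mul_right_inj]
        apply Units.ext
        change !![_, 0; 0, _] = !![_, _; _, _] * (!![_, 0; 0, _] * !![_, _; _, _])
        ext i j
        fin_cases i <;> fin_cases j <;> simp [Matrix.mul_apply, pow_succ]
        field_simp
        ring
      · change B * dgp ℓ (c + 1) c = A * sl _ _ _ _ hf * dgp ℓ c (c + 1) * sl _ _ _ _ hk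
        rw [hBC, mul_assoc, mul_assoc, mul_assoc, mul_right_inj]
        apply Units.ext
        change C.1 * !![_, 0; 0, _] = !![_, _; _, _] * (!![_, 0; 0, _] * !![_, _; _, _])
        rw [hCval]
        ext i j
        fin_cases i <;> fin_cases j <;> simp [Matrix.mul_apply, pow_succ] <;> field_simp
        linear_combination -hC2
  · rintro (hg | hg)
    · exact mem_doubleCoset_of_mem_orbitSet_self hg
    · have hw : (0 : ℚ_[ℓ]) * 0 - 1 * (-1) = 1 := by ring
      have hw' : (0 : ℚ_[ℓ]) * 0 - (-1) * 1 = 1 := by ring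
      have hwS : sl _ _ _ _ hw ∈ SLint ℓ := sl_mem_SLint (by simp) (by simp) (by simp) (by simp)
      have hwS' : sl _ _ _ _ hw' ∈ SLint ℓ := sl_mem_SLint (by simp) (by simp) (by simp) (by simp)
      have hd : (1 : GL (Fin 2) ℚ_[ℓ]).1.det = (sl _ _ _ _ hw).1.det := by rw [sl_det]; simp
      have hd' : (1 : GL (Fin 2) ℚ_[ℓ]).1.det = (sl _ _ _ _ hw').1.det := by rw [sl_det]; simp
      refine mem_doubleCoset_of_mem_orbitSet hwS
        (isIntegralH_of_SLint (m := pairH 1 _ hd') (one_mem _) hwS') hd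
        (Subtype.ext (Prod.ext ?_ ?_)) hg
      · change _ = 1 * _ * 1
        rw [one_mul, mul_one]
        rfl
      · change dgp ℓ c (c + 1) = sl _ _ _ _ hw * dgp ℓ (c + 1) c * sl _ _ _ _ hw'
        apply Units.ext
        change !![_, 0; 0, _] = !![_, _; _, _] * !![_, 0; 0, _] * !![_, _; _, _]
        ext i j
        fin_cases i <;> fin_cases j <;> simp [Matrix.mul_apply]

/-- The two orbits in the last statement are disjoint. -/
theorem not_isIntegralH_of_swap {c : ℕ} {k : GL (Fin 2) ℚ_[ℓ]} (hk : k ∈ SLint ℓ) :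
    ¬ IsIntegralH ((dH ℓ (c + 1) c (c + 1) c rfl)⁻¹ * diagonalH k *
      dH ℓ (c + 1) c c (c + 1) (add_comm _ _)) := by
  have hℓ := prime_ne_zero ℓ
  rintro ⟨h1, h2, -⟩
  obtain ⟨hk1, hk2⟩ := mem_SLint.1 hk
  rw [Matrix.det_fin_two] at hk2
  have hkval : k.1 = !![k.1 0 0, k.1 0 1; k.1 1 0, k.1 1 1] := Matrix.eta_fin_two _
  have e1 : k.1 0 1 = ℓ * ((dH ℓ (c + 1) c (c + 1) c rfl)⁻¹ * diagonalH k *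
      dH ℓ (c + 1) c c (c + 1) (add_comm _ _)).1.1.1 0 1 := by
    change _ = ℓ * (!![((ℓ : ℚ_[ℓ]) ^ (c + 1))⁻¹, 0; 0, ((ℓ : ℚ_[ℓ]) ^ c)⁻¹] * k.1 *
      !![(ℓ : ℚ_[ℓ]) ^ (c + 1), 0; 0, (ℓ : ℚ_[ℓ]) ^ c] : Matrix (Fin 2) (Fin 2) ℚ_[ℓ]) 0 1
    rw [hkval]
    simp [Matrix.mul_apply, pow_succ]
    field_simp
  have e2 : k.1 0 0 = ℓ * ((dH ℓ (c + 1) c (c + 1) c rfl)⁻¹ * diagonalH k *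
      dH ℓ (c + 1) c c (c + 1) (add_comm _ _)).1.2.1 0 0 := by
    change _ = ℓ * (!![((ℓ : ℚ_[ℓ]) ^ (c + 1))⁻¹, 0; 0, ((ℓ : ℚ_[ℓ]) ^ c)⁻¹] * k.1 *
      !![(ℓ : ℚ_[ℓ]) ^ c, 0; 0, (ℓ : ℚ_[ℓ]) ^ (c + 1)] : Matrix (Fin 2) (Fin 2) ℚ_[ℓ]) 0 0
    rw [hkval]
    simp [Matrix.mul_apply, pow_succ]
    field_simp
  have hle := norm_sub_mul_le_one (h2 0 0) (h1 0 1) (hk1 1 1) (hk1 1 0)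
  have e3 : (1 : ℚ_[ℓ]) = ℓ * (((dH ℓ (c + 1) c (c + 1) c rfl)⁻¹ * diagonalH k *
      dH ℓ (c + 1) c c (c + 1) (add_comm _ _)).1.2.1 0 0 * k.1 1 1 -
      ((dH ℓ (c + 1) c (c + 1) c rfl)⁻¹ * diagonalH k *
      dH ℓ (c + 1) c c (c + 1) (add_comm _ _)).1.1.1 0 1 * k.1 1 0) := by
    rw [mul_sub, ← mul_assoc, ← mul_assoc, ← e1, ← e2, hk2]
  have := congrArg norm e3
  rw [norm_one, norm_mul] at this
  have h3 : ‖(ℓ : ℚ_[ℓ])‖ < 1 := by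
    have := zpow_neg_lt_one ℓ (n := 1) le_rfl
    rwa [← norm_prime_pow, pow_one] at this
  have h4 := mul_lt_one_of_nonneg_of_lt_one_left (norm_nonneg _) h3 hle
  rw [← this] at h4
  exact lt_irrefl _ h4

/-! ### Transversals for the orbits -/

/-- The conjugation multiplies the off-diagonal entries by powers of `ℓ` and fixes the others. -/
theorem isIntegralH_dH_conj_iff {a b a' b' : ℕ} {h : a + b = a' + b'} {k : GL (Fin 2) ℚ_[ℓ]}
    (hk : k ∈ SLint ℓ) :
    IsIntegralH ((dH ℓ a b a' b' h)⁻¹ * diagonalH k * dH ℓ a b a' b' h) ↔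
      (‖k.1 0 1 * (ℓ : ℚ_[ℓ]) ^ b / (ℓ : ℚ_[ℓ]) ^ a‖ ≤ 1 ∧
        ‖k.1 1 0 * (ℓ : ℚ_[ℓ]) ^ a / (ℓ : ℚ_[ℓ]) ^ b‖ ≤ 1) ∧
      (‖k.1 0 1 * (ℓ : ℚ_[ℓ]) ^ b' / (ℓ : ℚ_[ℓ]) ^ a'‖ ≤ 1 ∧
        ‖k.1 1 0 * (ℓ : ℚ_[ℓ]) ^ a' / (ℓ : ℚ_[ℓ]) ^ b'‖ ≤ 1) := by
  have hℓ := prime_ne_zero ℓ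
  obtain ⟨hk1, hk2⟩ := mem_SLint.1 hk
  have hkval : k.1 = !![k.1 0 0, k.1 0 1; k.1 1 0, k.1 1 1] := Matrix.eta_fin_two _
  have key (r s : ℕ) : ((dgp ℓ r s)⁻¹ * k * dgp ℓ r s).1 =
      !![k.1 0 0, k.1 0 1 * (ℓ : ℚ_[ℓ]) ^ s / (ℓ : ℚ_[ℓ]) ^ r;
        k.1 1 0 * (ℓ : ℚ_[ℓ]) ^ r / (ℓ : ℚ_[ℓ]) ^ s, k.1 1 1] := by
    change !![((ℓ : ℚ_[ℓ]) ^ r)⁻¹, 0; 0, ((ℓ : ℚ_[ℓ]) ^ s)⁻¹] * k.1 *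
      !![(ℓ : ℚ_[ℓ]) ^ r, 0; 0, (ℓ : ℚ_[ℓ]) ^ s] = _
    conv_lhs => rw [hkval]
    ext i j
    fin_cases i <;> fin_cases j <;> simp [Matrix.mul_apply] <;> field_simp
  have e1 : ((dH ℓ a b a' b' h)⁻¹ * diagonalH k * dH ℓ a b a' b' h).1.1.1 =
    ((dgp ℓ a b)⁻¹ * k * dgp ℓ a b).1 := rfl
  have e2 : ((dH ℓ a b a' b' h)⁻¹ * diagonalH k * dH ℓ a b a' b' h).1.2.1 =
    ((dgp ℓ a' b')⁻¹ * k * dgp ℓ a' b').1 := rfl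
  have hd : ((dgp ℓ a' b')⁻¹ * k * dgp ℓ a' b').1.det = 1 := by
    rw [key, Matrix.det_fin_two]
    simp only [Matrix.of_apply, Matrix.cons_val', Matrix.cons_val_zero, Matrix.cons_val_one,
      Matrix.cons_val_fin_one]
    rw [← hk2, Matrix.det_fin_two]
    field_simp
  have hpos := (zpow_pos (prime_real_pos ℓ) (-((1 : ℕ) : ℤ))).le
  rw [IsIntegralH, e1, e2, hd, key, key]
  have h00 := hk1 0 0
  have h11 := hk1 1 1
  simp only [Fin.forall_fin_two, Matrix.of_apply, Matrix.cons_val', Matrix.cons_val_zero,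
    Matrix.cons_val_one, Matrix.cons_val_fin_one, sub_self, norm_zero, hpos, h00, h11,
    true_and, and_true]

theorem isTransversal_one {m : HQ ℓ}
    (hP : ∀ k ∈ SLint ℓ, IsIntegralH (m⁻¹ * diagonalH k * m)) :
    IsTransversal m (fun _ : Unit => 1) where
  mem _ := one_mem _
  cover _ hh := ⟨(), hP _ (mul_mem (inv_mem (one_mem _)) hh)⟩
  inj _ _ _ := rfl

variable (ℓ) in
/-- Representatives of `SL₂(ℤ_ℓ)` modulo the matrices with upper right entry in `ℓ^{n+1}`. -/
def upperRep (n : ℕ) : Fin (ℓ ^ (n + 1)) ⊕ Fin (ℓ ^ n) → GL (Fin 2) ℚ_[ℓ] :=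
  Sum.elim (fun b => sl 1 ((b : ℕ) : ℚ_[ℓ]) 0 1 (by ring))
    (fun d => sl 0 1 (-1) ((ℓ : ℚ_[ℓ]) * ((d : ℕ) : ℚ_[ℓ])) (by ring))

theorem upperRep_mem (n : ℕ) (r) : upperRep ℓ n r ∈ SLint ℓ := by
  obtain b | d := r
  · exact sl_mem_SLint (h := by ring) (by simp) (norm_natCast_le_one _) (by simp) (by simp)
  · exact sl_mem_SLint (h := by ring) (by simp) (by simp) (by simp)
      (norm_mul_le_one (norm_natCast_le_one _) (norm_natCast_le_one _))

theorem inv_upperRep_inl_mul (n : ℕ) (b) (h : GL (Fin 2) ℚ_[ℓ]) :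
    ((upperRep ℓ n (Sum.inl b))⁻¹ * h).1 0 1 = h.1 0 1 - ((b : ℕ) : ℚ_[ℓ]) * h.1 1 1 := by
  change (!![(1 : ℚ_[ℓ]), -((b : ℕ) : ℚ_[ℓ]); -0, 1] * h.1) 0 1 = _
  simp [Matrix.mul_apply]
  ring

theorem inv_upperRep_inr_mul (n : ℕ) (d) (h : GL (Fin 2) ℚ_[ℓ]) :
    ((upperRep ℓ n (Sum.inr d))⁻¹ * h).1 0 1 =
      (ℓ : ℚ_[ℓ]) * ((d : ℕ) : ℚ_[ℓ]) * h.1 0 1 - h.1 1 1 := by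
  change (!![(ℓ : ℚ_[ℓ]) * ((d : ℕ) : ℚ_[ℓ]), -1; -(-1), 0] * h.1) 0 1 = _
  simp [Matrix.mul_apply]
  ring

theorem norm_prime_mul_lt_one {x : ℚ_[ℓ]} (hx : ‖x‖ ≤ 1) : ‖(ℓ : ℚ_[ℓ]) * x‖ < 1 := by
  have := zpow_neg_lt_one ℓ (n := 1) le_rfl
  rw [← norm_prime_pow, pow_one] at this
  rw [norm_mul]
  exact mul_lt_one_of_nonneg_of_lt_one_left (norm_nonneg _) this hx

/-- In a matrix of determinant one, if one of two entries in a row or column is not a unit, the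
other one is. -/
theorem norm_eq_one_of_mul_sub {x y u v : ℚ_[ℓ]} (hx : ‖x‖ ≤ 1) (hy : ‖y‖ ≤ 1) (hu : ‖u‖ ≤ 1)
    (hv : ‖v‖ < 1) (h : x * y - u * v = 1) : ‖x‖ = 1 := by
  refine le_antisymm hx (not_lt.1 fun hlt => ?_)
  have h1 : ‖x * y‖ < 1 := by
    rw [norm_mul]; exact mul_lt_one_of_nonneg_of_lt_one_left (norm_nonneg _) hlt hy
  have h2 : ‖u * v‖ < 1 := by
    rw [norm_mul]; exact mul_lt_one_of_nonneg_of_lt_one_right hu (norm_nonneg _) hv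
  have := (IsUltrametricDist.norm_add_le_max (x * y) (-(u * v))).trans_lt
    (max_lt h1 (by rwa [norm_neg]))
  rw [← sub_eq_add_neg, h, norm_one] at this
  exact lt_irrefl _ this

theorem exists_upperRep (n : ℕ) {h : GL (Fin 2) ℚ_[ℓ]} (hh : h ∈ SLint ℓ) :
    ∃ r, ‖((upperRep ℓ n r)⁻¹ * h).1 0 1‖ ≤ (ℓ : ℝ) ^ (-((n + 1 : ℕ) : ℤ)) := by
  have hℓ := prime_ne_zero ℓ
  obtain ⟨h1, h2⟩ := mem_SLint.1 hh
  rw [Matrix.det_fin_two] at h2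
  -- The right column is a point of the projective line over `ℤ/ℓ^{n+1}`.
  by_cases hlt : ‖h.1 1 1‖ < 1
  · have hu : ‖h.1 0 1‖ = 1 := by
      refine norm_eq_one_of_mul_sub (x := h.1 0 1) (y := -h.1 1 0) (u := -h.1 0 0) (h1 _ _)
        (by rw [norm_neg]; exact h1 _ _) (by rw [norm_neg]; exact h1 _ _) hlt ?_
      linear_combination h2
    have hne : h.1 0 1 ≠ 0 := by rw [← norm_ne_zero_iff, hu]; exact one_ne_zero
    obtain ⟨d, hd⟩ := exists_digit (norm_div_le_one (norm_div_prime_le_one hlt) hu) n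
    refine ⟨Sum.inr d, ?_⟩
    rw [inv_upperRep_inr_mul]
    have e : (ℓ : ℚ_[ℓ]) * ((d : ℕ) : ℚ_[ℓ]) * h.1 0 1 - h.1 1 1 =
        -((ℓ : ℚ_[ℓ]) * h.1 0 1 * (h.1 1 1 / ℓ / h.1 0 1 - ((d : ℕ) : ℚ_[ℓ]))) := by
      field_simp
      ring
    rw [e, norm_neg, norm_mul, norm_mul, hu, mul_one]
    have h3 : ‖(ℓ : ℚ_[ℓ])‖ = (ℓ : ℝ) ^ (-(1 : ℤ)) := by
      have := norm_prime_pow ℓ 1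
      rwa [pow_one] at this
    rw [h3]
    calc _ ≤ (ℓ : ℝ) ^ (-(1 : ℤ)) * (ℓ : ℝ) ^ (-(n : ℤ)) := by
          gcongr
      _ = _ := by
          rw [← zpow_add₀ (prime_real_pos ℓ).ne']; congr 1; push_cast; ring
  · have hu : ‖h.1 1 1‖ = 1 := le_antisymm (h1 1 1) (not_lt.1 hlt)
    have hne : h.1 1 1 ≠ 0 := by rw [← norm_ne_zero_iff, hu]; exact one_ne_zero
    obtain ⟨b, hb⟩ := exists_digit (norm_div_le_one (h1 0 1) hu) (n + 1)
    refine ⟨Sum.inl b, ?_⟩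
    rw [inv_upperRep_inl_mul]
    have e : h.1 0 1 - ((b : ℕ) : ℚ_[ℓ]) * h.1 1 1 =
        h.1 1 1 * (h.1 0 1 / h.1 1 1 - ((b : ℕ) : ℚ_[ℓ])) := by field_simp
    rwa [e, norm_mul, hu, one_mul]

theorem upperRep_injective (n : ℕ) {r r'}
    (h : ‖((upperRep ℓ n r)⁻¹ * upperRep ℓ n r').1 0 1‖ ≤ (ℓ : ℝ) ^ (-((n + 1 : ℕ) : ℤ))) :
    r = r' := by
  have hℓ := prime_ne_zero ℓ
  have hlt := h.trans_lt (zpow_neg_lt_one ℓ (n := n + 1) (by omega))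
  have hone (x : ℚ_[ℓ]) (hx : ‖x‖ ≤ 1) : ¬ ‖1 - (ℓ : ℚ_[ℓ]) * x‖ < 1 := fun H => by
    have := (IsUltrametricDist.norm_add_le_max (1 - (ℓ : ℚ_[ℓ]) * x) (ℓ * x)).trans_lt
      (max_lt H (norm_prime_mul_lt_one hx))
    rw [sub_add_cancel, norm_one] at this
    exact lt_irrefl _ this
  obtain b | d := r <;> obtain b' | d' := r'
  · rw [inv_upperRep_inl_mul, show (upperRep ℓ n (Sum.inl b')).1
      = !![1, ((b' : ℕ) : ℚ_[ℓ]); 0, 1] from rfl] at h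
    congr 1
    refine (digit_unique ?_).symm
    simpa using h
  · rw [inv_upperRep_inl_mul, show (upperRep ℓ n (Sum.inr d')).1
      = !![0, 1; -1, (ℓ : ℚ_[ℓ]) * ((d' : ℕ) : ℚ_[ℓ])] from rfl] at hlt
    refine (hone (((b : ℕ) : ℚ_[ℓ]) * ((d' : ℕ) : ℚ_[ℓ]))
      (norm_mul_le_one (norm_natCast_le_one _) (norm_natCast_le_one _)) ?_).elim
    rw [mul_left_comm]
    simpa using hlt
  · rw [inv_upperRep_inr_mul, show (upperRep ℓ n (Sum.inl b')).1
      = !![1, ((b' : ℕ) : ℚ_[ℓ]); 0, 1] from rfl] at hlt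
    refine (hone (((d : ℕ) : ℚ_[ℓ]) * ((b' : ℕ) : ℚ_[ℓ]))
      (norm_mul_le_one (norm_natCast_le_one _) (norm_natCast_le_one _)) ?_).elim
    rw [← mul_assoc, norm_sub_rev]
    simpa using hlt
  · rw [inv_upperRep_inr_mul, show (upperRep ℓ n (Sum.inr d')).1
      = !![0, 1; -1, (ℓ : ℚ_[ℓ]) * ((d' : ℕ) : ℚ_[ℓ])] from rfl] at h
    congr 1
    refine (digit_unique ?_)
    have e : (ℓ : ℚ_[ℓ]) * ((d : ℕ) : ℚ_[ℓ]) - (ℓ : ℚ_[ℓ]) * ((d' : ℕ) : ℚ_[ℓ]) =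
      ℓ * (((d : ℕ) : ℚ_[ℓ]) - ((d' : ℕ) : ℚ_[ℓ])) := by ring
    rw [norm_le_zpow_iff] at h ⊢
    simp only [Matrix.of_apply, Matrix.cons_val', Matrix.cons_val_zero,
      Matrix.cons_val_one, Matrix.cons_val_fin_one, mul_one] at h
    rwa [e, pow_succ', mul_div_mul_left _ _ hℓ] at h

theorem isTransversal_upperRep {m : HQ ℓ} (n : ℕ)
    (hP : ∀ k ∈ SLint ℓ, IsIntegralH (m⁻¹ * diagonalH k * m) ↔
      ‖k.1 0 1‖ ≤ (ℓ : ℝ) ^ (-((n + 1 : ℕ) : ℤ))) :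
    IsTransversal m (upperRep ℓ n) where
  mem := upperRep_mem n
  cover h hh := by
    obtain ⟨r, hr⟩ := exists_upperRep n hh
    exact ⟨r, (hP _ (mul_mem (inv_mem (upperRep_mem n r)) hh)).2 hr⟩
  inj r r' h := upperRep_injective n
    ((hP _ (mul_mem (inv_mem (upperRep_mem n r)) (upperRep_mem n r'))).1 h)

variable (ℓ) in
/-- Representatives of `SL₂(ℤ_ℓ)` modulo the matrices that are diagonal modulo `ℓ`. -/
def torusRep (r : (Fin (ℓ ^ (0 + 1)) ⊕ Fin (ℓ ^ 0)) × Fin (ℓ ^ 1)) : GL (Fin 2) ℚ_[ℓ] :=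
  upperRep ℓ 0 r.1 * sl 1 0 ((r.2 : ℕ) : ℚ_[ℓ]) 1 (by ring)

theorem torusRep_mem (r) : torusRep ℓ r ∈ SLint ℓ :=
  mul_mem (upperRep_mem _ _)
    (sl_mem_SLint (by simp) (by simp) (norm_natCast_le_one _) (by simp))

theorem inv_lower_mul (c : ℚ_[ℓ]) (hc) (k : GL (Fin 2) ℚ_[ℓ]) :
    ((sl 1 0 c 1 hc)⁻¹ * k).1 0 1 = k.1 0 1 ∧
      ((sl 1 0 c 1 hc)⁻¹ * k).1 1 0 = k.1 1 0 - c * k.1 0 0 := by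
  constructor
  · change (!![(1 : ℚ_[ℓ]), -0; -c, 1] * k.1) 0 1 = _
    simp [Matrix.mul_apply]
  · change (!![(1 : ℚ_[ℓ]), -0; -c, 1] * k.1) 1 0 = _
    simp [Matrix.mul_apply]
    ring

theorem isTransversal_torusRep {m : HQ ℓ}
    (hP : ∀ k ∈ SLint ℓ, IsIntegralH (m⁻¹ * diagonalH k * m) ↔
      ‖k.1 0 1‖ ≤ (ℓ : ℝ) ^ (-((1 : ℕ) : ℤ)) ∧ ‖k.1 1 0‖ ≤ (ℓ : ℝ) ^ (-((1 : ℕ) : ℤ))) :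
    IsTransversal m (torusRep ℓ) where
  mem := torusRep_mem
  cover h hh := by
    obtain ⟨r, hr⟩ := exists_upperRep 0 hh
    set k := (upperRep ℓ 0 r)⁻¹ * h with hk
    obtain ⟨h1, h2⟩ := mem_SLint.1 (mul_mem (inv_mem (upperRep_mem 0 r)) hh)
    rw [← hk] at h1 h2
    rw [Matrix.det_fin_two] at h2
    have hu : ‖k.1 0 0‖ = 1 := by
      refine norm_eq_one_of_mul_sub (x := k.1 0 0) (y := k.1 1 1) (u := k.1 1 0) (v := k.1 0 1)
        (h1 _ _) (h1 _ _) (h1 _ _) (hr.trans_lt (zpow_neg_lt_one ℓ (by omega))) ?_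
      linear_combination h2
    have hne : k.1 0 0 ≠ 0 := by rw [← norm_ne_zero_iff, hu]; exact one_ne_zero
    obtain ⟨c, hc⟩ := exists_digit (norm_div_le_one (h1 1 0) hu) 1
    refine ⟨(r, c), (hP _ (mul_mem (inv_mem (torusRep_mem _)) hh)).2 ?_⟩
    rw [torusRep, mul_inv_rev, mul_assoc, ← hk, (inv_lower_mul _ _ _).1, (inv_lower_mul _ _ _).2]
    refine ⟨hr, ?_⟩
    have e : k.1 1 0 - ((c : ℕ) : ℚ_[ℓ]) * k.1 0 0 =
        k.1 0 0 * (k.1 1 0 / k.1 0 0 - ((c : ℕ) : ℚ_[ℓ])) := by field_simp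
    dsimp only
    rwa [e, norm_mul, hu, one_mul]
  inj := by
    rintro ⟨r, c⟩ ⟨r', c'⟩ h
    obtain ⟨h1, h2⟩ := (hP _ (mul_mem (inv_mem (torusRep_mem _)) (torusRep_mem _))).1 h
    rw [torusRep, torusRep, mul_inv_rev, mul_assoc] at h1 h2
    rw [(inv_lower_mul _ _ _).1, ← mul_assoc] at h1
    rw [(inv_lower_mul _ _ _).2] at h2
    dsimp only at h1 h2
    obtain rfl : r = r' := by
      refine upperRep_injective 0 ?_
      have e : ((upperRep ℓ 0 r)⁻¹ * upperRep ℓ 0 r').1 0 1 =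
          ((upperRep ℓ 0 r)⁻¹ * upperRep ℓ 0 r' * sl 1 0 ((c' : ℕ) : ℚ_[ℓ]) 1 (by ring)).1 0 1 := by
        change _ = (_ * !![(1 : ℚ_[ℓ]), 0; ((c' : ℕ) : ℚ_[ℓ]), 1] :
          Matrix (Fin 2) (Fin 2) ℚ_[ℓ]) 0 1
        rw [Matrix.mul_apply]
        simp
      rw [e]
      exact h1
    rw [inv_mul_cancel_left, sl_val] at h2
    have : c = c' := (digit_unique (by simpa using h2)).symm
    rw [this]

/-! ### Values of the Hecke operators -/

theorem norm_mul_pow_div_le_iff {x : ℚ_[ℓ]} {s n : ℕ} :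
    ‖x * (ℓ : ℚ_[ℓ]) ^ s / (ℓ : ℚ_[ℓ]) ^ (s + n)‖ ≤ 1 ↔ ‖x‖ ≤ (ℓ : ℝ) ^ (-(n : ℤ)) := by
  have hℓ := prime_ne_zero ℓ
  rw [norm_le_zpow_iff, pow_add, mul_comm, mul_div_mul_left _ _ (pow_ne_zero _ hℓ)]

theorem norm_mul_pow_div_le {x : ℚ_[ℓ]} (hx : ‖x‖ ≤ 1) {s n : ℕ} :
    ‖x * (ℓ : ℚ_[ℓ]) ^ (s + n) / (ℓ : ℚ_[ℓ]) ^ s‖ ≤ 1 := by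
  have hℓ := prime_ne_zero ℓ
  rw [pow_add, mul_left_comm, mul_div_cancel_left₀ _ (pow_ne_zero _ hℓ)]
  exact norm_mul_le_one hx (norm_prime_pow_le_one n)

theorem isTransversal_dH_scalar {b b' : ℕ} {h : b + b = b' + b'} :
    IsTransversal (dH ℓ b b b' b' h) (fun _ : Unit => 1) :=
  isTransversal_one fun _ hk => (isIntegralH_dH_conj_iff hk).2
    ⟨⟨norm_mul_pow_div_le (n := 0) ((mem_SLint.1 hk).1 _ _),
      norm_mul_pow_div_le (n := 0) ((mem_SLint.1 hk).1 _ _)⟩,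
      norm_mul_pow_div_le (n := 0) ((mem_SLint.1 hk).1 _ _),
      norm_mul_pow_div_le (n := 0) ((mem_SLint.1 hk).1 _ _)⟩

theorem isTransversal_dH_upper {b n b' n' N : ℕ} {h : (b + n) + b = (b' + n') + b'}
    (hN : max n n' = N + 1) :
    IsTransversal (dH ℓ (b + n) b (b' + n') b' h) (upperRep ℓ N) := by
  refine isTransversal_upperRep N fun k hk => ?_
  rw [isIntegralH_dH_conj_iff hk, norm_mul_pow_div_le_iff, norm_mul_pow_div_le_iff, ← hN]
  have h1 (s n : ℕ) := norm_mul_pow_div_le ((mem_SLint.1 hk).1 1 0) (s := s) (n := n)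
  constructor
  · rintro ⟨⟨h2, -⟩, h3, -⟩
    obtain hm | hm := max_choice n n' <;> rw [hm] <;> assumption
  · intro h2
    exact ⟨⟨h2.trans (zpow_neg_anti ℓ (le_max_left _ _)), h1 _ _⟩,
      h2.trans (zpow_neg_anti ℓ (le_max_right _ _)), h1 _ _⟩

theorem isTransversal_dH_torus {b : ℕ} :
    IsTransversal (dH ℓ (b + 1) b b (b + 1) (add_comm _ _)) (torusRep ℓ) := by
  refine isTransversal_torusRep fun k hk => ?_
  rw [isIntegralH_dH_conj_iff hk, norm_mul_pow_div_le_iff, norm_mul_pow_div_le_iff]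
  have h1 (i j) (s n : ℕ) := norm_mul_pow_div_le ((mem_SLint.1 hk).1 i j) (s := s) (n := n)
  exact ⟨fun h => ⟨h.1.1, h.2.2⟩, fun h => ⟨⟨h.1, h1 _ _ _ _⟩, h1 _ _ _ _, h.2⟩⟩

/-- The sum of the values at `m₀` over the Heisenberg coordinates in `ℓ^{-b}ℤ/ℤ × ℓ^{-a}ℤ/ℤ`. -/
def latticeSum {W : Type*} [AddCommGroup W] [Module ℂ W] (z : GQ ℓ → W) (m₀ : HQ ℓ)
    (b a : ℕ) : W :=
  ∑ x ∈ Finset.range (ℓ ^ b), ∑ y ∈ Finset.range (ℓ ^ a),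
    hval z ((x : ℚ_[ℓ]) / (ℓ : ℚ_[ℓ]) ^ b) ((y : ℚ_[ℓ]) / (ℓ : ℚ_[ℓ]) ^ a) m₀

section Values

variable {W : Type*} [AddCommGroup W] [Module ℂ W] {z : GQ ℓ → W}
  {Z : HeckeTensor ℓ →ₗ[ℂ] W}

theorem IsEquivariant.sum_orbitRep_eq_latticeSum (hz : IsEquivariant z) {R : Type*} [Fintype R]
    {a b a' b' : ℕ} {h : a + b = a' + b'} {τ : R → GL (Fin 2) ℚ_[ℓ]}
    (hτ : IsTransversal (dH ℓ a b a' b' h) τ) {m₀ : HQ ℓ}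
    (hm₀ : diagonalH (dgp ℓ a b) * m₀ = dH ℓ a b a' b' h) :
    ∑ i, z (orbitRep a b (dH ℓ a b a' b' h) τ i) =
      (Fintype.card R : ℂ) • latticeSum z m₀ b a := by
  rw [hz.sum_orbitRep hτ hm₀]
  congr 1
  simp only [latticeSum, Finset.sum_range]

/-- The value at a double coset consisting of one orbit. -/
theorem hasValue_of_orbit (hv : ∀ g, HasValueAtPhiInfty ℓ Z (ch (coset ℓ g (K ℓ 1 0))) (z g))
    (hz : IsEquivariant z) {R : Type*} [Fintype R]
    {a b a' b' : ℕ} {h : a + b = a' + b'} {τ : R → GL (Fin 2) ℚ_[ℓ]}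
    (hτ : IsTransversal (dH ℓ a b a' b' h) τ) {m₀ : HQ ℓ}
    (hm₀ : diagonalH (dgp ℓ a b) * m₀ = dH ℓ a b a' b' h)
    {S : TopologicalSpace.CompactOpens (GQ ℓ)} (hS : ∀ g, g ∈ S ↔ g ∈ orbitSet (dH ℓ a b a' b' h)) :
    HasValueAtPhiInfty ℓ Z (ch S) ((Fintype.card R : ℂ) • latticeSum z m₀ b a) := by
  rw [ch_eq_sum_coset (orbitRep a b (dH ℓ a b a' b' h) τ)
    (fun x => (hS x).trans (mem_orbitSet_iff hτ x)) (orbitRep_injective hτ),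
    ← hz.sum_orbitRep_eq_latticeSum hτ hm₀]
  exact HasValueAtPhiInfty.sum fun i => hv _

/-- The value at a double coset consisting of two orbits. -/
theorem hasValue_of_two_orbits
    (hv : ∀ g, HasValueAtPhiInfty ℓ Z (ch (coset ℓ g (K ℓ 1 0))) (z g))
    (hz : IsEquivariant z) {R : Type*} [Fintype R]
    {a b a' b' : ℕ} {h : a + b = a' + b'} {τ : R → GL (Fin 2) ℚ_[ℓ]}
    (hτ : IsTransversal (dH ℓ a b a' b' h) τ) {m₀ : HQ ℓ}
    (hm₀ : diagonalH (dgp ℓ a b) * m₀ = dH ℓ a b a' b' h)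
    {R₁ : Type*} [Fintype R₁]
    {c d c' d' : ℕ} {h₁ : c + d = c' + d'} {τ₁ : R₁ → GL (Fin 2) ℚ_[ℓ]}
    (hτ₁ : IsTransversal (dH ℓ c d c' d' h₁) τ₁) {m₁ : HQ ℓ}
    (hm₁ : diagonalH (dgp ℓ c d) * m₁ = dH ℓ c d c' d' h₁)
    (hdisj : ∀ k ∈ SLint ℓ, ¬ IsIntegralH ((dH ℓ a b a' b' h)⁻¹ * diagonalH k * dH ℓ c d c' d' h₁))
    {S : TopologicalSpace.CompactOpens (GQ ℓ)} (hS : ∀ g, g ∈ S ↔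
      g ∈ orbitSet (dH ℓ a b a' b' h) ∨ g ∈ orbitSet (dH ℓ c d c' d' h₁)) :
    HasValueAtPhiInfty ℓ Z (ch S) ((Fintype.card R : ℂ) • latticeSum z m₀ b a +
      (Fintype.card R₁ : ℂ) • latticeSum z m₁ d c) := by
  have hne (i j) : (orbitRep a b (dH ℓ a b a' b' h) τ i)⁻¹ *
      orbitRep c d (dH ℓ c d c' d' h₁) τ₁ j ∉ K10 ℓ := fun H => by
    have := isIntegralH_of_inv_mul_mem H
    rw [mul_assoc _ (diagonalH (τ i.1))⁻¹] at this
    exact hdisj _ (mul_mem (inv_mem (hτ.mem _)) (hτ₁.mem _)) this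
  rw [ch_eq_sum_coset (Sum.elim (orbitRep a b (dH ℓ a b a' b' h) τ)
    (orbitRep c d (dH ℓ c d c' d' h₁) τ₁)) (fun x => ?_) (fun i j hij => ?_),
    ← hz.sum_orbitRep_eq_latticeSum hτ hm₀, ← hz.sum_orbitRep_eq_latticeSum hτ₁ hm₁]
  · have := HasValueAtPhiInfty.sum fun i => hv (Sum.elim (orbitRep a b (dH ℓ a b a' b' h) τ)
      (orbitRep c d (dH ℓ c d c' d' h₁) τ₁) i)
    rwa [Fintype.sum_sum_type (fun i => z _)] at this
  · rw [hS, mem_orbitSet_iff hτ, mem_orbitSet_iff hτ₁, Sum.exists]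
    rfl
  · obtain i | i := i <;> obtain j | j := j
    · rw [orbitRep_injective hτ i j hij]
    · exact (hne _ _ hij).elim
    · have := inv_mem hij
      rw [mul_inv_rev, inv_inv] at this
      exact (hne _ _ this).elim
    · rw [orbitRep_injective hτ₁ i j hij]

end Values

variable (ℓ) in
/-- The pair `(1, diag(ℓ⁻¹, ℓ))`. Its components describe two lattices at distance two in the tree
of `SL₂(ℚ_ℓ)`. -/
def gam : HQ ℓ :=
  pairH 1 (dg (ℓ : ℚ_[ℓ])⁻¹ ℓ (inv_ne_zero (prime_ne_zero ℓ)) (prime_ne_zero ℓ)) (by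
    rw [dg_val, Matrix.det_fin_two]; simp [prime_ne_zero ℓ])

variable (ℓ) in
/-- The pair `(1, diag(ℓ, ℓ⁻¹))`, which the Weyl element of the diagonal `SL₂` exchanges with
`gam`. -/
def gam' : HQ ℓ :=
  pairH 1 (dg (ℓ : ℚ_[ℓ]) (ℓ : ℚ_[ℓ])⁻¹ (prime_ne_zero ℓ) (inv_ne_zero (prime_ne_zero ℓ))) (by
    rw [dg_val, Matrix.det_fin_two]; simp [prime_ne_zero ℓ])

theorem diagonalH_mul_one_eq {a b : ℕ} (h : a + b = a + b) :
    diagonalH (dgp ℓ a b) * 1 = dH ℓ a b a b h := mul_one _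

theorem diagonalH_mul_gam_eq {a b : ℕ} (h : (a + 1) + b = a + (b + 1)) :
    diagonalH (dgp ℓ (a + 1) b) * gam ℓ = dH ℓ (a + 1) b a (b + 1) h := by
  have hℓ := prime_ne_zero ℓ
  refine HQ_ext (congrArg Units.val (mul_one (dgp ℓ (a + 1) b))) ?_
  change !![_, 0; 0, _] * !![_, 0; 0, _] = !![(ℓ : ℚ_[ℓ]) ^ a, 0; 0, (ℓ : ℚ_[ℓ]) ^ (b + 1)]
  ext i j
  fin_cases i <;> fin_cases j <;> simp [Matrix.mul_apply, pow_succ, hℓ]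

theorem diagonalH_mul_gam'_eq {a b : ℕ} (h : a + (b + 1) = (a + 1) + b) :
    diagonalH (dgp ℓ a (b + 1)) * gam' ℓ = dH ℓ a (b + 1) (a + 1) b h := by
  have hℓ := prime_ne_zero ℓ
  refine HQ_ext (congrArg Units.val (mul_one (dgp ℓ a (b + 1)))) ?_
  change !![_, 0; 0, _] * !![_, 0; 0, _] = !![(ℓ : ℚ_[ℓ]) ^ (a + 1), 0; 0, (ℓ : ℚ_[ℓ]) ^ b]
  ext i j
  fin_cases i <;> fin_cases j <;> simp [Matrix.mul_apply, pow_succ, hℓ]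

theorem diagG_eq_lev {a b a' b' : ℕ} (h : a + b = a' + b') (h₀ h₁) :
    diagG ℓ ![a + b, a, b, 0] ![a', b'] h₀ h₁ = lev (dH ℓ a b a' b' h) := by
  refine GQ_ext ?_ ?_
  · rw [lev_fst]
    change Matrix.diagonal _ = _
    ext i j
    fin_cases i <;> fin_cases j <;> simp [dH, pairH, dgp, dg, pow_add]
  · change Matrix.diagonal _ = !![_, 0; 0, _]
    ext i j
    fin_cases i <;> fin_cases j <;> simp

section Operators

variable {W : Type*} [AddCommGroup W] [Module ℂ W] {z : GQ ℓ → W}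
  {Z : HeckeTensor ℓ →ₗ[ℂ] W}
theorem hasValue_U₁
    (hv : ∀ g, HasValueAtPhiInfty ℓ Z (ch (coset ℓ g (K ℓ 1 0))) (z g)) (hz : IsEquivariant z) :
    HasValueAtPhiInfty ℓ Z (U ℓ (u₁ ℓ))
    (((ℓ : ℂ) + 1) • latticeSum z 1 0 1 + (((ℓ : ℂ) + 1) * ℓ) • latticeSum z (gam ℓ) 0 1) := by
  have e : u₁ ℓ = lev (dH ℓ (0 + 1) 0 (0 + 1) 0 rfl) := diagG_eq_lev (a := 1) (b := 0) rfl _ _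
  rw [U, e]
  have := hasValue_of_two_orbits hv hz
    (isTransversal_dH_upper (b := 0) (n := 1) (b' := 0) (n' := 1) (N := 0) (h := rfl) rfl)
    (diagonalH_mul_one_eq rfl) (isTransversal_dH_torus (b := 0)) (diagonalH_mul_gam_eq _)
    (fun k hk => not_isIntegralH_of_swap hk)
    (S := doubleCoset ℓ (K ℓ 1 1) (lev (dH ℓ (0 + 1) 0 (0 + 1) 0 rfl)) (K ℓ 1 0))
    (fun g => mem_doubleCoset_iff_of_diagonal)
  simpa using this

theorem hasValue_U₂
    (hv : ∀ g, HasValueAtPhiInfty ℓ Z (ch (coset ℓ g (K ℓ 1 0))) (z g)) (hz : IsEquivariant z) :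
    HasValueAtPhiInfty ℓ Z (U ℓ (u₂ ℓ)) (latticeSum z 1 1 1) := by
  have e : u₂ ℓ = lev (dH ℓ 1 1 1 1 rfl) := diagG_eq_lev (a := 1) (b := 1) rfl _ _
  rw [U, e]
  have := hasValue_of_orbit hv hz (isTransversal_dH_scalar (b := 1) (b' := 1) (h := rfl))
    (diagonalH_mul_one_eq rfl)
    (S := doubleCoset ℓ (K ℓ 1 1) (lev (dH ℓ 1 1 1 1 rfl)) (K ℓ 1 0))
    (fun g => mem_doubleCoset_iff_of_scalar_snd)
  simpa using this

theorem hasValue_U₃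
    (hv : ∀ g, HasValueAtPhiInfty ℓ Z (ch (coset ℓ g (K ℓ 1 0))) (z g)) (hz : IsEquivariant z) :
    HasValueAtPhiInfty ℓ Z (U ℓ (u₃ ℓ))
    (((ℓ : ℂ) ^ 2 + ℓ) • latticeSum z (gam' ℓ) 1 1) := by
  have e : u₃ ℓ = lev (dH ℓ 1 1 2 0 rfl) :=
    diagG_eq_lev (a := 1) (b := 1) (a' := 2) (b' := 0) rfl _ _
  rw [U, e]
  have := hasValue_of_orbit hv hz
    (isTransversal_dH_upper (b := 1) (n := 0) (b' := 0) (n' := 2) (N := 1) (h := rfl) rfl)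
    (diagonalH_mul_gam'_eq (a := 1) (b := 0) rfl)
    (S := doubleCoset ℓ (K ℓ 1 1) (lev (dH ℓ 1 1 2 0 rfl)) (K ℓ 1 0))
    (fun g => mem_doubleCoset_iff_of_scalar_fst)
  simpa using this

theorem hasValue_U₄
    (hv : ∀ g, HasValueAtPhiInfty ℓ Z (ch (coset ℓ g (K ℓ 1 0))) (z g)) (hz : IsEquivariant z) :
    HasValueAtPhiInfty ℓ Z (U ℓ (u₄ ℓ))
    (((ℓ : ℂ) ^ 2 + ℓ) • latticeSum z (gam ℓ) 0 2) := by
  have e : u₄ ℓ = lev (dH ℓ 2 0 1 1 rfl) :=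
    diagG_eq_lev (a := 2) (b := 0) (a' := 1) (b' := 1) rfl _ _
  rw [U, e]
  have := hasValue_of_orbit hv hz
    (isTransversal_dH_upper (b := 0) (n := 2) (b' := 1) (n' := 0) (N := 1) (h := rfl) rfl)
    (diagonalH_mul_gam_eq (a := 1) (b := 0) rfl)
    (S := doubleCoset ℓ (K ℓ 1 1) (lev (dH ℓ 2 0 1 1 rfl)) (K ℓ 1 0))
    (fun g => mem_doubleCoset_iff_of_scalar_snd)
  simpa using this

theorem hasValue_U₅
    (hv : ∀ g, HasValueAtPhiInfty ℓ Z (ch (coset ℓ g (K ℓ 1 0))) (z g)) (hz : IsEquivariant z) :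
    HasValueAtPhiInfty ℓ Z (U ℓ (u₅ ℓ))
    (((ℓ : ℂ) + 1) • latticeSum z 1 1 2 + (((ℓ : ℂ) + 1) * ℓ) • latticeSum z (gam ℓ) 1 2) := by
  have e : u₅ ℓ = lev (dH ℓ (1 + 1) 1 (1 + 1) 1 rfl) := diagG_eq_lev (a := 2) (b := 1) rfl _ _
  rw [U, e]
  have := hasValue_of_two_orbits hv hz
    (isTransversal_dH_upper (b := 1) (n := 1) (b' := 1) (n' := 1) (N := 0) (h := rfl) rfl)
    (diagonalH_mul_one_eq rfl) (isTransversal_dH_torus (b := 1)) (diagonalH_mul_gam_eq _)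
    (fun k hk => not_isIntegralH_of_swap hk)
    (S := doubleCoset ℓ (K ℓ 1 1) (lev (dH ℓ (1 + 1) 1 (1 + 1) 1 rfl)) (K ℓ 1 0))
    (fun g => mem_doubleCoset_iff_of_diagonal)
  simpa using this

theorem hasValue_U₆
    (hv : ∀ g, HasValueAtPhiInfty ℓ Z (ch (coset ℓ g (K ℓ 1 0))) (z g)) (hz : IsEquivariant z) :
    HasValueAtPhiInfty ℓ Z (U ℓ (u₆ ℓ)) (latticeSum z 1 2 2) := by
  have e : u₆ ℓ = lev (dH ℓ 2 2 2 2 rfl) := diagG_eq_lev (a := 2) (b := 2) rfl _ _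
  rw [U, e]
  have := hasValue_of_orbit hv hz (isTransversal_dH_scalar (b := 2) (b' := 2) (h := rfl))
    (diagonalH_mul_one_eq rfl)
    (S := doubleCoset ℓ (K ℓ 1 1) (lev (dH ℓ 2 2 2 2 rfl)) (K ℓ 1 0))
    (fun g => mem_doubleCoset_iff_of_scalar_snd)
  simpa using this

end Operators

/-! ### Classes of Heisenberg coordinates -/

theorem norm_natCast_eq_one {n : ℕ} (h : ¬ ℓ ∣ n) : ‖(n : ℚ_[ℓ])‖ = 1 := by
  refine le_antisymm (norm_natCast_le_one n) (not_lt.1 fun hlt =>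
    h (Padic.norm_natCast_lt_one_iff.1 hlt))

section Sums

theorem sum_range_mul {W : Type*} [AddCommGroup W] (f : ℕ → W) (m n : ℕ) :
    ∑ i ∈ Finset.range (m * n), f i = ∑ a ∈ Finset.range m, ∑ b ∈ Finset.range n, f (n * a + b) := by
  induction m with
  | zero => simp
  | succ m ih => rw [add_mul, one_mul, Finset.sum_range_add, ih, Finset.sum_range_succ, mul_comm m]

variable {W : Type*} [AddCommGroup W] [Module ℂ W]

variable (ℓ) in
theorem sum_range_prime_of_const (f : ℕ → W) (C : W) (hf : ∀ y, ¬ ℓ ∣ y → f y = C) :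
    ∑ y ∈ Finset.range ℓ, f y = f 0 + ((ℓ : ℂ) - 1) • C := by
  obtain ⟨n, hn⟩ := Nat.exists_eq_succ_of_ne_zero (Fact.out : ℓ.Prime).ne_zero
  have h1 : ∀ y ∈ Finset.range n, f (y + 1) = C := fun y hy => hf _ fun hd => by
    have := Nat.le_of_dvd (Nat.succ_pos y) hd
    have := Finset.mem_range.1 hy
    omega
  have h2 : ((ℓ : ℂ) - 1) = n := by rw [hn]; push_cast; ring
  rw [h2, hn, Nat.succ_eq_add_one, Finset.sum_range_succ', Finset.sum_congr rfl h1,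
    Finset.sum_const, Finset.card_range, add_comm, Nat.cast_smul_eq_nsmul]

variable (ℓ) in
theorem sum_range_prime_sq_of_const (f : ℕ → W) (C : W) (hf : ∀ y, ¬ ℓ ∣ y → f y = C) :
    ∑ y ∈ Finset.range (ℓ ^ 2), f y =
      ∑ y ∈ Finset.range ℓ, f (ℓ * y) + ((ℓ : ℂ) ^ 2 - ℓ) • C := by
  have h1 (a : ℕ) : ∑ b ∈ Finset.range ℓ, f (ℓ * a + b) = f (ℓ * a) + ((ℓ : ℂ) - 1) • C :=
    sum_range_prime_of_const ℓ (fun b => f (ℓ * a + b)) C fun b hb =>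
      hf _ fun hd => hb ((Nat.dvd_add_right (dvd_mul_right _ _)).1 hd)
  rw [sq, sum_range_mul, Finset.sum_congr rfl fun a _ => h1 a, Finset.sum_add_distrib,
    Finset.sum_const, Finset.card_range, ← Nat.cast_smul_eq_nsmul ℂ, smul_smul]
  congr 2
  ring

end Sums

section Classes

variable {W : Type*} [AddCommGroup W] [Module ℂ W] {z : GQ ℓ → W}

theorem IsEquivariant.hval_one_SLint (hz : IsEquivariant z) (p q : ℚ_[ℓ]) {h : GL (Fin 2) ℚ_[ℓ]}
    (hh : h ∈ SLint ℓ) :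
    hval z (p * h.1 1 1 - q * h.1 1 0) (q * h.1 0 0 - p * h.1 0 1) 1 = hval z p q 1 := by
  have := hz.hval_diagonal p q 1 h
  rw [det_eq_one_of_mem hh, norm_one, Complex.ofReal_one, one_smul, mul_one] at this
  rw [← this, ← hz.hval_mul_right _ _ 1 (isIntegralH_of_SLint (m := diagonalH h) hh hh), one_mul]

/-- The value at `(u/ℓⁿ, v/ℓⁿ)` for a primitive vector `(u, v)` depends only on `n`. -/
theorem IsEquivariant.hval_one_of_primitive (hz : IsEquivariant z) {n : ℕ} {u v : ℚ_[ℓ]}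
    (hu : ‖u‖ ≤ 1) (hv : ‖v‖ ≤ 1) (huv : ‖u‖ = 1 ∨ ‖v‖ = 1) :
    hval z (u / (ℓ : ℚ_[ℓ]) ^ n) (v / (ℓ : ℚ_[ℓ]) ^ n) 1 =
      hval z 0 (1 / (ℓ : ℚ_[ℓ]) ^ n) 1 := by
  obtain ⟨h, hh, h10, h00⟩ : ∃ h ∈ SLint ℓ, h.1 1 0 = -u ∧ h.1 0 0 = v := by
    obtain hu1 | hv1 := huv
    · have hne : u ≠ 0 := by rw [← norm_ne_zero_iff, hu1]; exact one_ne_zero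
      have hd : v * 0 - 1 / u * (-u) = 1 := by field_simp; ring
      exact ⟨sl _ _ _ _ hd, sl_mem_SLint hv (norm_div_le_one (by simp) hu1) (by rwa [norm_neg])
        (by simp), rfl, rfl⟩
    · have hne : v ≠ 0 := by rw [← norm_ne_zero_iff, hv1]; exact one_ne_zero
      have hd : v * (1 / v) - 0 * (-u) = 1 := by field_simp; ring
      exact ⟨sl _ _ _ _ hd, sl_mem_SLint hv (by simp) (by rwa [norm_neg])
        (norm_div_le_one (by simp) hv1), rfl, rfl⟩
  rw [← hz.hval_one_SLint 0 _ hh, h10, h00]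
  congr 1 <;> ring

/-- Elements of `SL₂(ℤ_ℓ)` with lower left entry in `ℓ²` fix both lattices of the pair `gam`. -/
theorem gam_mul_conj (a b c d : ℚ_[ℓ]) (h : a * d - b * ((ℓ : ℚ_[ℓ]) ^ 2 * c) = 1)
    (h' : a * d - b * (ℓ : ℚ_[ℓ]) ^ 2 * c = 1) :
    diagonalH (sl a b ((ℓ : ℚ_[ℓ]) ^ 2 * c) d h) * gam ℓ =
      gam ℓ * pairH (sl a b ((ℓ : ℚ_[ℓ]) ^ 2 * c) d h) (sl a (b * (ℓ : ℚ_[ℓ]) ^ 2) c d h')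
        (by rw [sl_det, sl_det]) := by
  have hℓ := prime_ne_zero ℓ
  refine Subtype.ext (Prod.ext ((mul_one _).trans (one_mul _).symm) (Units.ext ?_))
  change !![_, _; _, _] * !![_, 0; 0, _] = !![_, 0; 0, _] * !![_, _; _, _]
  ext i j
  fin_cases i <;> fin_cases j <;> simp [Matrix.mul_apply] <;> field_simp

theorem IsEquivariant.hval_gam (hz : IsEquivariant z) (p q : ℚ_[ℓ]) {a b c d : ℚ_[ℓ]}
    (h : a * d - b * ((ℓ : ℚ_[ℓ]) ^ 2 * c) = 1) (ha : ‖a‖ ≤ 1) (hb : ‖b‖ ≤ 1) (hc : ‖c‖ ≤ 1)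
    (hd : ‖d‖ ≤ 1) :
    hval z (p * d - q * ((ℓ : ℚ_[ℓ]) ^ 2 * c)) (q * a - p * b) (gam ℓ) = hval z p q (gam ℓ) := by
  have h' : a * d - b * (ℓ : ℚ_[ℓ]) ^ 2 * c = 1 := by rw [← h]; ring
  have := hz.hval_diagonal p q (gam ℓ) (sl _ _ _ _ h)
  rw [sl_det, norm_one, Complex.ofReal_one, one_smul, gam_mul_conj _ _ _ _ h h',
    hz.hval_mul_right _ _ _ (isIntegralH_of_SLint ?_ ?_)] at this
  · exact this
  · exact sl_mem_SLint (h := h) ha hb (norm_mul_le_one (norm_prime_pow_le_one 2) hc) hd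
  · exact sl_mem_SLint (h := h') ha (norm_mul_le_one hb (norm_prime_pow_le_one 2)) hc hd

theorem IsEquivariant.hval_gam_zero (hz : IsEquivariant z) (q : ℚ_[ℓ]) {v : ℚ_[ℓ]}
    (hv : ‖v‖ = 1) : hval z 0 (v * q) (gam ℓ) = hval z 0 q (gam ℓ) := by
  have hne : v ≠ 0 := by rw [← norm_ne_zero_iff, hv]; exact one_ne_zero
  have := hz.hval_gam 0 q (a := v) (b := 0) (c := 0) (d := 1 / v) (by field_simp; ring) hv.le
    (by simp) (by simp) (norm_div_le_one (by simp) hv)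
  rw [← this]
  congr 1 <;> ring

/-- The value at `(u/ℓ, y/ℓ²)`, with `u` a unit, depends only on `u y` modulo `ℓ`. -/
theorem IsEquivariant.hval_gam_unit (hz : IsEquivariant z) {u y c : ℚ_[ℓ]} (hu : ‖u‖ = 1)
    (hc : ‖c - u * y‖ ≤ (ℓ : ℝ) ^ (-((1 : ℕ) : ℤ))) :
    hval z (u / ℓ) (y / (ℓ : ℚ_[ℓ]) ^ 2) (gam ℓ) =
      hval z (1 / ℓ) (c / (ℓ : ℚ_[ℓ]) ^ 2) (gam ℓ) := by
  have hℓ := prime_ne_zero ℓ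
  have hne : u ≠ 0 := by rw [← norm_ne_zero_iff, hu]; exact one_ne_zero
  rw [norm_le_zpow_iff, pow_one] at hc
  have := hz.hval_gam (1 / ℓ) (c / (ℓ : ℚ_[ℓ]) ^ 2) (a := 1 / u) (b := (c - u * y) / ℓ / u)
    (c := 0) (d := u) (by field_simp; ring) (norm_div_le_one (by simp) hu)
    (norm_div_le_one hc hu) (by simp) hu.le
  rw [← this]
  congr 1 <;> field_simp <;> ring

/-- The Weyl element exchanges the two pairs `gam` and `gam'`. -/
theorem IsEquivariant.hval_gam' (hz : IsEquivariant z) (p q : ℚ_[ℓ]) :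
    hval z p q (gam' ℓ) = hval z q (-p) (gam ℓ) := by
  have hw : (0 : ℚ_[ℓ]) * 0 - 1 * (-1) = 1 := by ring
  have hwS : sl _ _ _ _ hw ∈ SLint ℓ := sl_mem_SLint (by simp) (by simp) (by simp) (by simp)
  have e : diagonalH (sl _ _ _ _ hw) * gam' ℓ = gam ℓ * diagonalH (sl _ _ _ _ hw) := by
    refine Subtype.ext (Prod.ext ((mul_one _).trans (one_mul _).symm) (Units.ext ?_))
    change !![_, _; _, _] * !![_, 0; 0, _] = !![_, 0; 0, _] * !![_, _; _, _]
    ext i j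
    fin_cases i <;> fin_cases j <;> simp [Matrix.mul_apply]
  have := hz.hval_diagonal p q (gam' ℓ) (sl _ _ _ _ hw)
  rw [sl_det, norm_one, Complex.ofReal_one, one_smul, e,
    hz.hval_mul_right _ _ _ (isIntegralH_of_SLint (m := diagonalH (sl _ _ _ _ hw)) hwS hwS)] at this
  rw [← this, sl_val]
  congr 1 <;> simp

/-! ### Sums for coinciding lattices -/

theorem IsEquivariant.latticeSum_one_zero_one (hz : IsEquivariant z) :
    latticeSum z 1 0 1 = hval z 0 0 1 + ((ℓ : ℂ) - 1) • hval z 0 (1 / (ℓ : ℚ_[ℓ]) ^ 1) 1 := by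
  simp only [latticeSum, pow_zero, Finset.range_one, Finset.sum_singleton, Nat.cast_zero, zero_div]
  conv_lhs => rw [pow_one (ℓ : ℕ)]
  rw [sum_range_prime_of_const ℓ _ (hval z 0 (1 / (ℓ : ℚ_[ℓ]) ^ 1) 1) fun y hy => ?_]
  · simp
  · have := hz.hval_one_of_primitive (n := 1) (u := 0) (by simp) (norm_natCast_le_one y)
      (Or.inr (norm_natCast_eq_one hy))
    rwa [zero_div] at this

theorem IsEquivariant.latticeSum_one_one_one (hz : IsEquivariant z) :
    latticeSum z 1 1 1 = hval z 0 0 1 +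
      ((ℓ : ℂ) ^ 2 - 1) • hval z 0 (1 / (ℓ : ℚ_[ℓ]) ^ 1) 1 := by
  have h0 := hz.latticeSum_one_zero_one
  simp only [latticeSum, pow_zero, Finset.range_one, Finset.sum_singleton, Nat.cast_zero,
    zero_div] at h0
  rw [latticeSum]
  conv_lhs => rw [pow_one (ℓ : ℕ)]
  rw [pow_one (ℓ : ℕ)] at h0
  rw [sum_range_prime_of_const ℓ _ ((ℓ : ℂ) • hval z 0 (1 / (ℓ : ℚ_[ℓ]) ^ 1) 1) fun x hx => ?_]
  · rw [Nat.cast_zero, zero_div, h0]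
    module
  · rw [Finset.sum_congr rfl fun y _ => hz.hval_one_of_primitive (norm_natCast_le_one x)
      (norm_natCast_le_one y) (Or.inl (norm_natCast_eq_one hx)), Finset.sum_const,
      Finset.card_range, Nat.cast_smul_eq_nsmul]

theorem mul_div_prime_sq (x : ℕ) :
    ((ℓ * x : ℕ) : ℚ_[ℓ]) / (ℓ : ℚ_[ℓ]) ^ 2 = (x : ℚ_[ℓ]) / (ℓ : ℚ_[ℓ]) ^ 1 := by
  have hℓ := prime_ne_zero ℓ
  push_cast
  field_simp

theorem IsEquivariant.latticeSum_one_one_two (hz : IsEquivariant z) :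
    latticeSum z 1 1 2 = latticeSum z 1 1 1 +
      ((ℓ : ℂ) ^ 3 - (ℓ : ℂ) ^ 2) • hval z 0 (1 / (ℓ : ℚ_[ℓ]) ^ 2) 1 := by
  have h1 (x : ℕ) := sum_range_prime_sq_of_const ℓ
    (fun y => hval z ((x : ℚ_[ℓ]) / (ℓ : ℚ_[ℓ]) ^ 1) ((y : ℚ_[ℓ]) / (ℓ : ℚ_[ℓ]) ^ 2) 1)
    (hval z 0 (1 / (ℓ : ℚ_[ℓ]) ^ 2) 1) fun y hy => by
      rw [← mul_div_prime_sq]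
      exact hz.hval_one_of_primitive (norm_natCast_le_one _) (norm_natCast_le_one y)
        (Or.inr (norm_natCast_eq_one hy))
  rw [latticeSum, Finset.sum_congr rfl fun x _ => h1 x, Finset.sum_add_distrib, Finset.sum_const,
    Finset.card_range, latticeSum, pow_one (ℓ : ℕ)]
  simp only [mul_div_prime_sq]
  rw [← Nat.cast_smul_eq_nsmul ℂ, smul_smul]
  congr 2
  ring

theorem IsEquivariant.latticeSum_one_two_two (hz : IsEquivariant z) :
    latticeSum z 1 2 2 = latticeSum z 1 1 2 +
      ((ℓ : ℂ) ^ 4 - (ℓ : ℂ) ^ 3) • hval z 0 (1 / (ℓ : ℚ_[ℓ]) ^ 2) 1 := by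
  rw [latticeSum, sum_range_prime_sq_of_const ℓ _
    ((ℓ : ℂ) ^ 2 • hval z 0 (1 / (ℓ : ℚ_[ℓ]) ^ 2) 1) fun x hx => ?_]
  · simp only [mul_div_prime_sq, latticeSum]
    rw [pow_one (ℓ : ℕ), smul_smul]
    congr 2
    ring
  · rw [Finset.sum_congr rfl fun y _ => hz.hval_one_of_primitive (norm_natCast_le_one x)
      (norm_natCast_le_one y) (Or.inl (norm_natCast_eq_one hx)), Finset.sum_const,
      Finset.card_range, ← Nat.cast_smul_eq_nsmul ℂ, Nat.cast_pow]

/-! ### Sums for lattices at distance two -/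

theorem IsEquivariant.latticeSum_gam_zero_one (hz : IsEquivariant z) :
    latticeSum z (gam ℓ) 0 1 = hval z 0 0 (gam ℓ) +
      ((ℓ : ℂ) - 1) • hval z 0 (1 / (ℓ : ℚ_[ℓ]) ^ 1) (gam ℓ) := by
  simp only [latticeSum, pow_zero, Finset.range_one, Finset.sum_singleton, Nat.cast_zero, zero_div]
  conv_lhs => rw [pow_one (ℓ : ℕ)]
  rw [sum_range_prime_of_const ℓ _ (hval z 0 (1 / (ℓ : ℚ_[ℓ]) ^ 1) (gam ℓ)) fun y hy => ?_]
  · simp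
  · rw [← hz.hval_gam_zero (1 / _) (norm_natCast_eq_one hy), mul_one_div]

theorem IsEquivariant.latticeSum_gam_zero_two (hz : IsEquivariant z) :
    latticeSum z (gam ℓ) 0 2 = latticeSum z (gam ℓ) 0 1 +
      ((ℓ : ℂ) ^ 2 - ℓ) • hval z 0 (1 / (ℓ : ℚ_[ℓ]) ^ 2) (gam ℓ) := by
  simp only [latticeSum, pow_zero, Finset.range_one, Finset.sum_singleton, Nat.cast_zero, zero_div]
  rw [sum_range_prime_sq_of_const ℓ _ (hval z 0 (1 / (ℓ : ℚ_[ℓ]) ^ 2) (gam ℓ)) fun y hy => ?_]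
  · simp only [mul_div_prime_sq]
    rw [pow_one (ℓ : ℕ)]
  · rw [← hz.hval_gam_zero (1 / _) (norm_natCast_eq_one hy), mul_one_div]

/-- By the Weyl element the sum becomes one over `(y/ℓ, -x/ℓ)` for the pair `gam`, where all terms
with `y ≠ 0` agree. -/
theorem IsEquivariant.latticeSum_gam'_one_one (hz : IsEquivariant z) :
    latticeSum z (gam' ℓ) 1 1 = latticeSum z (gam ℓ) 0 1 +
      ((ℓ : ℂ) ^ 2 - ℓ) • hval z (1 / ℓ) 0 (gam ℓ) := by
  have hℓ := prime_ne_zero ℓ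
  have h1 (x : ℕ) := sum_range_prime_of_const ℓ
    (fun y => hval z ((x : ℚ_[ℓ]) / (ℓ : ℚ_[ℓ]) ^ 1) ((y : ℚ_[ℓ]) / (ℓ : ℚ_[ℓ]) ^ 1) (gam' ℓ))
    (hval z (1 / ℓ) 0 (gam ℓ)) fun y hy => by
      have := hz.hval_gam_unit (u := y) (y := -(ℓ * x)) (c := 0) (norm_natCast_eq_one hy) (by
        rw [norm_le_zpow_iff, show (0 - (y : ℚ_[ℓ]) * -(ℓ * x)) / (ℓ : ℚ_[ℓ]) ^ 1 =
          ((y * x : ℕ) : ℚ_[ℓ]) by push_cast; field_simp; ring]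
        exact norm_natCast_le_one _)
      rw [hz.hval_gam', ← zero_div ((ℓ : ℚ_[ℓ]) ^ 2), ← this, pow_one]
      congr 1
      field_simp
  have h2 (x : ℕ) : hval z ((x : ℚ_[ℓ]) / (ℓ : ℚ_[ℓ]) ^ 1)
      (((0 : ℕ) : ℚ_[ℓ]) / (ℓ : ℚ_[ℓ]) ^ 1) (gam' ℓ) =
      hval z 0 ((x : ℚ_[ℓ]) / (ℓ : ℚ_[ℓ]) ^ 1) (gam ℓ) := by
    rw [hz.hval_gam', Nat.cast_zero, zero_div, ← neg_one_mul]
    exact hz.hval_gam_zero _ (by simp)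
  simp only [latticeSum, pow_zero, Finset.range_one, Finset.sum_singleton, Nat.cast_zero, zero_div]
  conv_lhs => rw [pow_one (ℓ : ℕ)]
  rw [Finset.sum_congr rfl fun x _ => h1 x, Finset.sum_add_distrib, Finset.sum_const,
    Finset.card_range, Finset.sum_congr rfl fun x _ => h2 x, pow_one (ℓ : ℕ),
    ← Nat.cast_smul_eq_nsmul ℂ, smul_smul]
  congr 2
  ring

/-- For a fixed nonzero first coordinate `x/ℓ`, the product `x y` takes each residue modulo `ℓ`
equally often as `y` runs through the residues modulo `ℓ²`. -/
theorem IsEquivariant.latticeSum_gam_one_two (hz : IsEquivariant z) :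
    latticeSum z (gam ℓ) 1 2 = latticeSum z (gam ℓ) 0 2 +
      ((ℓ : ℂ) ^ 2 - ℓ) • ∑ c ∈ Finset.range ℓ,
        hval z (1 / ℓ) ((c : ℚ_[ℓ]) / (ℓ : ℚ_[ℓ]) ^ 2) (gam ℓ) := by
  set E : ZMod ℓ → W := fun c => hval z (1 / ℓ) ((c.val : ℚ_[ℓ]) / (ℓ : ℚ_[ℓ]) ^ 2) (gam ℓ) with hE
  have hsum (f : ZMod ℓ → W) : ∑ b ∈ Finset.range ℓ, f (b : ZMod ℓ) = ∑ c, f c := by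
    refine Finset.sum_bij' (fun b _ => (b : ZMod ℓ)) (fun c _ => c.val)
      (fun _ _ => Finset.mem_univ _) (fun c _ => Finset.mem_range.2 c.val_lt)
      (fun b hb => ZMod.val_cast_of_lt (Finset.mem_range.1 hb))
      (fun c _ => ZMod.natCast_zmod_val c) (fun _ _ => rfl)
  have hEs : ∑ c ∈ Finset.range ℓ, hval z (1 / ℓ) ((c : ℚ_[ℓ]) / (ℓ : ℚ_[ℓ]) ^ 2) (gam ℓ) =
      ∑ c, E c := by
    rw [← hsum]
    refine Finset.sum_congr rfl fun c hc => ?_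
    rw [hE]
    dsimp only
    rw [ZMod.val_cast_of_lt (Finset.mem_range.1 hc)]
  have hxy (x y : ℕ) (hx : ¬ ℓ ∣ x) : hval z ((x : ℚ_[ℓ]) / (ℓ : ℚ_[ℓ]) ^ 1)
      ((y : ℚ_[ℓ]) / (ℓ : ℚ_[ℓ]) ^ 2) (gam ℓ) = E ((x : ZMod ℓ) * (y : ZMod ℓ)) := by
    rw [pow_one]
    refine hz.hval_gam_unit (norm_natCast_eq_one hx) ?_
    have : ((((x : ZMod ℓ) * (y : ZMod ℓ)).val : ℤ) - (x * y : ℤ) : ℤ) = (0 : ZMod ℓ) := by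
      push_cast
      rw [ZMod.natCast_zmod_val, sub_self]
    rw [ZMod.intCast_zmod_eq_zero_iff_dvd] at this
    have h2 := (Padic.norm_int_le_pow_iff_dvd (p := ℓ)
      ((((x : ZMod ℓ) * (y : ZMod ℓ)).val : ℤ) - (x * y : ℤ)) 1).2 (by simpa using this)
    exact_mod_cast h2
  rw [latticeSum, pow_one (ℓ : ℕ), sum_range_prime_of_const ℓ _ ((ℓ : ℂ) • ∑ c, E c)
    fun x hx => ?_, hEs]
  · simp only [latticeSum, pow_zero, Finset.range_one, Finset.sum_singleton, Nat.cast_zero,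
      zero_div]
    rw [smul_smul]
    congr 2
    ring
  · have hx0 : (x : ZMod ℓ) ≠ 0 := by rwa [Ne, ZMod.natCast_eq_zero_iff]
    have h3 (a : ℕ) : ∑ b ∈ Finset.range ℓ, E ((x : ZMod ℓ) * ((ℓ * a + b : ℕ) : ZMod ℓ)) =
        ∑ c, E c := by
      simp only [Nat.cast_add, Nat.cast_mul, ZMod.natCast_self, zero_mul, zero_add]
      rw [hsum (fun b => E (x * b))]
      exact Equiv.sum_comp (Equiv.mulLeft₀ (x : ZMod ℓ) hx0) E
    rw [Finset.sum_congr rfl fun y _ => hxy x y hx, sq, sum_range_mul,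
      Finset.sum_congr rfl fun a _ => h3 a, Finset.sum_const, Finset.card_range,
      Nat.cast_smul_eq_nsmul]

end Classes

/-! ### Values at the unipotent elements -/

/-- The pair `(1, (1 c; 0 1))`. -/
def ups (c : ℚ_[ℓ]) : HQ ℓ :=
  pairH 1 (sl 1 c 0 1 (by ring)) (by rw [sl_det]; simp)

theorem eta_fst (i j : ℕ) (a b c : ℚ_[ℓ]) : (eta ℓ i j a b c).1.1.1 =
    !![1, a / (ℓ : ℚ_[ℓ]) ^ i, b / (ℓ : ℚ_[ℓ]) ^ i, 0; 0, 1, 0, b / (ℓ : ℚ_[ℓ]) ^ i;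
      0, 0, 1, -a / (ℓ : ℚ_[ℓ]) ^ i; 0, 0, 0, 1] := rfl

theorem eta_snd (i j : ℕ) (a b c : ℚ_[ℓ]) : (eta ℓ i j a b c).1.2.1 =
    !![1, c / (ℓ : ℚ_[ℓ]) ^ j; 0, 1] := rfl

theorem eta_eq (i j : ℕ) (a b c : ℚ_[ℓ]) : eta ℓ i j a b c =
    heis (a / (ℓ : ℚ_[ℓ]) ^ i) (b / (ℓ : ℚ_[ℓ]) ^ i) 0 * lev (ups (c / (ℓ : ℚ_[ℓ]) ^ j)) := by
  refine GQ_ext ?_ ?_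
  · rw [heis_lev_fst, show (ups (c / (ℓ : ℚ_[ℓ]) ^ j)).1.1.1 = 1 from rfl, eta_fst, neg_div]
    generalize a / (ℓ : ℚ_[ℓ]) ^ i = x
    generalize b / (ℓ : ℚ_[ℓ]) ^ i = y
    rw [Matrix.det_one]
    simp
  · rw [eta_snd, mul_snd, heis_snd, one_mul]
    rfl

section Unipotent

variable {W : Type*} [AddCommGroup W] [Module ℂ W] {z : GQ ℓ → W}

theorem IsEquivariant.hval_ups_integral (hz : IsEquivariant z) (p q : ℚ_[ℓ]) {c : ℚ_[ℓ]}
    (hc : ‖c‖ ≤ 1) : hval z p q (ups c) = hval z p q 1 := by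
  rw [← hz.hval_mul_right p q 1 (k := ups c), one_mul]
  exact isIntegralH_of_SLint (one_mem _)
    (sl_mem_SLint (h := by ring) (by simp) hc (by simp) (by simp))

/-- The lattices attached to `ups (1/(uℓ))` and `gam` differ by the diagonal `SL₂(ℤ_ℓ)`. -/
theorem IsEquivariant.hval_ups (hz : IsEquivariant z) (p q : ℚ_[ℓ]) {u : ℚ_[ℓ]}
    (hu : ‖u‖ = 1) :
    hval z p q (ups (1 / (u * (ℓ : ℚ_[ℓ])))) = hval z (p + u * ℓ * q) q (gam ℓ) := by
  have hℓ := prime_ne_zero ℓ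
  have hne : u ≠ 0 := by rw [← norm_ne_zero_iff, hu]; exact one_ne_zero
  have hul : ‖u * ℓ‖ ≤ 1 := norm_mul_le_one hu.le (norm_natCast_le_one ℓ)
  have h1 : (1 : ℚ_[ℓ]) * 1 - 0 * (u * ℓ) = 1 := by ring
  have h2 : (0 : ℚ_[ℓ]) * ℓ - -(1 / u) * u = 1 := by field_simp; ring
  have e : diagonalH (sl _ _ _ _ h1) * gam ℓ = ups (1 / (u * (ℓ : ℚ_[ℓ]))) *
      pairH (sl _ _ _ _ h1) (sl _ _ _ _ h2) (by rw [sl_det, sl_det]) := by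
    refine Subtype.ext (Prod.ext ((mul_one _).trans (one_mul _).symm) (Units.ext ?_))
    change !![_, _; _, _] * !![_, 0; 0, _] = !![_, _; _, _] * !![_, _; _, _]
    ext i j
    fin_cases i <;> fin_cases j <;> simp [Matrix.mul_apply] <;> field_simp
    ring
  have := hz.hval_diagonal (p + u * ℓ * q) q (gam ℓ) (sl _ _ _ _ h1)
  rw [sl_det, norm_one, Complex.ofReal_one, one_smul, e,
    hz.hval_mul_right _ _ _ (isIntegralH_of_SLint ?_ ?_)] at this
  · rw [← this, sl_val]
    congr 1 <;> simp
    ring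
  · exact sl_mem_SLint (h := h1) (by simp) (by simp) hul (by simp)
  · exact sl_mem_SLint (h := h2) (by simp)
      (by rw [norm_neg]; exact norm_div_le_one (by simp) hu) hu.le (norm_natCast_le_one ℓ)

variable (ℓ) in
/-- The pair of diagonal matrices `(diag(u⁻¹, 1), diag(u⁻¹, 1))` with `u = i + 1`. -/
def kap (i : ℕ) : HQ ℓ :=
  diagonalH (dg (((i + 1 : ℕ) : ℚ_[ℓ]))⁻¹ 1 (inv_ne_zero (Nat.cast_ne_zero.2 i.succ_ne_zero))
    one_ne_zero)

theorem norm_succ_eq_one (i : Fin (ℓ - 1)) : ‖((i + 1 : ℕ) : ℚ_[ℓ])‖ = 1 :=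
  norm_natCast_eq_one fun hd => by
    have := Nat.le_of_dvd (Nat.succ_pos _) hd
    have := i.2
    omega

/-- Multiplying by `kap` on the right rescales both the second coordinate and the entry of `ups`;
the effect on the class is to multiply the residue by `i + 1`. -/
theorem IsEquivariant.hval_ups_mul_kap (hz : IsEquivariant z) (i : Fin (ℓ - 1)) :
    hval z 0 (1 / (ℓ : ℚ_[ℓ]) ^ 2) (ups (1 / (ℓ : ℚ_[ℓ])) * kap ℓ i) =
      hval z (1 / ℓ) (((i + 1 : ℕ) : ℚ_[ℓ]) / (ℓ : ℚ_[ℓ]) ^ 2) (gam ℓ) := by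
  have hℓ := prime_ne_zero ℓ
  have hu := norm_succ_eq_one i
  set u : ℚ_[ℓ] := ((i + 1 : ℕ) : ℚ_[ℓ]) with hudef
  have hne : u ≠ 0 := by rw [← norm_ne_zero_iff, hu]; exact one_ne_zero
  have e : diagonalH (dg u 1 hne one_ne_zero) * (ups (1 / (ℓ : ℚ_[ℓ])) * kap ℓ i) =
      ups (1 / (u⁻¹ * (ℓ : ℚ_[ℓ]))) := by
    refine HQ_ext ?_ ?_
    · change !![u, 0; 0, 1] * (1 * !![u⁻¹, 0; 0, 1]) = 1
      simp [hne, Matrix.one_fin_two]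
    · change !![u, 0; 0, 1] * (!![1, _; 0, 1] * !![u⁻¹, 0; 0, 1]) = !![1, _; 0, 1]
      ext r s
      fin_cases r <;> fin_cases s <;> simp [Matrix.mul_apply, hne] <;> field_simp
  have := hz.hval_diagonal 0 (1 / (ℓ : ℚ_[ℓ]) ^ 2) (ups (1 / (ℓ : ℚ_[ℓ])) * kap ℓ i)
    (dg u 1 hne one_ne_zero)
  have hd : (dg u 1 hne one_ne_zero).1.det = u := by
    rw [dg_val, Matrix.det_fin_two]; simp
  rw [e, hd, hu, Complex.ofReal_one, one_smul, hz.hval_ups _ _ (by rw [norm_inv, hu, inv_one]),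
    dg_val] at this
  rw [← this]
  congr 1 <;> simp <;> field_simp

end Unipotent

variable (ℓ) in
/-- The group `G(ℤ_ℓ)` as a subgroup of `G`. -/
def GintSubgroup : Subgroup (GQ ℓ) where
  carrier := {g | g.1.1 ∈ GLintSubgroup ℓ 4 ∧ g.1.2 ∈ GLintSubgroup ℓ 2}
  one_mem' := ⟨one_mem _, one_mem _⟩
  mul_mem' := fun ha hb => ⟨mul_mem ha.1 hb.1, mul_mem ha.2 hb.2⟩
  inv_mem' := fun ha => ⟨inv_mem ha.1, inv_mem ha.2⟩

theorem mem_GintSubgroup {g : GQ ℓ} : g ∈ GintSubgroup ℓ ↔ (∀ i j, ‖g.1.1.1 i j‖ ≤ 1) ∧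
    (∀ i j, ‖g.1.2.1 i j‖ ≤ 1) ∧ ‖g.1.2.1.det‖ = 1 := by
  constructor
  · rintro ⟨h1, h2⟩
    exact ⟨((mem_GLintSubgroup ℓ).1 h1).1, (mem_GLintSubgroup ℓ).1 h2⟩
  · rintro ⟨h1, h2, h3⟩
    exact ⟨(mem_GLintSubgroup ℓ).2 ⟨h1, norm_det_fst_eq_one h3⟩,
      (mem_GLintSubgroup ℓ).2 ⟨h2, h3⟩⟩

theorem mem_K00_iff {g : GQ ℓ} : g ∈ K ℓ 0 0 ↔ g ∈ GintSubgroup ℓ := by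
  rw [mem_GintSubgroup]
  constructor
  · rintro ⟨⟨h1, h2⟩, -, -⟩
    exact ⟨h1.1, h2⟩
  · rintro ⟨h1, h2, h3⟩
    refine ⟨⟨⟨h1, norm_det_fst_eq_one h3⟩, h2, h3⟩, by simp [h1], ?_⟩
    simpa using norm_sub_le_of_le h3.le (norm_one (α := ℚ_[ℓ])).le

theorem mem_coset_K00_iff {g x : GQ ℓ} : x ∈ coset ℓ g (K ℓ 0 0) ↔ g⁻¹ * x ∈ GintSubgroup ℓ := by
  rw [← mem_K00_iff]
  constructor
  · rintro ⟨k, hk, rfl⟩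
    change g⁻¹ * (g * k) ∈ _
    rwa [inv_mul_cancel_left]
  · intro h
    exact ⟨_, h, mul_inv_cancel_left g x⟩

theorem det_kap (i : ℕ) : (lev (kap ℓ i)).1.2.1.det = (((i + 1 : ℕ) : ℚ_[ℓ]))⁻¹ := by
  change Matrix.det !![_, 0; 0, 1] = _
  rw [Matrix.det_fin_two]
  simp

theorem kap_mem (i : Fin (ℓ - 1)) : lev (kap ℓ i) ∈ GintSubgroup ℓ := by
  have hu := norm_succ_eq_one i
  rw [mem_GintSubgroup, det_kap, norm_inv, hu, inv_one, lev_fst, lev_snd]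
  have e : (kap ℓ i).1.1.1 = !![(((i + 1 : ℕ) : ℚ_[ℓ]))⁻¹, 0; 0, 1] := rfl
  have e' : (kap ℓ i).1.2.1 = !![(((i + 1 : ℕ) : ℚ_[ℓ]))⁻¹, 0; 0, 1] := rfl
  have hui : ‖(((i + 1 : ℕ) : ℚ_[ℓ]))⁻¹‖ ≤ 1 := by rw [norm_inv, hu, inv_one]
  rw [e, e']
  generalize (((i + 1 : ℕ) : ℚ_[ℓ]))⁻¹ = v at hui
  refine ⟨fun r s => ?_, fun r s => ?_, rfl⟩
  · fin_cases r <;> fin_cases s <;> simp [hui]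
  · fin_cases r <;> fin_cases s <;> simp [hui]

theorem K10_le : K10 ℓ ≤ GintSubgroup ℓ := fun _ h => h.1

/-- A coset of `K_{0,0}` is a union of `ℓ - 1` cosets of `K_{1,0}`. -/
theorem ch_coset_K00 (g : GQ ℓ) : ch (coset ℓ g (K ℓ 0 0)) =
    ∑ i : Fin (ℓ - 1), ch (coset ℓ (g * lev (kap ℓ i)) (K ℓ 1 0)) := by
  refine ch_eq_sum_coset (fun i : Fin (ℓ - 1) => g * lev (kap ℓ i)) (fun x => ?_)
    (fun i j hij => ?_)
  · rw [mem_coset_K00_iff]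
    constructor
    · intro hx
      obtain ⟨-, -, hδ⟩ := mem_GintSubgroup.1 hx
      set δ := (g⁻¹ * x).1.2.1.det with hδdef
      have hne : δ ≠ 0 := by rw [← norm_ne_zero_iff, hδ]; exact one_ne_zero
      obtain ⟨j, hj⟩ := exists_digit (show ‖δ⁻¹‖ ≤ 1 by rw [norm_inv, hδ, inv_one]) 1
      have hj0 : (j : ℕ) ≠ 0 := fun h0 => by
        rw [h0, Nat.cast_zero, sub_zero, norm_inv, hδ, inv_one] at hj
        exact absurd hj (not_le.2 (zpow_neg_lt_one ℓ le_rfl))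
      have hjℓ : (j : ℕ) < ℓ := j.2.trans_eq (pow_one ℓ)
      have hi : (j : ℕ) - 1 < ℓ - 1 := by omega
      refine ⟨⟨(j : ℕ) - 1, hi⟩, ?_⟩
      rw [mul_inv_rev, mul_assoc]
      refine ⟨mul_mem (inv_mem (kap_mem ⟨(j : ℕ) - 1, hi⟩)) hx, ?_⟩
      have e : ((lev (kap ℓ ((j : ℕ) - 1)))⁻¹ * (g⁻¹ * x)).1.2.1.det =
          ((j : ℕ) : ℚ_[ℓ]) * δ := by
        have e1 : (lev (kap ℓ ((j : ℕ) - 1))).1.2.1.det *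
            ((lev (kap ℓ ((j : ℕ) - 1)))⁻¹ * (g⁻¹ * x)).1.2.1.det = δ := by
          rw [← Matrix.det_mul, ← mul_snd, mul_inv_cancel_left]
        rw [det_kap, Nat.sub_add_cancel (Nat.pos_of_ne_zero hj0)] at e1
        have hjne : ((j : ℕ) : ℚ_[ℓ]) ≠ 0 := Nat.cast_ne_zero.2 hj0
        rw [← e1, mul_inv_cancel_left₀ hjne]
      rw [e, show ((j : ℕ) : ℚ_[ℓ]) * δ - 1 = -(δ * (δ⁻¹ - ((j : ℕ) : ℚ_[ℓ]))) by
        field_simp; ring, norm_neg, norm_mul, hδ, one_mul]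
      exact hj
    · rintro ⟨i, hi⟩
      have := mul_mem (kap_mem i) (K10_le hi)
      rwa [mul_inv_rev, mul_assoc, mul_inv_cancel_left] at this
  · rw [mul_inv_rev, mul_assoc, inv_mul_cancel_left] at hij
    have hu := norm_succ_eq_one j
    have hne : ((j + 1 : ℕ) : ℚ_[ℓ]) ≠ 0 := Nat.cast_ne_zero.2 (Nat.succ_ne_zero _)
    have hne' : ((i + 1 : ℕ) : ℚ_[ℓ]) ≠ 0 := Nat.cast_ne_zero.2 (Nat.succ_ne_zero _)
    have e : ((lev (kap ℓ i))⁻¹ * lev (kap ℓ j)).1.2.1.det =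
        ((i + 1 : ℕ) : ℚ_[ℓ]) * (((j + 1 : ℕ) : ℚ_[ℓ]))⁻¹ := by
      have e1 : (lev (kap ℓ i)).1.2.1.det * ((lev (kap ℓ i))⁻¹ * lev (kap ℓ j)).1.2.1.det =
          (lev (kap ℓ j)).1.2.1.det := by
        rw [← Matrix.det_mul, ← mul_snd, mul_inv_cancel_left]
      rw [det_kap, det_kap] at e1
      rw [← e1, mul_inv_cancel_left₀ hne']
    have h2 := hij.2
    rw [e, show ((i + 1 : ℕ) : ℚ_[ℓ]) * (((j + 1 : ℕ) : ℚ_[ℓ]))⁻¹ - 1 =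
      (((i + 1 : ℕ) : ℚ_[ℓ]) - ((j + 1 : ℕ) : ℚ_[ℓ])) / ((j + 1 : ℕ) : ℚ_[ℓ]) by field_simp,
      norm_div, hu, div_one] at h2
    have hi := i.2
    have hj := j.2
    have := digit_unique (ℓ := ℓ) (n := 1) (i := ⟨(i : ℕ) + 1, by rw [pow_one]; omega⟩)
      (j := ⟨(j : ℕ) + 1, by rw [pow_one]; omega⟩) h2
    have := congrArg Fin.val this
    exact Fin.ext (by simpa using this)

section EtaValues

variable {W : Type*} [AddCommGroup W] [Module ℂ W] {z : GQ ℓ → W}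
  {Z : HeckeTensor ℓ →ₗ[ℂ] W}

theorem hasValue_chEta
    (hv : ∀ g, HasValueAtPhiInfty ℓ Z (ch (coset ℓ g (K ℓ 1 0))) (z g)) (i j : ℕ)
    (a b c : ℚ_[ℓ]) : HasValueAtPhiInfty ℓ Z (chEta ℓ 1 i j a b c)
      (hval z (a / (ℓ : ℚ_[ℓ]) ^ i) (b / (ℓ : ℚ_[ℓ]) ^ i) (ups (c / (ℓ : ℚ_[ℓ]) ^ j))) := by
  rw [chEta, eta_eq]
  exact hv _

/-- The identity coset has Heisenberg coordinates zero. -/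
theorem hasValue_ch_K10
    (hv : ∀ g, HasValueAtPhiInfty ℓ Z (ch (coset ℓ g (K ℓ 1 0))) (z g)) :
    HasValueAtPhiInfty ℓ Z (ch (K ℓ 1 0)) (hval z 0 0 1) := by
  have e : coset ℓ 1 (K ℓ 1 0) = K ℓ 1 0 := by
    apply SetLike.ext
    intro x
    rw [mem_coset_iff, mem_K_iff, inv_one, one_mul]
  have := hv 1
  rw [e] at this
  rwa [hval, heis_zero, map_one, mul_one]

theorem hasValue_chEta_one_zero
    (hv : ∀ g, HasValueAtPhiInfty ℓ Z (ch (coset ℓ g (K ℓ 1 0))) (z g)) (hz : IsEquivariant z) :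
    HasValueAtPhiInfty ℓ Z (chEta ℓ 1 1 0 1 0 0) (hval z 0 (1 / (ℓ : ℚ_[ℓ]) ^ 1) 1) := by
  have := hasValue_chEta hv 1 0 1 0 0
  rwa [hz.hval_ups_integral _ _ (by simp),
    hz.hval_one_of_primitive (by simp) (by simp) (Or.inl (by simp))] at this

theorem IsEquivariant.hval_ups_prime (hz : IsEquivariant z) (p q : ℚ_[ℓ]) :
    hval z p q (ups (1 / (ℓ : ℚ_[ℓ]) ^ 1)) = hval z (p + ℓ * q) q (gam ℓ) := by
  have := hz.hval_ups p q (u := 1) (by simp)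
  rwa [one_mul, ← pow_one (1 / (ℓ : ℚ_[ℓ])), one_div_pow] at this

theorem hasValue_chEta_zero_one
    (hv : ∀ g, HasValueAtPhiInfty ℓ Z (ch (coset ℓ g (K ℓ 1 0))) (z g)) (hz : IsEquivariant z) :
    HasValueAtPhiInfty ℓ Z (chEta ℓ 1 0 1 0 0 1) (hval z 0 0 (gam ℓ)) := by
  have := hasValue_chEta hv 0 1 0 0 1
  rw [hz.hval_ups_prime] at this
  simpa using this

theorem hasValue_chEta_one_one
    (hv : ∀ g, HasValueAtPhiInfty ℓ Z (ch (coset ℓ g (K ℓ 1 0))) (z g)) (hz : IsEquivariant z) :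
    HasValueAtPhiInfty ℓ Z (chEta ℓ 1 1 1 1 0 1) (hval z (1 / ℓ) 0 (gam ℓ)) := by
  have := hasValue_chEta hv 1 1 1 0 1
  rw [hz.hval_ups_prime] at this
  simpa using this

theorem hasValue_chEta_one_one'
    (hv : ∀ g, HasValueAtPhiInfty ℓ Z (ch (coset ℓ g (K ℓ 1 0))) (z g)) (hz : IsEquivariant z) :
    HasValueAtPhiInfty ℓ Z (chEta ℓ 1 1 1 0 1 1) (hval z 0 (1 / (ℓ : ℚ_[ℓ]) ^ 1) (gam ℓ)) := by
  have hℓ := prime_ne_zero ℓ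
  have := hasValue_chEta hv 1 1 0 1 1
  rw [hz.hval_ups_prime, ← zero_add (1 / (ℓ : ℚ_[ℓ]) ^ 1), zero_div, pow_one,
    show 0 + (ℓ : ℚ_[ℓ]) * (0 + 1 / ℓ) = 0 + 1 by field_simp; ring, zero_add (1 / (ℓ : ℚ_[ℓ])),
    ← add_zero (1 / (ℓ : ℚ_[ℓ])), hz.hval_add _ _ _ rfl (by simp) (by simp)] at this
  rwa [pow_one]

theorem hasValue_chEta_two_one
    (hv : ∀ g, HasValueAtPhiInfty ℓ Z (ch (coset ℓ g (K ℓ 1 0))) (z g)) (hz : IsEquivariant z) :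
    HasValueAtPhiInfty ℓ Z (chEta ℓ 1 2 1 (-(ℓ : ℚ_[ℓ])) 1 1)
      (hval z 0 (1 / (ℓ : ℚ_[ℓ]) ^ 2) (gam ℓ)) := by
  have hℓ := prime_ne_zero ℓ
  have := hasValue_chEta hv 2 1 (-(ℓ : ℚ_[ℓ])) 1 1
  rwa [hz.hval_ups_prime, show -(ℓ : ℚ_[ℓ]) / (ℓ : ℚ_[ℓ]) ^ 2 + ℓ * (1 / (ℓ : ℚ_[ℓ]) ^ 2) = 0 by
    field_simp; ring] at this

/-- The `ℓ - 1` cosets of `K_{1,0}` contribute the classes with nonzero residue. -/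
theorem hasValue_chEta_K00
    (hv : ∀ g, HasValueAtPhiInfty ℓ Z (ch (coset ℓ g (K ℓ 1 0))) (z g)) (hz : IsEquivariant z) :
    HasValueAtPhiInfty ℓ Z (chEta ℓ 0 2 1 0 1 1)
      (∑ c ∈ Finset.range ℓ, hval z (1 / ℓ) ((c : ℚ_[ℓ]) / (ℓ : ℚ_[ℓ]) ^ 2) (gam ℓ) -
        hval z (1 / ℓ) 0 (gam ℓ)) := by
  have h1 := HasValueAtPhiInfty.sum fun i : Fin (ℓ - 1) =>
    hv (eta ℓ 2 1 0 1 1 * lev (kap ℓ i))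
  rw [← ch_coset_K00] at h1
  have h2 (i : Fin (ℓ - 1)) : z (eta ℓ 2 1 0 1 1 * lev (kap ℓ i)) =
      hval z (1 / ℓ) (((i + 1 : ℕ) : ℚ_[ℓ]) / (ℓ : ℚ_[ℓ]) ^ 2) (gam ℓ) := by
    rw [← hz.hval_ups_mul_kap, eta_eq, mul_assoc, ← map_mul, zero_div, pow_one]
    rfl
  rw [Finset.sum_congr rfl fun i _ => h2 i, ← Finset.sum_range
    (fun i => hval z (1 / ℓ) (((i + 1 : ℕ) : ℚ_[ℓ]) / (ℓ : ℚ_[ℓ]) ^ 2) (gam ℓ))] at h1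
  have h3 := Finset.sum_range_succ' (fun c : ℕ =>
    hval z (1 / ℓ) ((c : ℚ_[ℓ]) / (ℓ : ℚ_[ℓ]) ^ 2) (gam ℓ)) (ℓ - 1)
  rw [Nat.sub_add_cancel (Fact.out : ℓ.Prime).one_le, Nat.cast_zero, zero_div] at h3
  rw [h3, add_sub_cancel_right]
  exact h1

end EtaValues

/-! ### Comparison of the two elements -/

/-- The identity between the two linear combinations of the class values. Here `D_n`, `E_n` are the
values at `(0, 1/ℓⁿ)` for coinciding lattices and for lattices at distance two, `F₀` is the value
at `(1/ℓ, 0)`, and `F` is the sum of the values at `(1/ℓ, c/ℓ²)` over the residues `c` modulo `ℓ`.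
-/
theorem class_value_identity {W : Type*} [AddCommGroup W] [Module ℂ W] {l : ℂ} (h0 : l ≠ 0)
    (h1 : l - 1 ≠ 0) (h2 : l + 1 ≠ 0) (D₀ D₁ D₂ E₀ E₁ E₂ F₀ F : W) :
    D₀ - (l ^ 2)⁻¹ • ((l + 1) • (D₀ + (l - 1) • D₁) + ((l + 1) * l) • (E₀ + (l - 1) • E₁))
      + (2 * (l ^ 3)⁻¹) • (D₀ + (l ^ 2 - 1) • D₁)
      + (l ^ 3)⁻¹ • ((l ^ 2 + l) • (E₀ + (l - 1) • E₁ + (l ^ 2 - l) • F₀))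
      + (l ^ 3)⁻¹ • ((l ^ 2 + l) • (E₀ + (l - 1) • E₁ + (l ^ 2 - l) • E₂))
      - (l ^ 4)⁻¹ • ((l + 1) • (D₀ + (l ^ 2 - 1) • D₁ + (l ^ 3 - l ^ 2) • D₂) +
          ((l + 1) * l) • (E₀ + (l - 1) • E₁ + (l ^ 2 - l) • E₂ + (l ^ 2 - l) • F))
      + (l ^ 4)⁻¹ • (D₀ + (l ^ 2 - 1) • D₁ + (l ^ 3 - l ^ 2) • D₂ + (l ^ 4 - l ^ 3) • D₂)
    = (1 / (l ^ 4 * (l ^ 2 - 1))) •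
      ((l * (l - 1) ^ 3 * (l + 1) ^ 2) •
          (D₀ - D₁ - E₀ + l • F₀ - (l - 1) • E₁ + l • E₂)
        - (l ^ 2 * (l - 1) ^ 2 * (l + 1) ^ 2) • (F - F₀)) := by
  have h3 : l ^ 2 - 1 ≠ 0 := by
    rw [show l ^ 2 - 1 = (l - 1) * (l + 1) by ring]; exact mul_ne_zero h1 h2
  match_scalars <;> field_simp <;> ring

/-- The comparison holds for every linear map on the tensor product over `H(H)`: both values are
combinations of the same class values. -/
theorem exists_hasValue_xiSimple_xi₀ {W : Type*} [AddCommGroup W] [Module ℂ W]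
    (Z : HeckeTensor ℓ →ₗ[ℂ] W) : ∃ w : W, HasValueAtPhiInfty ℓ Z (xiSimple ℓ) w ∧
      HasValueAtPhiInfty ℓ Z (xi₀ ℓ) ((1 / ((ℓ : ℂ) ^ 4 * ((ℓ : ℂ) ^ 2 - 1))) • w) := by
  obtain ⟨z, hv, hr, hl⟩ := exists_cosetValue Z
  have hz : IsEquivariant z := ⟨hr, hl⟩
  have hp : ℓ.Prime := Fact.out
  have h0 : (ℓ : ℂ) ≠ 0 := Nat.cast_ne_zero.2 hp.ne_zero
  have h1 : (ℓ : ℂ) - 1 ≠ 0 := sub_ne_zero.2 (by exact_mod_cast hp.one_lt.ne')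
  have h2 : (ℓ : ℂ) + 1 ≠ 0 := by exact_mod_cast Nat.succ_ne_zero ℓ
  have hK := hasValue_ch_K10 hv
  refine ⟨_, ((((((hK.sub (hasValue_chEta_one_zero hv hz)).sub
    (hasValue_chEta_zero_one hv hz)).add ((hasValue_chEta_one_one hv hz).smul _)).sub
    ((hasValue_chEta_one_one' hv hz).smul _)).add ((hasValue_chEta_two_one hv hz).smul _)).smul
    _).sub ((hasValue_chEta_K00 hv hz).smul _), ?_⟩
  have := (((((hK.sub ((hasValue_U₁ hv hz).smul ((ℓ : ℂ) ^ 2)⁻¹)).add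
    ((hasValue_U₂ hv hz).smul (2 * ((ℓ : ℂ) ^ 3)⁻¹))).add
    ((hasValue_U₃ hv hz).smul ((ℓ : ℂ) ^ 3)⁻¹)).add
    ((hasValue_U₄ hv hz).smul ((ℓ : ℂ) ^ 3)⁻¹)).sub
    ((hasValue_U₅ hv hz).smul ((ℓ : ℂ) ^ 4)⁻¹)).add
    ((hasValue_U₆ hv hz).smul ((ℓ : ℂ) ^ 4)⁻¹)
  rw [hz.latticeSum_one_two_two, hz.latticeSum_one_one_two, hz.latticeSum_one_one_one,
    hz.latticeSum_one_zero_one, hz.latticeSum_gam_one_two, hz.latticeSum_gam_zero_two,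
    hz.latticeSum_gam'_one_one, hz.latticeSum_gam_zero_one,
    class_value_identity h0 h1 h2] at this
  exact this

end Cosets

end GSp4Tame

end

theorem mainTheorem5 (ℓ : ℕ) [Fact ℓ.Prime] {V : Type*} [AddCommGroup V] [Module ℂ V]
    (σ : Representation ℂ (GSp4Tame.GQ ℓ) V) (hσ : GSp4Tame.IsSmooth σ)
    (Z : GSp4Tame.HeckeTensor ℓ →ₗ[ℂ] GSp4Tame.Contragredient σ)
    (hZ : Z ∈ GSp4Tame.heckeHom ℓ σ) :
    ∃ w : GSp4Tame.Contragredient σ,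
      GSp4Tame.HasValueAtPhiInfty ℓ Z (GSp4Tame.xiSimple ℓ) w ∧
      GSp4Tame.HasValueAtPhiInfty ℓ Z (GSp4Tame.xi₀ ℓ)
        ((1 / ((ℓ : ℂ) ^ 4 * ((ℓ : ℂ) ^ 2 - 1))) • w) :=
  GSp4Tame.exists_hasValue_xiSimple_xi₀ Z
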